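/- Let $d\ge 2$. For $L>0$ let $Q_L=(-L/2,L/2)^{d-1}\times(0,L)\subset\mathbb R^d$, let $\underline{Q_L}=(-L/2,L/2)^{d-1}\times\{0\}$ be its bottom face, $\Gamma_L$ the rest of its boundary, $\nu$ the inner normal and $\mathbb T_L^{d-1}$ the torus obtained from $\underline{Q_L}$ by identifying opposite faces. Let $\mathcal A(Q_L)$ be the set of pairs $(u,\mathbf b)$ with $u\in \mathrm{BV}(\underline{Q_L})$ taking values in $\{-1,1\}$ a.e. and $\mathbf b\in \mathrm L^2(Q_L,\mathbb R^d)$ such that, in the sense of distributions, $\nabla\cdot\mathbf b=0$ in $Q_L$ and $\mathbf b\cdot\nu=u$ on $\underline{Q_L}$; that is, $\int_{Q_L}\mathbf b\cdot\nabla\zeta=-\int_{\underline{Q_L}}u\,\zeta$ for every $\zeta\in C_c^\infty(\mathbb R^d)$ with support in $(-L/2,L/2)^{d-1}\times(-\infty,L)$. Let $\mathcal A^0(Q_L)$ be the set of those $(u,\mathbf b)\in\mathcal A(Q_L)$ with moreover $\mathbf b\cdot\nu=0$ on $\Gamma_L$ in the sense of distributions, that is, for which the same identity holds for every $\zeta\in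 C^\infty_c(\mathbb R^d)$. Let $\mathcal A^{\mathrm{per}}(Q_L)$ be the set of horizontally $L$-periodic pairs $(u,\mathbf b)$ with $u\in\mathrm{BV}(\mathbb T_L^{d-1})$ taking values in $\{-1,1\}$ a.e. and $\mathbf b\in \mathrm L^2(\mathbb T_L^{d-1}\times(0,L),\mathbb R^d)$ for which the same identity holds for every smooth, horizontally $L$-periodic $\zeta$ on $\mathbb R^d$ with support in $\mathbb R^{d-1}\times(-\infty,L)$. Put $$E(u,\mathbf b,Q_L)=\int_{\underline{Q_L}}|\nabla u|+\int_{Q_L}\tfrac12|\mathbf b|^2,\qquad E^{\mathrm{per}}(u,\mathbf b,Q_L)=\int_{\mathbb T_L^{d-1}}|\nabla u|+\int_{\mathbb T_L^{d-1}\times(0,L)}\tfrac12|\mathbf b|^2,$$ where the first integrals denote total variations (on the torus, jumps across identified faces are counted), and $$\sigma(Q_L)=\inf_{\mathcal A(Q_L)}\frac{E(u,\mathbf b,Q_L)}{L^{d-1}},\quad \sigma^0(Q_L)=\inf_{\mathcal A^0(Q_L)}\frac{E(u,\mathbf b,Q_L)}{L^{d-1}},\quad \sigma^{\mathrm{per}}(Q_L)=\inf_{\mathcal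 A^{\mathrm{per}}(Q_L)}\frac{E^{\mathrm{per}}(u,\mathbf b,Q_L)}{L^{d-1}}.$$ **Lemma (Basic inequalities).** There exist constants $C,L_0\in(0,+\infty)$, depending only on $d$, such that for all $L\ge L_0$: 1. $\sigma(Q_L)\le\sigma^{\mathrm{per}}(Q_L)$ and $\sigma(Q_L)\le\sigma^0(Q_L)$; 2. $\sigma(Q_L)\le\sigma(Q_{kL})$ for each positive integer $k$; 3. $\sigma^0(Q_{kL})\le\sigma^0(Q_L)$ for each positive integer $k$; 4. $\sigma^0(Q_L)\le C$; 5. $\sigma(Q_L)\ge 1/C$; 6. $\sigma^{\mathrm{per}}(Q_L)\le\sigma(Q_L)+C/L$. -/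

import Mathlib

open MeasureTheory
open scoped ENNReal ContDiff

noncomputable section

namespace ThinCharge

/-- Euclidean space `ℝᵐ`. Throughout, the ambient dimension is `d = n + 1`: the field lives in
`Euc (n + 1)`, the charge lives on the hyperplane `{x_d = 0}`, identified with `Euc n`; the vertical
coordinate `x_d` has index `Fin.last n`, the horizontal ones have the indices `i.castSucc`. -/
abbrev Euc (m : ℕ) : Type := EuclideanSpace ℝ (Fin m)

/-- The bottom face `(-L/2, L/2)^(d-1)` of the cube, as a subset of `ℝ^(d-1)`. -/
def bottom (n : ℕ) (L : ℝ) : Set (Euc n) := {y | ∀ i, |y i| < L / 2}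

/-- The cube `Q_L = (-L/2, L/2)^(d-1) × (0, L)`. -/
def cube (n : ℕ) (L : ℝ) : Set (Euc (n + 1)) :=
  {x | (∀ i : Fin n, |x i.castSucc| < L / 2) ∧ 0 < x (Fin.last n) ∧ x (Fin.last n) < L}

/-- The inclusion `y ↦ (y, 0)` of the hyperplane. -/
def incl {n : ℕ} (y : Euc n) : Euc (n + 1) :=
  WithLp.toLp 2 (Fin.snoc (α := fun _ => ℝ) (fun i => y i) 0)

/-- The divergence of a vector field. -/
def divergence {m : ℕ} (φ : Euc m → Euc m) (y : Euc m) : ℝ :=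
  ∑ i, (fderiv ℝ φ y (EuclideanSpace.single i 1)) i

/-- A function on `ℝ^(d-1)` that is `L`-periodic in every coordinate direction,
i.e. a function on the torus `𝕋_L^(d-1)`. -/
def IsPeriodic {n : ℕ} {F : Type*} (L : ℝ) (f : Euc n → F) : Prop :=
  ∀ (y : Euc n) (i : Fin n), f (y + EuclideanSpace.single i L) = f y

/-- A function on `ℝ^d` that is `L`-periodic in every horizontal coordinate direction. -/
def IsHorPeriodic {n : ℕ} {F : Type*} (L : ℝ) (f : Euc (n + 1) → F) : Prop :=
  ∀ (x : Euc (n + 1)) (i : Fin n), f (x + EuclideanSpace.single i.castSucc L) = f x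

/-- The total variation `∫_Ω |∇u|` of `u` in the open set `Ω`. -/
def variation {n : ℕ} (Ω : Set (Euc n)) (u : Euc n → ℝ) : ℝ≥0∞ :=
  ⨆ (φ : Euc n → Euc n) (_ : ContDiff ℝ 1 φ ∧ HasCompactSupport φ ∧ tsupport φ ⊆ Ω ∧
    ∀ y, ‖φ y‖ ≤ 1), ENNReal.ofReal (∫ y in Ω, u y * divergence φ y)

/-- The total variation `∫_{𝕋_L^(d-1)} |∇u|` on the torus of an `L`-periodic function `u`: the test
fields are the periodic ones, so jumps of `u` across the boundary of the cell are counted. -/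
def variationPer {n : ℕ} (L : ℝ) (u : Euc n → ℝ) : ℝ≥0∞ :=
  ⨆ (φ : Euc n → Euc n) (_ : ContDiff ℝ 1 φ ∧ IsPeriodic L φ ∧ ∀ y, ‖φ y‖ ≤ 1),
    ENNReal.ofReal (∫ y in bottom n L, u y * divergence φ y)

/-- `u` is (a.e. equal to) a measurable function with values in `{-1, 1}` on the bottom face. -/
def IsCharge (n : ℕ) (L : ℝ) (u : Euc n → ℝ) : Prop :=
  AEStronglyMeasurable u (volume.restrict (bottom n L)) ∧
    ∀ᵐ y ∂volume.restrict (bottom n L), u y = 1 ∨ u y = -1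

/-- `∫_{Q_L} b · ∇ζ = - ∫_{bottom} u ζ`: the identity obtained by testing `∇ · b = 0` in `Q_L`
and `b · e_d = u` on the bottom face with `ζ`. -/
def TestedBy {n : ℕ} (L : ℝ) (u : Euc n → ℝ) (b : Euc (n + 1) → Euc (n + 1))
    (ζ : Euc (n + 1) → ℝ) : Prop :=
  ∫ x in cube n L, fderiv ℝ ζ x (b x) = - ∫ y in bottom n L, u y * ζ (incl y)

/-- The class `𝒜(Q_L)` (free boundary conditions): `u ∈ BV(bottom, ±1)`, `b ∈ L²(Q_L, ℝᵈ)`,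
`∇ · b = 0` in `Q_L` and `b · e_d = u` on the bottom face in the sense of distributions. The test
functions vanish near the rest `Γ_L` of the boundary of the cube. -/
def admissible (n : ℕ) (L : ℝ) : Set ((Euc n → ℝ) × (Euc (n + 1) → Euc (n + 1))) :=
  {p | IsCharge n L p.1 ∧ variation (bottom n L) p.1 < ⊤ ∧
    MemLp p.2 2 (volume.restrict (cube n L)) ∧
    ∀ ζ : Euc (n + 1) → ℝ, ContDiff ℝ ∞ ζ → HasCompactSupport ζ →
      tsupport ζ ⊆ {x | (∀ i : Fin n, |x i.castSucc| < L / 2) ∧ x (Fin.last n) < L} →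
      TestedBy L p.1 p.2 ζ}

/-- The class `𝒜⁰(Q_L)` (zero flux): in addition `b · ν = 0` on `Γ_L` in the sense of
distributions, that is, the test functions need not vanish near `Γ_L`. -/
def admissibleZero (n : ℕ) (L : ℝ) : Set ((Euc n → ℝ) × (Euc (n + 1) → Euc (n + 1))) :=
  {p | p ∈ admissible n L ∧
    ∀ ζ : Euc (n + 1) → ℝ, ContDiff ℝ ∞ ζ → HasCompactSupport ζ → TestedBy L p.1 p.2 ζ}

/-- The class `𝒜^per(Q_L)`: `u` lives on the torus `𝕋_L^(d-1)` and `b` on `𝕋_L^(d-1) × (0, L)`,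
with free boundary conditions on the top face. The test functions are horizontally periodic and
vanish near the top face. -/
def admissiblePer (n : ℕ) (L : ℝ) : Set ((Euc n → ℝ) × (Euc (n + 1) → Euc (n + 1))) :=
  {p | IsPeriodic L p.1 ∧ IsHorPeriodic L p.2 ∧ IsCharge n L p.1 ∧ variationPer L p.1 < ⊤ ∧
    MemLp p.2 2 (volume.restrict (cube n L)) ∧
    ∀ ζ : Euc (n + 1) → ℝ, ContDiff ℝ ∞ ζ → IsHorPeriodic L ζ →
      tsupport ζ ⊆ {x | x (Fin.last n) < L} → TestedBy L p.1 p.2 ζ}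

/-- The field energy `∫_{Q_L} |b|² / 2`. -/
def fieldEnergy (n : ℕ) (L : ℝ) (b : Euc (n + 1) → Euc (n + 1)) : ℝ≥0∞ :=
  ∫⁻ x in cube n L, ENNReal.ofReal (‖b x‖ ^ 2 / 2)

/-- The energy `E(u, b, Q_L)`. -/
def energy (n : ℕ) (L : ℝ) (p : (Euc n → ℝ) × (Euc (n + 1) → Euc (n + 1))) : ℝ≥0∞ :=
  variation (bottom n L) p.1 + fieldEnergy n L p.2

/-- The periodic energy `E^per(u, b, Q_L)`. -/
def energyPer (n : ℕ) (L : ℝ) (p : (Euc n → ℝ) × (Euc (n + 1) → Euc (n + 1))) : ℝ≥0∞ :=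
  variationPer L p.1 + fieldEnergy n L p.2

/-- The optimal energy density `σ(Q_L)` with free boundary conditions. -/
def sigma (n : ℕ) (L : ℝ) : ℝ≥0∞ :=
  ⨅ p ∈ admissible n L, energy n L p / ENNReal.ofReal (L ^ n)

/-- The optimal energy density `σ⁰(Q_L)` with zero flux boundary conditions. -/
def sigmaZero (n : ℕ) (L : ℝ) : ℝ≥0∞ :=
  ⨅ p ∈ admissibleZero n L, energy n L p / ENNReal.ofReal (L ^ n)

/-- The optimal energy density `σ^per(Q_L)` with periodic boundary conditions. -/
def sigmaPer (n : ℕ) (L : ℝ) : ℝ≥0∞ :=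
  ⨅ p ∈ admissiblePer n L, energyPer n L p / ENNReal.ofReal (L ^ n)

end ThinCharge

end

noncomputable section

namespace ThinCharge

open Filter Topology Set

/-! Write n = d - 1. The inequalities follow from cutting a competitor into cells, from even and odd
reflection, and from a duality argument for the lower bound.

Reflections never require traces of u or b. Testing a folded pair against ζ is the same as testing
the original pair, in one cell, against the signed sum of the pullbacks of ζ
(`setIntegral_foldField`, `setIntegral_foldCharge`); the same holds for the test fields of the total
variation (`setIntegral_foldCharge_divergence`). A reflection is therefore admissible as soon as the
unfolded test function is an admissible test function, and this is decided by cancellations on the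
faces of the cell.

Cutting: the variation is superadditive and the field energy additive over the k^n columns, so some
column carries at most the average (`exists_colAdmissible_subdivide`). This gives monotonicity of σ
along multiples. Even reflection: neighbouring copies agree on the common face, so no jump of u is
created, and a zero-flux field stays a zero-flux field; this gives monotonicity of σ⁰
(`sigmaZero_mul_le`). Odd reflection: u and b change sign across each face, which leaves the normal
component of b continuous whatever its boundary values are. A free competitor in a column of half
the width thus becomes periodic, at the price of jumps of u on faces of area of order L^(n-1), that
is C/L after normalisation (`exists_sigmaPer_le`).

Upper bound: for u = 1 an explicit field turns the incoming flux sideways through one face; odd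
reflection makes it a zero-flux competitor on cubes of side between 1 and 2, and monotonicity of σ⁰
reaches every L ≥ 1 (`exists_sigmaZero_le`).

Lower bound: since u² = 1, u tested against u times a bump has a fixed positive value m. Mollifying
the test function at a fixed scale costs at most a multiple of the variation
(`integral_sub_mollify_le`), and u tested against a function with controlled gradient is bounded by
the field energy (`exists_integral_mul_le`). Hence variation and field energy cannot both be small
on cubes of side between 1 and 2 (`exists_le_energy`), and monotonicity of σ does the rest.

The comparisons of σ with σ^per and σ⁰ are inclusions of classes; for the periodic one, compactly
supported test objects are extended periodically (`contDiff_comp_wrap`). -/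

/-! ### Coordinate reflections and the divergence. -/

/-- The coordinate sign change `y ↦ (ε i * y i)`. -/
def flip {m : ℕ} (ε : Fin m → ℤˣ) : Euc m ≃ₗᵢ[ℝ] Euc m :=
  LinearIsometryEquiv.piLpCongrRight 2 fun i =>
    if ε i = 1 then LinearIsometryEquiv.refl ℝ ℝ else LinearIsometryEquiv.neg ℝ

lemma flip_apply {m : ℕ} (ε : Fin m → ℤˣ) (y : Euc m) (i : Fin m) :
    flip ε y i = ((ε i : ℤ) : ℝ) * y i := by
  rcases Int.units_eq_one_or (ε i) with h | h <;> simp [flip, h]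

lemma units_cast_mul_self (e : ℤˣ) : ((e : ℤ) : ℝ) * ((e : ℤ) : ℝ) = 1 := by
  rcases Int.units_eq_one_or e with h | h <;> simp [h]

lemma abs_units_cast (e : ℤˣ) : |((e : ℤ) : ℝ)| = 1 := by
  rcases Int.units_eq_one_or e with h | h <;> simp [h]

lemma flip_one {m : ℕ} (y : Euc m) : flip (fun _ => 1) y = y := by
  ext i
  simp [flip_apply]

/-- The affine isometry `y ↦ (ε i * y i + a i)`. -/
def aff {m : ℕ} (ε : Fin m → ℤˣ) (a : Euc m) : Euc m ≃ᵢ Euc m :=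
  (flip ε).toIsometryEquiv.trans (IsometryEquiv.addRight a)

lemma aff_apply {m : ℕ} (ε : Fin m → ℤˣ) (a y : Euc m) : aff ε a y = flip ε y + a := rfl

lemma aff_coord {m : ℕ} (ε : Fin m → ℤˣ) (a y : Euc m) (i : Fin m) :
    aff ε a y i = ((ε i : ℤ) : ℝ) * y i + a i := by
  rw [aff_apply, PiLp.add_apply, flip_apply]

lemma measurePreserving_aff {m : ℕ} (ε : Fin m → ℤˣ) (a : Euc m) :
    MeasurePreserving (aff ε a) volume volume :=
  (measurePreserving_add_right volume a).comp (flip ε).measurePreserving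

lemma measurableEmbedding_aff {m : ℕ} (ε : Fin m → ℤˣ) (a : Euc m) :
    MeasurableEmbedding (aff ε a) :=
  (aff ε a).toHomeomorph.measurableEmbedding

lemma contDiff_aff {m : ℕ} (ε : Fin m → ℤˣ) (a : Euc m) {r : WithTop ℕ∞} :
    ContDiff ℝ r (aff ε a) :=
  (flip ε).contDiff.add contDiff_const

lemma hasFDerivAt_aff {m : ℕ} (ε : Fin m → ℤˣ) (a y : Euc m) :
    HasFDerivAt (aff ε a) ((flip ε).toContinuousLinearEquiv : Euc m →L[ℝ] Euc m) y :=
  ((flip ε).toContinuousLinearEquiv.hasFDerivAt).add_const a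

lemma fderiv_comp_aff {m : ℕ} {F : Type*} [NormedAddCommGroup F] [NormedSpace ℝ F]
    (ε : Fin m → ℤˣ) (a y v : Euc m) {f : Euc m → F} (hf : Differentiable ℝ f) :
    fderiv ℝ (fun y => f (aff ε a y)) y v = fderiv ℝ f (aff ε a y) (flip ε v) := by
  have := ((hf (aff ε a y)).hasFDerivAt.comp y (hasFDerivAt_aff ε a y)).fderiv
  change fderiv ℝ (f ∘ aff ε a) y v = _
  rw [this]
  rfl

lemma flip_single {m : ℕ} (ε : Fin m → ℤˣ) (i : Fin m) (t : ℝ) :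
    flip ε (EuclideanSpace.single i t) = ((ε i : ℤ) : ℝ) • EuclideanSpace.single i t := by
  ext j
  rw [flip_apply, PiLp.smul_apply, smul_eq_mul]
  by_cases h : j = i
  · subst h; simp
  · simp [h]

/-- In the `i`-th term the sign `ε i` occurs twice, from the inner derivative and from the outer
reflection, and its square is one. -/
lemma divergence_flip_comp_aff {m : ℕ} (ε : Fin m → ℤˣ) (a y : Euc m) {φ : Euc m → Euc m}
    (hφ : Differentiable ℝ φ) :
    divergence (fun y => flip ε (φ (aff ε a y))) y = divergence φ (aff ε a y) := by
  unfold divergence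
  refine Finset.sum_congr rfl fun i _ => ?_
  have h1 : fderiv ℝ (fun y => flip ε (φ (aff ε a y))) y (EuclideanSpace.single i 1)
      = flip ε (fderiv ℝ (fun y => φ (aff ε a y)) y (EuclideanSpace.single i 1)) := by
    have hd : DifferentiableAt ℝ (fun y => φ (aff ε a y)) y :=
      (hφ (aff ε a y)).comp y (hasFDerivAt_aff ε a y).differentiableAt
    have := ((flip ε).toContinuousLinearEquiv.hasFDerivAt.comp y hd.hasFDerivAt).fderiv
    change fderiv ℝ ((flip ε).toContinuousLinearEquiv ∘ fun y => φ (aff ε a y)) y _ = _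
    rw [this]
    rfl
  rw [h1, fderiv_comp_aff _ _ _ _ hφ, flip_single, map_smul, map_smul, PiLp.smul_apply, flip_apply,
    smul_eq_mul, ← mul_assoc, units_cast_mul_self, one_mul]

lemma divergence_const_smul {m : ℕ} (r : ℝ) {φ : Euc m → Euc m} {y : Euc m}
    (hφ : DifferentiableAt ℝ φ y) :
    divergence (fun y => r • φ y) y = r * divergence φ y := by
  unfold divergence
  rw [Finset.mul_sum]
  refine Finset.sum_congr rfl fun i _ => ?_
  rw [fderiv_fun_const_smul hφ]
  simp

lemma divergence_sum {m : ℕ} {ι : Type*} (s : Finset ι) {φ : ι → Euc m → Euc m} {y : Euc m}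
    (hφ : ∀ c ∈ s, DifferentiableAt ℝ (φ c) y) :
    divergence (fun y => ∑ c ∈ s, φ c y) y = ∑ c ∈ s, divergence (φ c) y := by
  unfold divergence
  rw [Finset.sum_comm]
  refine Finset.sum_congr rfl fun i _ => ?_
  rw [fderiv_fun_sum hφ]
  simp

lemma divergence_mul {m : ℕ} {η : Euc m → ℝ} {φ : Euc m → Euc m} {y : Euc m}
    (hη : DifferentiableAt ℝ η y) (hφ : DifferentiableAt ℝ φ y) :
    divergence (fun y => η y • φ y) y = η y * divergence φ y + fderiv ℝ η y (φ y) := by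
  unfold divergence
  have h2 : φ y = ∑ i, φ y i • EuclideanSpace.single i (1 : ℝ) := by
    ext j
    simp [Finset.sum_apply, Pi.single_apply]
  have h3 : fderiv ℝ η y (φ y) = ∑ i, φ y i * fderiv ℝ η y (EuclideanSpace.single i 1) := by
    conv_lhs => rw [h2]
    simp [map_sum]
  rw [h3, Finset.mul_sum, ← Finset.sum_add_distrib]
  refine Finset.sum_congr rfl fun i _ => ?_
  rw [fderiv_fun_smul hη hφ]
  simp [mul_comm]

lemma continuous_divergence {m : ℕ} {φ : Euc m → Euc m} (hφ : ContDiff ℝ 1 φ) :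
    Continuous (divergence φ) := by
  unfold divergence
  have := hφ.continuous_fderiv one_ne_zero
  fun_prop

/-! ### Integration over a set tiled by isometric copies of a cell. -/

lemma volume_hyperplane {m : ℕ} (i : Fin m) (t : ℝ) : volume {x : Euc m | x i = t} = 0 := by
  have h := (EuclideanSpace.volume_preserving_symm_measurableEquiv_toLp (Fin m)).measure_preimage
    (s := {f : Fin m → ℝ | f i = t})
    (measurableSet_eq_fun (measurable_pi_apply i) measurable_const).nullMeasurableSet
  rw [volume_pi, Measure.pi_hyperplane] at h
  exact h

/-- A set which is almost covered by disjoint isometric copies of `S` carries the sum of the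
transported measures. -/
lemma restrict_eq_sum_map {m : ℕ} {ι : Type*} (s : Finset ι) (ε : ι → Fin m → ℤˣ) (a : ι → Euc m)
    {S T : Set (Euc m)} (hS : MeasurableSet S)
    (hsub : ∀ c ∈ s, ∀ x ∈ S, aff (ε c) (a c) x ∈ T)
    (hdisj : ∀ c ∈ s, ∀ c' ∈ s, ∀ x ∈ S, ∀ x' ∈ S,
      aff (ε c) (a c) x = aff (ε c') (a c') x' → c = c')
    (hcov : ∀ᵐ x : Euc m, x ∈ T → ∃ c ∈ s, ∃ y ∈ S, aff (ε c) (a c) y = x) :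
    (volume : Measure (Euc m)).restrict T
      = ∑ c ∈ s, (volume.restrict S).map (aff (ε c) (a c)) := by
  have h1 : ∀ c, (volume.restrict S).map (aff (ε c) (a c))
      = volume.restrict (aff (ε c) (a c) '' S) := fun c =>
    ((measurePreserving_aff (ε c) (a c)).restrict_image_emb
      (measurableEmbedding_aff (ε c) (a c)) S).map_eq
  simp_rw [h1]
  have h2 : (T : Set (Euc m)) =ᵐ[volume] ⋃ c ∈ s, aff (ε c) (a c) '' S := by
    filter_upwards [hcov] with x hx
    apply propext
    change x ∈ T ↔ x ∈ ⋃ c ∈ s, aff (ε c) (a c) '' S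
    simp only [mem_iUnion, mem_image]
    constructor
    · intro hxT
      obtain ⟨c, hc, y, hy, rfl⟩ := hx hxT
      exact ⟨c, hc, y, hy, rfl⟩
    · rintro ⟨c, hc, y, hy, rfl⟩
      exact hsub c hc y hy
  rw [Measure.restrict_congr_set h2, Measure.restrict_biUnion_finset]
  · rw [Measure.sum_fintype, Finset.univ_eq_attach,
      Finset.sum_attach s (fun c => volume.restrict (aff (ε c) (a c) '' S))]
  · intro c hc c' hc' hne
    rw [Function.onFun, Set.disjoint_left]
    rintro _ ⟨x, hx, rfl⟩ ⟨x', hx', h⟩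
    exact hne (hdisj c hc c' hc' x hx x' hx' h.symm)
  · exact fun c => (measurableEmbedding_aff (ε c) (a c)).measurableSet_image.2 hS

section CellIntegrals

variable {m : ℕ} {ι : Type*} {s : Finset ι} {ε : ι → Fin m → ℤˣ} {a : ι → Euc m}
  {S T : Set (Euc m)}

lemma setLIntegral_cells
    (h : (volume : Measure (Euc m)).restrict T
      = ∑ c ∈ s, (volume.restrict S).map (aff (ε c) (a c))) (f : Euc m → ℝ≥0∞) :
    ∫⁻ x in T, f x = ∑ c ∈ s, ∫⁻ y in S, f (aff (ε c) (a c) y) := by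
  rw [h, lintegral_finsetSum_measure]
  exact Finset.sum_congr rfl fun c _ => (measurableEmbedding_aff _ _).lintegral_map _

lemma integrableOn_cells {F : Type*} [NormedAddCommGroup F]
    (h : (volume : Measure (Euc m)).restrict T
      = ∑ c ∈ s, (volume.restrict S).map (aff (ε c) (a c))) {f : Euc m → F}
    (hf : ∀ c ∈ s, IntegrableOn (fun y => f (aff (ε c) (a c) y)) S) : IntegrableOn f T := by
  rw [IntegrableOn, h, integrable_finsetSum_measure]
  exact fun c hc => (measurableEmbedding_aff _ _).integrable_map_iff.2 (hf c hc)

lemma setIntegral_cells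
    (h : (volume : Measure (Euc m)).restrict T
      = ∑ c ∈ s, (volume.restrict S).map (aff (ε c) (a c))) {f : Euc m → ℝ}
    (hf : ∀ c ∈ s, IntegrableOn (fun y => f (aff (ε c) (a c) y)) S) :
    ∫ x in T, f x = ∑ c ∈ s, ∫ y in S, f (aff (ε c) (a c) y) := by
  rw [h, integral_finsetSum_measure
    (fun c hc => (measurableEmbedding_aff _ _).integrable_map_iff.2 (hf c hc))]
  exact Finset.sum_congr rfl fun c _ => (measurableEmbedding_aff _ _).integral_map _

lemma ae_cells
    (h : (volume : Measure (Euc m)).restrict T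
      = ∑ c ∈ s, (volume.restrict S).map (aff (ε c) (a c))) {P : Euc m → Prop}
    (hP : ∀ c ∈ s, ∀ᵐ y ∂volume.restrict S, P (aff (ε c) (a c) y)) :
    ∀ᵐ x ∂volume.restrict T, P x := by
  rw [h, ae_iff, Measure.finsetSum_apply, Finset.sum_eq_zero]
  intro c hc
  rw [← ae_iff, (measurableEmbedding_aff _ _).ae_map_iff]
  exact hP c hc

lemma aestronglyMeasurable_cells {F : Type*} [NormedAddCommGroup F]
    (h : (volume : Measure (Euc m)).restrict T
      = ∑ c ∈ s, (volume.restrict S).map (aff (ε c) (a c))) {f : Euc m → F}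
    (hf : ∀ c ∈ s, AEStronglyMeasurable (fun y => f (aff (ε c) (a c) y)) (volume.restrict S)) :
    AEStronglyMeasurable f (volume.restrict T) := by
  classical
  rw [h]
  clear h
  induction s using Finset.induction_on with
  | empty => simp
  | insert c s hc ih =>
    rw [Finset.sum_insert hc, aestronglyMeasurable_add_measure_iff]
    refine ⟨(measurableEmbedding_aff _ _).aestronglyMeasurable_map_iff.2
      (hf c (Finset.mem_insert_self c s)), ih fun c' hc' => hf c' (Finset.mem_insert_of_mem hc')⟩

end CellIntegrals

/-! ### Columns and the grid of cells. -/

/-- The column `(-l/2, l/2)^(d-1) × (0, h)`. -/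
def col (n : ℕ) (l h : ℝ) : Set (Euc (n + 1)) :=
  {x | (∀ i : Fin n, |x i.castSucc| < l / 2) ∧ 0 < x (Fin.last n) ∧ x (Fin.last n) < h}

lemma isOpen_bottom (n : ℕ) (l : ℝ) : IsOpen (bottom n l) := by
  have : bottom n l = ⋂ i, {y | |y i| < l / 2} := by ext; simp [bottom]
  rw [this]
  exact isOpen_iInter_of_finite fun i => isOpen_lt (by fun_prop) continuous_const

lemma isOpen_col (n : ℕ) (l h : ℝ) : IsOpen (col n l h) := by
  have : col n l h = (⋂ i : Fin n, {x | |x i.castSucc| < l / 2}) ∩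
      ({x | 0 < x (Fin.last n)} ∩ {x | x (Fin.last n) < h}) := by ext; simp [col]
  rw [this]
  refine (isOpen_iInter_of_finite fun i => isOpen_lt (by fun_prop) continuous_const).inter
    ((isOpen_lt continuous_const (by fun_prop)).inter (isOpen_lt (by fun_prop) continuous_const))

lemma isBounded_of_coord_le {m : ℕ} {S : Set (Euc m)} (R : ℝ) (h : ∀ x ∈ S, ∀ i, |x i| ≤ R) :
    Bornology.IsBounded S := by
  refine isBounded_iff_forall_norm_le.2 ⟨√(∑ _i : Fin m, R ^ 2), fun x hx => ?_⟩
  rw [EuclideanSpace.norm_eq]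
  refine Real.sqrt_le_sqrt (Finset.sum_le_sum fun i _ => ?_)
  rw [Real.norm_eq_abs, sq_abs]
  exact sq_le_sq' (by linarith [(abs_le.1 (h x hx i)).1]) (abs_le.1 (h x hx i)).2

lemma isBounded_bottom (n : ℕ) (l : ℝ) : Bornology.IsBounded (bottom n l) :=
  isBounded_of_coord_le (l / 2) fun _ hx i => (hx i).le

lemma isBounded_col (n : ℕ) (l h : ℝ) : Bornology.IsBounded (col n l h) := by
  refine isBounded_of_coord_le (max (l / 2) h) fun x hx i => ?_
  refine Fin.lastCases ?_ (fun i => ?_) i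
  · rw [abs_of_pos hx.2.1]
    exact hx.2.2.le.trans (le_max_right _ _)
  · exact (hx.1 i).le.trans (le_max_left _ _)

/-- The centre of the cell number `m` in the subdivision of `(-k l/2, k l/2)` into `k` intervals
of length `l`. -/
def ctr (k : ℕ) (l : ℝ) (m : ℤ) : ℝ := l * (m + 1 / 2 - k / 2)

/-- The number of the cell that contains `t`. -/
def cellNum (k : ℕ) (l t : ℝ) : ℤ := ⌊t / l + k / 2⌋

lemma cellNum_eq {k : ℕ} {l t : ℝ} (hl : 0 < l) {m : ℤ} (e : ℤˣ) (ht : |t| < l / 2) :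
    cellNum k l (((e : ℤ) : ℝ) * t + ctr k l m) = m := by
  have h : |((e : ℤ) : ℝ) * t| < l / 2 := by rwa [abs_mul, abs_units_cast, one_mul]
  obtain ⟨h1, h2⟩ := abs_lt.1 h
  rw [cellNum, Int.floor_eq_iff]
  have h3 : (((e : ℤ) : ℝ) * t + ctr k l m) / l + k / 2 = ((e : ℤ) : ℝ) * t / l + m + 1 / 2 := by
    unfold ctr; field_simp; ring
  rw [h3]
  have h4 : -(1 / 2) < ((e : ℤ) : ℝ) * t / l := by rw [lt_div_iff₀ hl]; linarith
  have h5 : ((e : ℤ) : ℝ) * t / l < 1 / 2 := by rw [div_lt_iff₀ hl]; linarith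
  constructor <;> linarith

lemma abs_cell_lt {k : ℕ} {l t : ℝ} (hl : 0 < l) {m : ℤ} (hm : m ∈ Finset.Ico (0 : ℤ) k) (e : ℤˣ)
    (ht : |t| < l / 2) : |((e : ℤ) : ℝ) * t + ctr k l m| < k * l / 2 := by
  have h : |((e : ℤ) : ℝ) * t| < l / 2 := by rwa [abs_mul, abs_units_cast, one_mul]
  obtain ⟨h1, h2⟩ := abs_lt.1 h
  obtain ⟨h3, h4⟩ := Finset.mem_Ico.1 hm
  have h5 : (0 : ℝ) ≤ m := by exact_mod_cast h3
  have h6 : (m : ℝ) + 1 ≤ k := by exact_mod_cast h4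
  have h7 := mul_le_mul_of_nonneg_left h6 hl.le
  have h8 := mul_nonneg hl.le h5
  rw [abs_lt]
  unfold ctr
  constructor <;> nlinarith

lemma cellNum_mem {k : ℕ} {l t : ℝ} (hl : 0 < l) (ht : |t| < k * l / 2) :
    cellNum k l t ∈ Finset.Ico (0 : ℤ) k := by
  obtain ⟨h1, h2⟩ := abs_lt.1 ht
  have h3 : -(k / 2 : ℝ) < t / l := by rw [lt_div_iff₀ hl]; linarith
  have h4 : t / l < k / 2 := by rw [div_lt_iff₀ hl]; linarith
  rw [Finset.mem_Ico, cellNum]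
  exact ⟨Int.floor_nonneg.2 (by linarith), Int.floor_lt.2 (by push_cast; linarith)⟩

/-- The floor gives one weak inequality; excluding the grid points makes it strict, so that the
point lies in an open cell. -/
lemma abs_sub_ctr_lt {k : ℕ} {l t : ℝ} (hl : 0 < l) (ht : ∀ m : ℤ, t ≠ l * (m - k / 2)) :
    |t - ctr k l (cellNum k l t)| < l / 2 := by
  have h1 : ((cellNum k l t : ℤ) : ℝ) ≤ t / l + k / 2 := Int.floor_le _
  have h2 : t / l + k / 2 < cellNum k l t + 1 := Int.lt_floor_add_one _
  have h3 : ((cellNum k l t : ℤ) : ℝ) ≠ t / l + k / 2 := by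
    intro h
    apply ht (cellNum k l t)
    rw [h]; field_simp; ring
  have h4 : ((cellNum k l t : ℤ) : ℝ) < t / l + k / 2 := lt_of_le_of_ne h1 h3
  have h5 : t = l * (t / l) := by field_simp
  have h6 := mul_lt_mul_of_pos_left h4 hl
  have h7 := mul_lt_mul_of_pos_left h2 hl
  rw [abs_lt]
  unfold ctr
  constructor <;> nlinarith

/-- The indices of the `k^n` cells of the subdivided bottom face. -/
def cells (n k : ℕ) : Finset (Fin n → ℤ) := Fintype.piFinset fun _ => Finset.Ico (0 : ℤ) k

lemma card_cells (n k : ℕ) : (cells n k).card = k ^ n := by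
  simp [cells]

/-- The isometry of the cell at the origin onto the cell number `c` of the bottom face. -/
def cellMap {n : ℕ} (σ : ℤ → ℤˣ) (k : ℕ) (l : ℝ) (c : Fin n → ℤ) : Euc n ≃ᵢ Euc n :=
  aff (fun i => σ (c i)) (WithLp.toLp 2 fun i => ctr k l (c i))

/-- The signs of the horizontal isometry of `ℝ^d` for the cell number `c`. -/
def sgnH {n : ℕ} (σ : ℤ → ℤˣ) (c : Fin n → ℤ) : Fin (n + 1) → ℤˣ :=
  Fin.snoc (α := fun _ => ℤˣ) (fun i => σ (c i)) 1

/-- The centre of the cell number `c`, as a point of `ℝ^d`. -/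
def ctrH {n : ℕ} (k : ℕ) (l : ℝ) (c : Fin n → ℤ) : Euc (n + 1) :=
  WithLp.toLp 2 (Fin.snoc (α := fun _ => ℝ) (fun i => ctr k l (c i)) 0)

/-- The isometry of the column over the cell at the origin onto the column over the cell `c`. -/
def cellMapH {n : ℕ} (σ : ℤ → ℤˣ) (k : ℕ) (l : ℝ) (c : Fin n → ℤ) :
    Euc (n + 1) ≃ᵢ Euc (n + 1) :=
  aff (sgnH σ c) (ctrH k l c)

section

variable {n : ℕ} (σ : ℤ → ℤˣ) (k : ℕ) (l : ℝ) (c : Fin n → ℤ)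

lemma cellMap_coord (y : Euc n) (i : Fin n) :
    cellMap σ k l c y i = ((σ (c i) : ℤ) : ℝ) * y i + ctr k l (c i) := aff_coord _ _ _ _

lemma cellMapH_castSucc (x : Euc (n + 1)) (i : Fin n) :
    cellMapH σ k l c x i.castSucc = ((σ (c i) : ℤ) : ℝ) * x i.castSucc + ctr k l (c i) := by
  rw [cellMapH, aff_coord]
  simp [sgnH, ctrH]

lemma cellMapH_last (x : Euc (n + 1)) : cellMapH σ k l c x (Fin.last n) = x (Fin.last n) := by
  rw [cellMapH, aff_coord]
  simp [sgnH, ctrH]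

lemma incl_castSucc (y : Euc n) (i : Fin n) : incl y i.castSucc = y i := by
  simp [incl]

lemma incl_last (y : Euc n) : incl y (Fin.last n) = 0 := by
  simp [incl]

lemma cellMapH_incl (y : Euc n) : cellMapH σ k l c (incl y) = incl (cellMap σ k l c y) := by
  ext i
  refine Fin.lastCases ?_ (fun i => ?_) i
  · rw [cellMapH_last, incl_last, incl_last]
  · rw [cellMapH_castSucc, incl_castSucc, incl_castSucc, cellMap_coord]

/-- The horizontal part of a point of `ℝ^d`. -/
def hor (x : Euc (n + 1)) : Euc n := WithLp.toLp 2 fun i => x i.castSucc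

lemma hor_apply (x : Euc (n + 1)) (i : Fin n) : hor x i = x i.castSucc := rfl

/-- The number of the cell that contains `y`. -/
def idx (y : Euc n) : Fin n → ℤ := fun i => cellNum k l (y i)

variable {l}

lemma idx_cellMap (hl : 0 < l) {y : Euc n} (hy : y ∈ bottom n l) :
    idx k l (cellMap σ k l c y) = c := by
  funext i
  rw [idx, cellMap_coord, cellNum_eq hl _ (hy i)]

lemma idx_cellMapH (hl : 0 < l) {h : ℝ} {x : Euc (n + 1)} (hx : x ∈ col n l h) :
    idx k l (hor (cellMapH σ k l c x)) = c := by
  funext i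
  rw [idx, hor_apply, cellMapH_castSucc, cellNum_eq hl _ (hx.1 i)]

variable {c k}

lemma cellMap_mem (hl : 0 < l) (hc : c ∈ cells n k) {y : Euc n} (hy : y ∈ bottom n l) :
    cellMap σ k l c y ∈ bottom n (k * l) := by
  intro i
  rw [cellMap_coord]
  exact abs_cell_lt hl (Fintype.mem_piFinset.1 hc i) _ (hy i)

lemma cellMapH_mem (hl : 0 < l) (hc : c ∈ cells n k) {h : ℝ} {x : Euc (n + 1)}
    (hx : x ∈ col n l h) : cellMapH σ k l c x ∈ col n (k * l) h := by
  refine ⟨fun i => ?_, ?_⟩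
  · rw [cellMapH_castSucc]
    exact abs_cell_lt hl (Fintype.mem_piFinset.1 hc i) _ (hx.1 i)
  · rw [cellMapH_last]
    exact hx.2

lemma ae_avoid_grid {m : ℕ} (k : ℕ) (l : ℝ) :
    ∀ᵐ x : Euc m, ∀ i, ∀ r : ℤ, x i ≠ l * (r - k / 2) := by
  rw [ae_all_iff]
  intro i
  rw [ae_all_iff]
  intro r
  rw [ae_iff]
  simpa using volume_hyperplane i (l * (r - k / 2))

variable (k n)

/-- The function `idx` recovers the cell from a point of it, which yields disjointness, and names
the cell to use for coverage off the grid hyperplanes, a null set. -/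
lemma restrict_bottom_eq (hl : 0 < l) :
    (volume : Measure (Euc n)).restrict (bottom n (k * l))
      = ∑ c ∈ cells n k, (volume.restrict (bottom n l)).map
        (aff (fun i => σ (c i)) (WithLp.toLp 2 fun i => ctr k l (c i))) := by
  refine restrict_eq_sum_map _ _ _ (isOpen_bottom n l).measurableSet
    (fun c hc x hx => cellMap_mem σ hl hc hx) ?_ ?_
  · intro c _ c' _ x hx x' hx' h
    rw [← idx_cellMap σ k c hl hx, ← idx_cellMap σ k c' hl hx']
    exact congrArg _ h
  · filter_upwards [ae_avoid_grid k l] with x hx hxT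
    refine ⟨idx k l x, Fintype.mem_piFinset.2 fun i => cellNum_mem hl (hxT i),
      (cellMap σ k l (idx k l x)).symm x, fun i => ?_,
      (cellMap σ k l (idx k l x)).apply_symm_apply x⟩
    have h1 := cellMap_coord σ k l (idx k l x) ((cellMap σ k l (idx k l x)).symm x) i
    rw [IsometryEquiv.apply_symm_apply] at h1
    have h2 := abs_sub_ctr_lt hl (hx i)
    rw [h1] at h2
    rw [← h1] at h2
    change |x i - ctr k l (idx k l x i)| < l / 2 at h2
    rwa [h1, add_sub_cancel_right, abs_mul, abs_units_cast, one_mul] at h2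

lemma restrict_col_eq (hl : 0 < l) (h : ℝ) :
    (volume : Measure (Euc (n + 1))).restrict (col n (k * l) h)
      = ∑ c ∈ cells n k, (volume.restrict (col n l h)).map (aff (sgnH σ c) (ctrH k l c)) := by
  refine restrict_eq_sum_map _ _ _ (isOpen_col n l h).measurableSet
    (fun c hc x hx => cellMapH_mem σ hl hc hx) ?_ ?_
  · intro c _ c' _ x hx x' hx' he
    rw [← idx_cellMapH σ k c hl hx, ← idx_cellMapH σ k c' hl hx']
    exact congrArg (fun z => idx k l (hor z)) he
  -- The vertical coordinate is made to avoid the grid values too; this is harmless, since only a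
  -- null set is lost.
  · filter_upwards [ae_avoid_grid k l] with x hx hxT
    set A := cellMapH σ k l (idx k l (hor x)) with hA
    refine ⟨idx k l (hor x), Fintype.mem_piFinset.2 fun i => cellNum_mem hl (hxT.1 i),
      A.symm x, ⟨fun i => ?_, ?_⟩, A.apply_symm_apply x⟩
    · have h1 := cellMapH_castSucc σ k l (idx k l (hor x)) (A.symm x) i
      rw [← hA, IsometryEquiv.apply_symm_apply] at h1
      have h2 := abs_sub_ctr_lt hl (hx i.castSucc)
      change |x i.castSucc - ctr k l (idx k l (hor x) i)| < l / 2 at h2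
      rwa [h1, add_sub_cancel_right, abs_mul, abs_units_cast, one_mul] at h2
    · have h1 := cellMapH_last σ k l (idx k l (hor x)) (A.symm x)
      rw [← hA, IsometryEquiv.apply_symm_apply] at h1
      rw [← h1]
      exact hxT.2

end

/-! ### Folding of charges and fields, unfolding of test functions. -/

lemma exists_bound_of_isBounded {m : ℕ} {F : Type*} [NormedAddCommGroup F] {S : Set (Euc m)}
    (hS : Bornology.IsBounded S) {g : Euc m → F} (hg : Continuous g) :
    ∃ M : ℝ, 0 ≤ M ∧ ∀ x ∈ S, ‖g x‖ ≤ M := by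
  obtain ⟨M, hM⟩ := hS.isCompact_closure.exists_bound_of_continuousOn hg.continuousOn
  exact ⟨max M 0, le_max_right _ _, fun x hx => (hM x (subset_closure hx)).trans (le_max_left _ _)⟩

lemma volume_lt_top_of_isBounded {m : ℕ} {S : Set (Euc m)} (hS : Bornology.IsBounded S) :
    volume S < ⊤ :=
  hS.measure_lt_top

lemma IsCharge.ae_abs_eq {n : ℕ} {l : ℝ} {u : Euc n → ℝ} (hu : IsCharge n l u) :
    ∀ᵐ y ∂volume.restrict (bottom n l), |u y| = 1 := by
  filter_upwards [hu.2] with y hy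
  rcases hy with h | h <;> simp [h]

lemma IsCharge.integrableOn_mul {n : ℕ} {l : ℝ} {u : Euc n → ℝ} (hu : IsCharge n l u)
    {g : Euc n → ℝ} (hg : Continuous g) : IntegrableOn (fun y => u y * g y) (bottom n l) := by
  obtain ⟨M, -, hM⟩ := exists_bound_of_isBounded (isBounded_bottom n l) hg
  refine IntegrableOn.of_bound (volume_lt_top_of_isBounded (isBounded_bottom n l))
    (hu.1.mul hg.aestronglyMeasurable) M ?_
  filter_upwards [hu.ae_abs_eq, ae_restrict_mem (isOpen_bottom n l).measurableSet] with y hy hyS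
  rw [norm_mul, Real.norm_eq_abs, hy, one_mul]
  exact hM y hyS

lemma integrableOn_of_memLp_two {m : ℕ} {S : Set (Euc m)} (hS : Bornology.IsBounded S)
    {b : Euc m → Euc m} (hb : MemLp b 2 (volume.restrict S)) : IntegrableOn b S := by
  have : IsFiniteMeasure (volume.restrict S) :=
    isFiniteMeasure_restrict.2 (volume_lt_top_of_isBounded hS).ne
  exact hb.integrable (by norm_num)

lemma integrableOn_apply {m : ℕ} {S : Set (Euc m)} (hS : Bornology.IsBounded S)
    (hSm : MeasurableSet S)
    {b : Euc m → Euc m} (hb : IntegrableOn b S) {Λ : Euc m → Euc m →L[ℝ] ℝ}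
    (hΛ : Continuous Λ) : IntegrableOn (fun x => Λ x (b x)) S := by
  obtain ⟨M, -, hM⟩ := exists_bound_of_isBounded hS hΛ
  refine (hb.norm.const_mul M).mono' ?_ ?_
  · exact (isBoundedBilinearMap_apply.continuous.comp_aestronglyMeasurable
      (hΛ.aestronglyMeasurable.prodMk hb.1))
  · filter_upwards [ae_restrict_mem hSm] with x hx
    exact (Λ x).le_of_opNorm_le (hM x hx) _

/-- The charge obtained from a charge on the cell at the origin by reflections (`σ` gives the
orientation, `w` the sign on the single cells). -/
def foldCharge {n : ℕ} (σ : ℤ → ℤˣ) (w : (Fin n → ℤ) → ℤˣ) (k : ℕ) (l : ℝ) (u : Euc n → ℝ)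
    (y : Euc n) : ℝ :=
  ((w (idx k l y) : ℤ) : ℝ) * u ((cellMap σ k l (idx k l y)).symm y)

/-- The field obtained from a field in the column at the origin by reflections. -/
def foldField {n : ℕ} (σ : ℤ → ℤˣ) (w : (Fin n → ℤ) → ℤˣ) (k : ℕ) (l : ℝ)
    (b : Euc (n + 1) → Euc (n + 1)) (x : Euc (n + 1)) : Euc (n + 1) :=
  ((w (idx k l (hor x)) : ℤ) : ℝ) • flip (sgnH σ (idx k l (hor x)))
    (b ((cellMapH σ k l (idx k l (hor x))).symm x))

/-- The test function on the cell at the origin that corresponds to `ζ`. -/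
def unfoldTest {n : ℕ} (σ : ℤ → ℤˣ) (w : (Fin n → ℤ) → ℤˣ) (k : ℕ) (l : ℝ)
    (ζ : Euc (n + 1) → ℝ) (x : Euc (n + 1)) : ℝ :=
  ∑ c ∈ cells n k, ((w c : ℤ) : ℝ) * ζ (cellMapH σ k l c x)

/-- The test field on the cell at the origin that corresponds to `φ`. -/
def unfoldVec {n : ℕ} (σ : ℤ → ℤˣ) (w : (Fin n → ℤ) → ℤˣ) (k : ℕ) (l : ℝ)
    (φ : Euc n → Euc n) (y : Euc n) : Euc n :=
  ∑ c ∈ cells n k, ((w c : ℤ) : ℝ) • flip (fun i => σ (c i)) (φ (cellMap σ k l c y))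

section

variable {n : ℕ} (σ : ℤ → ℤˣ) (w : (Fin n → ℤ) → ℤˣ) (k : ℕ) {l h : ℝ}
  {u : Euc n → ℝ} {b : Euc (n + 1) → Euc (n + 1)}

lemma foldCharge_cellMap (hl : 0 < l) (c : Fin n → ℤ) {y : Euc n} (hy : y ∈ bottom n l) :
    foldCharge σ w k l u (cellMap σ k l c y) = ((w c : ℤ) : ℝ) * u y := by
  rw [foldCharge, idx_cellMap σ k c hl hy, IsometryEquiv.symm_apply_apply]

lemma foldField_cellMapH (hl : 0 < l) (c : Fin n → ℤ) {x : Euc (n + 1)} (hx : x ∈ col n l h) :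
    foldField σ w k l b (cellMapH σ k l c x) = ((w c : ℤ) : ℝ) • flip (sgnH σ c) (b x) := by
  rw [foldField, idx_cellMapH σ k c hl hx, IsometryEquiv.symm_apply_apply]

lemma isCharge_foldCharge (hl : 0 < l) (hu : IsCharge n l u) :
    IsCharge n (k * l) (foldCharge σ w k l u) := by
  constructor
  · refine aestronglyMeasurable_cells (restrict_bottom_eq n σ k hl) fun c _ => ?_
    refine (hu.1.const_mul ((w c : ℤ) : ℝ)).congr ?_
    filter_upwards [ae_restrict_mem (isOpen_bottom n l).measurableSet] with y hy
    exact (foldCharge_cellMap σ w k hl c hy).symm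
  · refine ae_cells (restrict_bottom_eq n σ k hl) fun c _ => ?_
    filter_upwards [hu.2, ae_restrict_mem (isOpen_bottom n l).measurableSet] with y hy hyS
    have := foldCharge_cellMap σ w k hl c hyS (u := u)
    change foldCharge σ w k l u (cellMap σ k l c y) = 1 ∨
      foldCharge σ w k l u (cellMap σ k l c y) = -1
    rw [this]
    rcases Int.units_eq_one_or (w c) with h1 | h1 <;> rcases hy with h2 | h2 <;> simp [h1, h2]

lemma norm_foldField_cellMapH (hl : 0 < l) (c : Fin n → ℤ) {x : Euc (n + 1)}
    (hx : x ∈ col n l h) : ‖foldField σ w k l b (cellMapH σ k l c x)‖ = ‖b x‖ := by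
  rw [foldField_cellMapH σ w k hl c hx, norm_smul, Real.norm_eq_abs, abs_units_cast, one_mul,
    LinearIsometryEquiv.norm_map]

lemma memLp_foldField (hl : 0 < l) (hb : MemLp b 2 (volume.restrict (col n l h))) :
    MemLp (foldField σ w k l b) 2 (volume.restrict (col n (k * l) h)) := by
  have hm : AEStronglyMeasurable (foldField σ w k l b) (volume.restrict (col n (k * l) h)) := by
    refine aestronglyMeasurable_cells (restrict_col_eq n σ k hl h) fun c _ => ?_
    refine (((flip (sgnH σ c)).continuous.comp_aestronglyMeasurable hb.1).const_smul
      ((w c : ℤ) : ℝ)).congr ?_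
    filter_upwards [ae_restrict_mem (isOpen_col n l h).measurableSet] with x hx
    exact (foldField_cellMapH σ w k hl c hx).symm
  rw [memLp_two_iff_integrable_sq_norm hm]
  refine integrableOn_cells (restrict_col_eq n σ k hl h) fun c _ => ?_
  refine ((memLp_two_iff_integrable_sq_norm hb.1).1 hb).congr ?_
  filter_upwards [ae_restrict_mem (isOpen_col n l h).measurableSet] with x hx
  have := norm_foldField_cellMapH σ w k hl c hx (b := b)
  change _ = ‖foldField σ w k l b (cellMapH σ k l c x)‖ ^ 2
  rw [this]

lemma lintegral_foldField (hl : 0 < l) :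
    ∫⁻ x in col n (k * l) h, ENNReal.ofReal (‖foldField σ w k l b x‖ ^ 2 / 2)
      = (k : ℝ≥0∞) ^ n * ∫⁻ x in col n l h, ENNReal.ofReal (‖b x‖ ^ 2 / 2) := by
  rw [setLIntegral_cells (restrict_col_eq n σ k hl h)]
  rw [Finset.sum_congr rfl (g := fun _ => ∫⁻ x in col n l h, ENNReal.ofReal (‖b x‖ ^ 2 / 2))]
  · rw [Finset.sum_const, card_cells, nsmul_eq_mul, Nat.cast_pow]
  · intro c _
    refine setLIntegral_congr_fun (isOpen_col n l h).measurableSet fun x hx => ?_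
    have := norm_foldField_cellMapH σ w k hl c hx (b := b)
    change ENNReal.ofReal (‖foldField σ w k l b (cellMapH σ k l c x)‖ ^ 2 / 2) = _
    rw [this]

lemma contDiff_cellMapH (c : Fin n → ℤ) {r : WithTop ℕ∞} : ContDiff ℝ r (cellMapH σ k l c) :=
  contDiff_aff _ _

lemma contDiff_cellMap (c : Fin n → ℤ) {r : WithTop ℕ∞} : ContDiff ℝ r (cellMap σ k l c) :=
  contDiff_aff _ _

lemma contDiff_unfoldTest {r : WithTop ℕ∞} {ζ : Euc (n + 1) → ℝ} (hζ : ContDiff ℝ r ζ) :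
    ContDiff ℝ r (unfoldTest σ w k l ζ) :=
  ContDiff.sum fun c _ => contDiff_const.mul (hζ.comp (contDiff_cellMapH σ k c))

lemma contDiff_unfoldVec {r : WithTop ℕ∞} {φ : Euc n → Euc n} (hφ : ContDiff ℝ r φ) :
    ContDiff ℝ r (unfoldVec σ w k l φ) :=
  ContDiff.sum fun c _ =>
    ((flip fun i => σ (c i)).contDiff.comp (hφ.comp (contDiff_cellMap σ k c))).const_smul _

/-- There are `k ^ n` summands of norm at most `M`. The crude bound loses nothing: the area of the
large face is `k ^ n` times that of the cell. -/
lemma norm_unfoldVec_le {φ : Euc n → Euc n} {M : ℝ} (hφ : ∀ y, ‖φ y‖ ≤ M) (y : Euc n) :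
    ‖unfoldVec σ w k l φ y‖ ≤ (k : ℝ) ^ n * M := by
  refine (norm_sum_le _ _).trans ?_
  refine (Finset.sum_le_card_nsmul _ _ M fun c _ => ?_).trans_eq ?_
  · rw [norm_smul, Real.norm_eq_abs, abs_units_cast, one_mul, LinearIsometryEquiv.norm_map]
    exact hφ _
  · rw [card_cells, nsmul_eq_mul, Nat.cast_pow]

lemma fderiv_unfoldTest {ζ : Euc (n + 1) → ℝ} (hζ : Differentiable ℝ ζ) (x v : Euc (n + 1)) :
    fderiv ℝ (unfoldTest σ w k l ζ) x v
      = ∑ c ∈ cells n k, ((w c : ℤ) : ℝ) *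
        fderiv ℝ ζ (cellMapH σ k l c x) (flip (sgnH σ c) v) := by
  have hd : ∀ c : Fin n → ℤ, Differentiable ℝ fun x => ζ (cellMapH σ k l c x) := fun c =>
    hζ.comp ((contDiff_cellMapH σ k c (r := 1)).differentiable one_ne_zero)
  unfold unfoldTest
  rw [fderiv_fun_sum fun c _ => (hd c x).const_mul _, sum_apply]
  refine Finset.sum_congr rfl fun c _ => ?_
  rw [fderiv_const_mul (hd c x), smul_apply, smul_eq_mul]
  congr 1
  exact fderiv_comp_aff _ _ _ _ hζ

/-- Folding and unfolding are adjoint: a change of variables on each cell moves the sign and the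
isometry from the field to the test function. -/
lemma setIntegral_foldField (hl : 0 < l) (hb : IntegrableOn b (col n l h))
    {ζ : Euc (n + 1) → ℝ} (hζ : ContDiff ℝ 1 ζ) :
    ∫ x in col n (k * l) h, fderiv ℝ ζ x (foldField σ w k l b x)
      = ∫ x in col n l h, fderiv ℝ (unfoldTest σ w k l ζ) x (b x) := by
  have hcell : ∀ c : Fin n → ℤ, ∀ x ∈ col n l h,
      fderiv ℝ ζ (cellMapH σ k l c x) (foldField σ w k l b (cellMapH σ k l c x))
        = ((w c : ℤ) : ℝ) * fderiv ℝ ζ (cellMapH σ k l c x) (flip (sgnH σ c) (b x)) := by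
    intro c x hx
    rw [foldField_cellMapH σ w k hl c hx, map_smul, smul_eq_mul]
  have hint : ∀ c : Fin n → ℤ, IntegrableOn (fun x => ((w c : ℤ) : ℝ) *
      fderiv ℝ ζ (cellMapH σ k l c x) (flip (sgnH σ c) (b x))) (col n l h) := by
    intro c
    refine Integrable.const_mul ?_ _
    have hΛ : Continuous fun x => (fderiv ℝ ζ (cellMapH σ k l c x)).comp
        ((flip (sgnH σ c)).toContinuousLinearEquiv : Euc (n + 1) →L[ℝ] Euc (n + 1)) :=
      ((hζ.continuous_fderiv one_ne_zero).comp (cellMapH σ k l c).continuous).clm_comp_const _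
    exact integrableOn_apply (isBounded_col n l h) (isOpen_col n l h).measurableSet hb hΛ
  refine (setIntegral_cells (restrict_col_eq n σ k hl h) fun c _ => (hint c).congr_fun
    (fun x hx => (hcell c x hx).symm) (isOpen_col n l h).measurableSet).trans ?_
  refine (Finset.sum_congr rfl fun c _ =>
    setIntegral_congr_fun (isOpen_col n l h).measurableSet (hcell c)).trans ?_
  rw [← integral_finsetSum _ fun c _ => hint c]
  refine setIntegral_congr_fun (isOpen_col n l h).measurableSet fun x _ => ?_
  exact (fderiv_unfoldTest σ w k (hζ.differentiable one_ne_zero) x (b x)).symm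

lemma continuous_incl : Continuous (incl : Euc n → Euc (n + 1)) := by
  unfold incl
  refine (PiLp.continuous_toLp 2 _).comp (continuous_pi fun i => ?_)
  refine Fin.lastCases ?_ (fun i => ?_) i
  · simp only [Fin.snoc_last]; fun_prop
  · simp only [Fin.snoc_castSucc]; fun_prop

lemma setIntegral_foldCharge (hl : 0 < l) (hu : IsCharge n l u)
    {ζ : Euc (n + 1) → ℝ} (hζ : Continuous ζ) :
    ∫ y in bottom n (k * l), foldCharge σ w k l u y * ζ (incl y)
      = ∫ y in bottom n l, u y * unfoldTest σ w k l ζ (incl y) := by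
  have hcell : ∀ c : Fin n → ℤ, ∀ y ∈ bottom n l,
      foldCharge σ w k l u (cellMap σ k l c y) * ζ (incl (cellMap σ k l c y))
        = u y * (((w c : ℤ) : ℝ) * ζ (cellMapH σ k l c (incl y))) := by
    intro c y hy
    rw [foldCharge_cellMap σ w k hl c hy, cellMapH_incl]
    ring
  have hint : ∀ c : Fin n → ℤ, IntegrableOn (fun y => u y * (((w c : ℤ) : ℝ) *
      ζ (cellMapH σ k l c (incl y)))) (bottom n l) := fun c =>
    hu.integrableOn_mul (continuous_const.mul
      (hζ.comp ((cellMapH σ k l c).continuous.comp continuous_incl)))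
  refine (setIntegral_cells (restrict_bottom_eq n σ k hl) fun c _ => (hint c).congr_fun
    (fun x hx => (hcell c x hx).symm) (isOpen_bottom n l).measurableSet).trans ?_
  refine (Finset.sum_congr rfl fun c _ =>
    setIntegral_congr_fun (isOpen_bottom n l).measurableSet (hcell c)).trans ?_
  rw [← integral_finsetSum _ fun c _ => hint c]
  refine setIntegral_congr_fun (isOpen_bottom n l).measurableSet fun x _ => ?_
  simp only [unfoldTest, Finset.mul_sum]

/-- The adjunction for the test fields of the variation. The outer reflection in `unfoldVec` is what
makes the divergence commute with the isometries. -/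
lemma setIntegral_foldCharge_divergence (hl : 0 < l) (hu : IsCharge n l u)
    {φ : Euc n → Euc n} (hφ : ContDiff ℝ 1 φ) :
    ∫ y in bottom n (k * l), foldCharge σ w k l u y * divergence φ y
      = ∫ y in bottom n l, u y * divergence (unfoldVec σ w k l φ) y := by
  have hφd := hφ.differentiable one_ne_zero
  have hcell : ∀ c : Fin n → ℤ, ∀ y ∈ bottom n l,
      foldCharge σ w k l u (cellMap σ k l c y) * divergence φ (cellMap σ k l c y)
        = u y * (((w c : ℤ) : ℝ) * divergence φ (cellMap σ k l c y)) := by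
    intro c y hy
    rw [foldCharge_cellMap σ w k hl c hy]
    ring
  have hint : ∀ c : Fin n → ℤ, IntegrableOn (fun y => u y * (((w c : ℤ) : ℝ) *
      divergence φ (cellMap σ k l c y))) (bottom n l) := fun c =>
    hu.integrableOn_mul (continuous_const.mul
      ((continuous_divergence hφ).comp (cellMap σ k l c).continuous))
  have hc1 : ∀ c : Fin n → ℤ,
      ContDiff ℝ 1 fun y => flip (fun i => σ (c i)) (φ (cellMap σ k l c y)) := fun c =>
    (flip fun i => σ (c i)).contDiff.comp (hφ.comp (contDiff_cellMap σ k c))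
  refine (setIntegral_cells (restrict_bottom_eq n σ k hl) fun c _ => (hint c).congr_fun
    (fun x hx => (hcell c x hx).symm) (isOpen_bottom n l).measurableSet).trans ?_
  refine (Finset.sum_congr rfl fun c _ =>
    setIntegral_congr_fun (isOpen_bottom n l).measurableSet (hcell c)).trans ?_
  rw [← integral_finsetSum _ fun c _ => hint c]
  refine setIntegral_congr_fun (isOpen_bottom n l).measurableSet fun y _ => ?_
  rw [← Finset.mul_sum]
  unfold unfoldVec
  rw [divergence_sum (cells n k)
    (φ := fun c y => ((w c : ℤ) : ℝ) • flip (fun i => σ (c i)) (φ (cellMap σ k l c y)))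
    fun c _ => ((hc1 c).differentiable one_ne_zero y).fun_const_smul _]
  congr 1
  refine Finset.sum_congr rfl fun c _ => ?_
  rw [divergence_const_smul _ ((hc1 c).differentiable one_ne_zero y)]
  congr 1
  exact (divergence_flip_comp_aff _ _ y hφd).symm

end

/-! ### Cutoff functions near the lateral faces. -/

lemma exists_bound_deriv_smoothTransition :
    ∃ M : ℝ, 0 < M ∧ ∀ t, |deriv Real.smoothTransition t| ≤ M := by
  have hc : Continuous (deriv Real.smoothTransition) :=
    (Real.smoothTransition.contDiff (n := 1)).continuous_deriv le_rfl
  obtain ⟨M, hM⟩ := (isCompact_Icc (a := (0 : ℝ)) (b := 1)).exists_bound_of_continuousOn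
    hc.continuousOn
  refine ⟨max M 1, by positivity, fun t => ?_⟩
  by_cases h : t ∈ Icc (0 : ℝ) 1
  · exact (hM t h).trans (le_max_left _ _)
  · have h0 : deriv Real.smoothTransition t = 0 := by
      rw [mem_Icc, not_and_or, not_le, not_le] at h
      rcases h with h | h
      · have : Real.smoothTransition =ᶠ[𝓝 t] fun _ => 0 := by
          filter_upwards [Iio_mem_nhds h] with s hs
          exact Real.smoothTransition.zero_of_nonpos (le_of_lt hs)
        rw [this.deriv_eq, deriv_const]
      · have : Real.smoothTransition =ᶠ[𝓝 t] fun _ => 1 := by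
          filter_upwards [Ioi_mem_nhds h] with s hs
          exact Real.smoothTransition.one_of_one_le (le_of_lt hs)
        rw [this.deriv_eq, deriv_const]
    rw [h0, abs_zero]
    positivity

/-- A smooth cutoff function on `(-l/2, l/2)`, equal to one at distance at least `2/j` from the end
points and to zero at distance at most `1/j`. -/
def cut (l : ℝ) (j : ℕ) (t : ℝ) : ℝ :=
  Real.smoothTransition (j * (l / 2 - t) - 1) * Real.smoothTransition (j * (l / 2 + t) - 1)

lemma contDiff_cut (l : ℝ) (j : ℕ) {r : ℕ∞} : ContDiff ℝ r (cut l j) :=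
  (Real.smoothTransition.contDiff.comp (by fun_prop)).mul
    (Real.smoothTransition.contDiff.comp (by fun_prop))

lemma cut_nonneg (l : ℝ) (j : ℕ) (t : ℝ) : 0 ≤ cut l j t :=
  mul_nonneg (Real.smoothTransition.nonneg _) (Real.smoothTransition.nonneg _)

lemma cut_le_one (l : ℝ) (j : ℕ) (t : ℝ) : cut l j t ≤ 1 :=
  mul_le_one₀ (Real.smoothTransition.le_one _) (Real.smoothTransition.nonneg _)
    (Real.smoothTransition.le_one _)

lemma abs_cut_le_one (l : ℝ) (j : ℕ) (t : ℝ) : |cut l j t| ≤ 1 := by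
  rw [abs_of_nonneg (cut_nonneg l j t)]
  exact cut_le_one l j t

lemma cut_eq_zero {l : ℝ} {j : ℕ} (hj : 0 < j) {t : ℝ} (ht : l / 2 - 1 / j ≤ |t|) :
    cut l j t = 0 := by
  have hj' : (0 : ℝ) < j := by exact_mod_cast hj
  have h1 : (j : ℝ) * (l / 2 - |t|) ≤ 1 := by
    have := mul_le_mul_of_nonneg_left ht hj'.le
    rw [mul_sub, mul_one_div_cancel hj'.ne'] at this
    linarith
  rcases abs_cases t with ⟨h, -⟩ | ⟨h, -⟩ <;> rw [h] at h1
  · rw [cut, Real.smoothTransition.zero_of_nonpos (by linarith), zero_mul]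
  · rw [cut, mul_comm, Real.smoothTransition.zero_of_nonpos (by linarith), zero_mul]

lemma cut_eventuallyEq_one {l : ℝ} {j : ℕ} (hj : 0 < j) {t : ℝ} (ht : |t| < l / 2 - 2 / j) :
    cut l j =ᶠ[𝓝 t] fun _ => 1 := by
  have hj' : (0 : ℝ) < j := by exact_mod_cast hj
  have : {s : ℝ | |s| < l / 2 - 2 / j} ∈ 𝓝 t :=
    (isOpen_lt continuous_abs continuous_const).mem_nhds ht
  filter_upwards [this] with s hs
  have h1 : 2 ≤ (j : ℝ) * (l / 2 - |s|) := by
    have h2 := mul_le_mul_of_nonneg_left (le_of_lt hs : |s| ≤ _) hj'.le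
    have h3 : (j : ℝ) * (2 / j) = 2 := by field_simp
    rw [mul_sub, h3] at h2
    linarith
  have h4 := mul_le_mul_of_nonneg_left (le_abs_self s) hj'.le
  have h5 := mul_le_mul_of_nonneg_left (neg_abs_le s) hj'.le
  rw [cut, Real.smoothTransition.one_of_one_le (by linarith),
    Real.smoothTransition.one_of_one_le (by linarith), one_mul]

lemma deriv_cut_eq_zero {l : ℝ} {j : ℕ} (hj : 0 < j) {t : ℝ} (ht : |t| < l / 2 - 2 / j) :
    deriv (cut l j) t = 0 := by
  rw [(cut_eventuallyEq_one hj ht).deriv_eq, deriv_const]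

/-- The constant depends on neither `l` nor `j`. The growth `j` is compensated later by the width `2
/ j` of the strip that carries the derivative. -/
lemma exists_bound_deriv_cut :
    ∃ M : ℝ, 0 < M ∧ ∀ (l : ℝ) (j : ℕ) (t : ℝ), |deriv (cut l j) t| ≤ M * j := by
  obtain ⟨M, hM0, hM⟩ := exists_bound_deriv_smoothTransition
  refine ⟨2 * M, by positivity, fun l j t => ?_⟩
  have hS : ∀ s, HasDerivAt Real.smoothTransition (deriv Real.smoothTransition s) s := fun s =>
    ((Real.smoothTransition.contDiff (n := 1)).differentiable one_ne_zero s).hasDerivAt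
  have h1 : HasDerivAt (fun t : ℝ => (j : ℝ) * (l / 2 - t) - 1) (-j) t := by
    have := (((hasDerivAt_id t).const_sub (l / 2)).const_mul (j : ℝ)).sub_const 1
    simpa using this
  have h2 : HasDerivAt (fun t : ℝ => (j : ℝ) * (l / 2 + t) - 1) j t := by
    have := (((hasDerivAt_id t).const_add (l / 2)).const_mul (j : ℝ)).sub_const 1
    simpa using this
  have h3 := ((hS _).comp t h1).mul ((hS _).comp t h2)
  have h4 : cut l j = (Real.smoothTransition ∘ fun t : ℝ => (j : ℝ) * (l / 2 - t) - 1) *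
      (Real.smoothTransition ∘ fun t : ℝ => (j : ℝ) * (l / 2 + t) - 1) := rfl
  rw [h4, h3.deriv]
  have hj : (0 : ℝ) ≤ j := Nat.cast_nonneg j
  refine (abs_add_le _ _).trans ?_
  simp only [Function.comp, abs_mul, abs_neg, abs_of_nonneg hj,
    abs_of_nonneg (Real.smoothTransition.nonneg _)]
  have a1 := hM ((j : ℝ) * (l / 2 - t) - 1)
  have a2 := hM ((j : ℝ) * (l / 2 + t) - 1)
  have b1 := Real.smoothTransition.le_one ((j : ℝ) * (l / 2 - t) - 1)
  have b2 := Real.smoothTransition.le_one ((j : ℝ) * (l / 2 + t) - 1)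
  have c1 := Real.smoothTransition.nonneg ((j : ℝ) * (l / 2 - t) - 1)
  have c2 := Real.smoothTransition.nonneg ((j : ℝ) * (l / 2 + t) - 1)
  calc _ ≤ M * j * 1 + 1 * (M * j) := by gcongr
    _ = 2 * M * j := by ring

/-- The product of the cutoff functions `cut l j` in the coordinates `e i`. -/
def cutoff {n m : ℕ} (e : Fin n → Fin m) (l : ℝ) (j : ℕ) (x : Euc m) : ℝ :=
  ∏ i, cut l j (x (e i))

section

variable {n m : ℕ} (e : Fin n → Fin m) (l : ℝ) (j : ℕ)

lemma contDiff_cutoff {r : ℕ∞} : ContDiff ℝ r (cutoff e l j) :=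
  contDiff_prod fun _ _ => (contDiff_cut l j).comp (by fun_prop)

lemma cutoff_nonneg (x : Euc m) : 0 ≤ cutoff e l j x :=
  Finset.prod_nonneg fun _ _ => cut_nonneg _ _ _

lemma cutoff_le_one (x : Euc m) : cutoff e l j x ≤ 1 :=
  Finset.prod_le_one (fun _ _ => cut_nonneg _ _ _) fun _ _ => cut_le_one _ _ _

lemma abs_cutoff_le_one (x : Euc m) : |cutoff e l j x| ≤ 1 := by
  rw [abs_of_nonneg (cutoff_nonneg e l j x)]
  exact cutoff_le_one e l j x

lemma tsupport_cutoff_subset (hj : 0 < j) :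
    tsupport (cutoff e l j) ⊆ {x | ∀ i, |x (e i)| ≤ l / 2 - 1 / j} := by
  refine closure_minimal (fun x hx i => ?_) ?_
  · by_contra h
    exact hx (Finset.prod_eq_zero (Finset.mem_univ i) (cut_eq_zero hj (not_le.1 h).le))
  · simp only [ofPred_forall]
    exact isClosed_iInter fun i => isClosed_le (by fun_prop) continuous_const

lemma fderiv_cutoff (x v : Euc m) :
    fderiv ℝ (cutoff e l j) x v = ∑ i, (∏ k ∈ Finset.univ.erase i, cut l j (x (e k))) *
      (deriv (cut l j) (x (e i)) * v (e i)) := by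
  have h : ∀ i ∈ (Finset.univ : Finset (Fin n)), HasFDerivAt (fun x : Euc m => cut l j (x (e i)))
      (deriv (cut l j) (x (e i)) • (EuclideanSpace.proj (e i) : Euc m →L[ℝ] ℝ)) x := fun i _ =>
    (((contDiff_cut l j (r := 1)).differentiable one_ne_zero _).hasDerivAt.comp_hasFDerivAt x
      (EuclideanSpace.proj (e i) : Euc m →L[ℝ] ℝ).hasFDerivAt)
  have := (HasFDerivAt.finsetProd h).fderiv
  change fderiv ℝ (fun x => ∏ i, cut l j (x (e i))) x v = _
  rw [this]
  simp

lemma abs_fderiv_cutoff_le (x v : Euc m) :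
    |fderiv ℝ (cutoff e l j) x v| ≤ ∑ i, |deriv (cut l j) (x (e i))| * |v (e i)| := by
  rw [fderiv_cutoff]
  refine (Finset.abs_sum_le_sum_abs _ _).trans (Finset.sum_le_sum fun i _ => ?_)
  rw [abs_mul, abs_mul]
  refine mul_le_of_le_one_left (by positivity) ?_
  rw [Finset.abs_prod]
  exact Finset.prod_le_one (fun _ _ => abs_nonneg _) fun _ _ => abs_cut_le_one _ _ _

variable {e l}

lemma eventually_forall_lt {x : Euc m} (hx : ∀ i, |x (e i)| < l / 2) :
    ∀ᶠ j : ℕ in atTop, ∀ i, |x (e i)| < l / 2 - 2 / j := by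
  rw [eventually_all]
  intro i
  have h : Tendsto (fun j : ℕ => l / 2 - 2 / (j : ℝ)) atTop (𝓝 (l / 2 - 0)) :=
    tendsto_const_nhds.sub (tendsto_const_div_atTop_nhds_zero_nat 2)
  rw [sub_zero] at h
  exact h.eventually (lt_mem_nhds (hx i))

lemma eventually_cutoff_eq_one {x : Euc m} (hx : ∀ i, |x (e i)| < l / 2) :
    ∀ᶠ j : ℕ in atTop, cutoff e l j x = 1 := by
  filter_upwards [eventually_forall_lt hx, eventually_gt_atTop 0] with j hj hj0
  exact Finset.prod_eq_one fun i _ => (cut_eventuallyEq_one hj0 (hj i)).eq_of_nhds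

lemma eventually_fderiv_cutoff_eq_zero {x : Euc m} (hx : ∀ i, |x (e i)| < l / 2) :
    ∀ᶠ j : ℕ in atTop, ∀ v, fderiv ℝ (cutoff e l j) x v = 0 := by
  filter_upwards [eventually_forall_lt hx, eventually_gt_atTop 0] with j hj hj0 v
  rw [fderiv_cutoff]
  refine Finset.sum_eq_zero fun i _ => ?_
  rw [deriv_cut_eq_zero hj0 (hj i), zero_mul, mul_zero]

lemma tendsto_setIntegral_mul_cutoff {S : Set (Euc m)} (hS : MeasurableSet S)
    (hSe : ∀ x ∈ S, ∀ i, |x (e i)| < l / 2) {f : Euc m → ℝ} (hf : IntegrableOn f S) :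
    Tendsto (fun j => ∫ x in S, cutoff e l j x * f x) atTop (𝓝 (∫ x in S, f x)) := by
  refine tendsto_integral_of_dominated_convergence (fun x => ‖f x‖)
    (fun j => ((contDiff_cutoff e l j (r := 0)).continuous.aestronglyMeasurable.mul hf.1)) hf.norm
    (fun j => ae_of_all _ fun x => ?_) ?_
  · rw [norm_mul]
    exact mul_le_of_le_one_left (norm_nonneg _) (abs_cutoff_le_one e l j x)
  · filter_upwards [ae_restrict_mem hS] with x hx
    refine tendsto_const_nhds.congr' ?_
    filter_upwards [eventually_cutoff_eq_one (hSe x hx)] with j hj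
    rw [hj, one_mul]

/-- The gradient of the cutoff has size `M * j` and lives within distance `2 / j` of the faces.
Linear decay of the normal components there makes `2 * M * K` a majorant for each coordinate,
independent of `j`; pointwise the integrand is eventually zero. -/
lemma tendsto_setIntegral_fderiv_cutoff {S : Set (Euc m)} (hS : MeasurableSet S)
    (hSe : ∀ x ∈ S, ∀ i, |x (e i)| < l / 2) {V : Euc m → Euc m} {K : Euc m → ℝ}
    (hV : AEStronglyMeasurable V (volume.restrict S)) (hK : IntegrableOn K S)
    (hVK : ∀ᵐ x ∂volume.restrict S, ∀ i, |V x (e i)| ≤ K x * (l / 2 - |x (e i)|)) :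
    Tendsto (fun j => ∫ x in S, fderiv ℝ (cutoff e l j) x (V x)) atTop (𝓝 0) := by
  obtain ⟨M, hM0, hM⟩ := exists_bound_deriv_cut
  rw [← integral_zero (Euc m) ℝ (μ := volume.restrict S)]
  refine tendsto_integral_filter_of_dominated_convergence (fun x => ∑ _i : Fin n, 2 * M * K x)
    (Eventually.of_forall fun j => ?_) ?_ ?_ ?_
  · exact isBoundedBilinearMap_apply.continuous.comp_aestronglyMeasurable
      (((contDiff_cutoff e l j (r := 1)).continuous_fderiv
        one_ne_zero).aestronglyMeasurable.prodMk hV)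
  · filter_upwards [eventually_gt_atTop 0] with j hj
    have hj' : (0 : ℝ) < j := by exact_mod_cast hj
    filter_upwards [ae_restrict_mem hS, hVK] with x hx hxK
    refine (abs_fderiv_cutoff_le e l j x (V x)).trans (Finset.sum_le_sum fun i _ => ?_)
    have hd : 0 < l / 2 - |x (e i)| := by linarith [hSe x hx i]
    -- No sign of `K` is assumed: it is forced by the bound on `V`, as the distance to the face is
    -- positive.
    have hK0 : 0 ≤ K x := by
      by_contra h
      exact absurd ((abs_nonneg _).trans (hxK i)) (not_le.2 (mul_neg_of_neg_of_pos (not_le.1 h) hd))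
    by_cases h : |x (e i)| < l / 2 - 2 / j
    · rw [deriv_cut_eq_zero hj h, abs_zero, zero_mul]
      positivity
    · have h1 : l / 2 - |x (e i)| ≤ 2 / j := by linarith [not_lt.1 h]
      calc |deriv (cut l j) (x (e i))| * |V x (e i)| ≤ (M * j) * (K x * (2 / j)) := by
            gcongr
            · exact hM l j _
            · exact (hxK i).trans (by gcongr)
        _ = 2 * M * K x := by field_simp
  · exact integrable_finsetSum _ fun _ _ => hK.const_mul _
  · filter_upwards [ae_restrict_mem hS] with x hx
    refine tendsto_const_nhds.congr' ?_
    filter_upwards [eventually_fderiv_cutoff_eq_zero (hSe x hx)] with j hj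
    exact (hj _).symm

end

/-! ### Test fields for the variation that reach the faces. -/

/-- Mean value inequality on the segment from `x` to the nearest point `x'`, in direction `i`, where
`f` vanishes. -/
lemma exists_bound_of_vanish_on_faces {m : ℕ} {S : Set (Euc m)} (hS : Bornology.IsBounded S)
    {l : ℝ} (i : Fin m) (hSl : ∀ x ∈ S, |x i| ≤ l / 2) {f : Euc m → ℝ} (hf : ContDiff ℝ 1 f)
    (hf0 : ∀ x, |x i| = l / 2 → f x = 0) :
    ∃ M : ℝ, 0 ≤ M ∧ ∀ x ∈ S, |f x| ≤ M * (l / 2 - |x i|) := by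
  obtain ⟨R, hR⟩ := hS.subset_closedBall 0
  -- The point `x'` need not lie in `S`, but it is within `l / 2` of `x`; the enlarged ball is
  -- convex and contains both.
  obtain ⟨M, hM0, hM⟩ := exists_bound_of_isBounded
    (Metric.isBounded_closedBall (x := (0 : Euc m)) (r := R + l / 2))
    (hf.continuous_fderiv one_ne_zero)
  refine ⟨M, hM0, fun x hx => ?_⟩
  have hd : 0 ≤ l / 2 - |x i| := by linarith [hSl x hx]
  obtain ⟨s, hs, hsx⟩ : ∃ s : ℝ, |s| = l / 2 - |x i| ∧ |x i + s| = l / 2 := by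
    rcases le_total 0 (x i) with h | h
    · refine ⟨l / 2 - |x i|, abs_of_nonneg hd, ?_⟩
      rw [abs_of_nonneg h]
      rw [add_sub_cancel, abs_of_nonneg (by linarith [abs_nonneg (x i)])]
    · refine ⟨-(l / 2 - |x i|), by rw [abs_neg, abs_of_nonneg hd], ?_⟩
      rw [abs_of_nonpos h]
      have : x i + -(l / 2 - -x i) = -(l / 2) := by ring
      rw [this, abs_neg, abs_of_nonneg (by linarith [abs_nonneg (x i)])]
  set x' : Euc m := x + EuclideanSpace.single i s with hx'
  have h0 : f x' = 0 := by
    apply hf0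
    simpa [hx'] using hsx
  have hxR : ‖x‖ ≤ R := by simpa using hR hx
  have hn : ‖x - x'‖ = l / 2 - |x i| := by
    rw [hx', sub_add_cancel_left, norm_neg, PiLp.norm_single, Real.norm_eq_abs, hs]
  have h1 : x ∈ Metric.closedBall (0 : Euc m) (R + l / 2) := by
    rw [mem_closedBall_zero_iff]
    linarith [abs_nonneg (x i)]
  have h2 : x' ∈ Metric.closedBall (0 : Euc m) (R + l / 2) := by
    rw [mem_closedBall_zero_iff]
    have := norm_sub_norm_le x' x
    rw [norm_sub_rev, hn] at this
    linarith [abs_nonneg (x i)]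
  have := (convex_closedBall (0 : Euc m) (R + l / 2)).norm_image_sub_le_of_norm_fderiv_le
    (fun y _ => (hf.differentiable one_ne_zero) y) (fun y hy => hM y hy) h2 h1
  rwa [h0, sub_zero, hn, Real.norm_eq_abs] at this

lemma isCompact_tsupport_of_isBounded {m : ℕ} {F : Type*} [Zero F] {f : Euc m → F}
    (h : Bornology.IsBounded (tsupport f)) : HasCompactSupport f :=
  Metric.isCompact_of_isClosed_isBounded (isClosed_tsupport f) h

lemma one_div_cast_pos {j : ℕ} (hj : 0 < j) : (0 : ℝ) < 1 / j :=
  one_div_pos.2 (by exact_mod_cast hj)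

lemma le_variation {n : ℕ} {Ω : Set (Euc n)} {u : Euc n → ℝ} {φ : Euc n → Euc n}
    (h1 : ContDiff ℝ 1 φ) (h2 : HasCompactSupport φ) (h3 : tsupport φ ⊆ Ω)
    (h4 : ∀ y, ‖φ y‖ ≤ 1) :
    ENNReal.ofReal (∫ y in Ω, u y * divergence φ y) ≤ variation Ω u :=
  le_iSup₂_of_le (f := fun (φ : Euc n → Euc n) (_ : ContDiff ℝ 1 φ ∧ HasCompactSupport φ ∧
    tsupport φ ⊆ Ω ∧ ∀ y, ‖φ y‖ ≤ 1) => ENNReal.ofReal (∫ y in Ω, u y * divergence φ y))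
    φ ⟨h1, h2, h3, h4⟩ le_rfl

section

variable {n : ℕ} {l : ℝ} {u : Euc n → ℝ} {ψ : Euc n → Euc n}

lemma ofReal_integral_divergence_cutoff_le {j : ℕ} (hj : 0 < j) (hψ : ContDiff ℝ 1 ψ)
    (hψ1 : ∀ y, ‖ψ y‖ ≤ 1) :
    ENNReal.ofReal (∫ y in bottom n l, u y * divergence (fun y => cutoff id l j y • ψ y) y)
      ≤ variation (bottom n l) u := by
  have hs : tsupport (fun y => cutoff id l j y • ψ y)
      ⊆ {x : Euc n | ∀ i, |x i| ≤ l / 2 - 1 / j} :=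
    (tsupport_smul_subset_left _ _).trans (tsupport_cutoff_subset id l j hj)
  refine le_variation ((contDiff_cutoff id l j).smul hψ) ?_ ?_ fun y => ?_
  · exact isCompact_tsupport_of_isBounded (isBounded_of_coord_le _ fun x hx => hs hx)
  · intro x hx i
    exact (hs hx i).trans_lt (by linarith [one_div_cast_pos hj])
  · rw [norm_smul, Real.norm_eq_abs]
    exact mul_le_one₀ (abs_cutoff_le_one id l j y) (norm_nonneg _) (hψ1 y)

/-- The product rule isolates the error of cutting off: the last integral is an approximate flux of
`u ψ` through the faces. It tends to zero for tangential `ψ` and is of the order of the area of the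
faces in general. -/
lemma integral_divergence_cutoff (hu : IsCharge n l u) (j : ℕ) (hψ : ContDiff ℝ 1 ψ) :
    ∫ y in bottom n l, u y * divergence (fun y => cutoff id l j y • ψ y) y
      = (∫ y in bottom n l, cutoff id l j y * (u y * divergence ψ y)) +
        ∫ y in bottom n l, fderiv ℝ (cutoff id l j) y (u y • ψ y) := by
  have hc : ContDiff ℝ 1 (cutoff (id : Fin n → Fin n) l j) := contDiff_cutoff id l j
  have i1 := hu.integrableOn_mul (hc.continuous.mul (continuous_divergence hψ))
  have i2 := hu.integrableOn_mul
    (isBoundedBilinearMap_apply.continuous.comp ((hc.continuous_fderiv one_ne_zero).prodMk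
      hψ.continuous))
  have h1 : ∀ y, cutoff id l j y * (u y * divergence ψ y)
      = u y * (cutoff id l j y * divergence ψ y) := fun y => by ring
  have h2 : ∀ y, fderiv ℝ (cutoff id l j) y (u y • ψ y)
      = u y * fderiv ℝ (cutoff id l j) y (ψ y) := fun y => by rw [map_smul, smul_eq_mul]
  simp_rw [h1, h2]
  refine Eq.trans ?_ (integral_add i1 i2)
  refine integral_congr_ae (ae_of_all _ fun y => ?_)
  simp only
  rw [divergence_mul (hc.differentiable one_ne_zero y) (hψ.differentiable one_ne_zero y), mul_add]

lemma abs_coord_le_norm {m : ℕ} (x : Euc m) (i : Fin m) : |x i| ≤ ‖x‖ := by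
  simpa using PiLp.norm_apply_le x i

/-- A field that is tangential on the faces may be used as a test field for the variation. -/
lemma ofReal_integral_divergence_le_of_tangential (hu : IsCharge n l u) (hψ : ContDiff ℝ 1 ψ)
    (hψ1 : ∀ y, ‖ψ y‖ ≤ 1) (hψ0 : ∀ i y, |y i| = l / 2 → ψ y i = 0) :
    ENNReal.ofReal (∫ y in bottom n l, u y * divergence ψ y) ≤ variation (bottom n l) u := by
  have hm := (isOpen_bottom n l).measurableSet
  have hb : ∀ i : Fin n, ∃ M : ℝ, 0 ≤ M ∧ ∀ y ∈ bottom n l, |ψ y i| ≤ M * (l / 2 - |y i|) :=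
    fun i => exists_bound_of_vanish_on_faces (isBounded_bottom n l) i (fun y hy => (hy i).le)
      (f := fun y => ψ y i) (by fun_prop) (hψ0 i)
  choose M hM0 hM using hb
  have t1 := tendsto_setIntegral_mul_cutoff (e := id) hm (fun y hy i => hy i)
    (hu.integrableOn_mul (continuous_divergence hψ))
  have t2 : Tendsto (fun j => ∫ y in bottom n l, fderiv ℝ (cutoff id l j) y (u y • ψ y)) atTop
      (𝓝 0) := by
    refine tendsto_setIntegral_fderiv_cutoff (e := id) hm (fun y hy i => hy i)
      (hu.1.smul hψ.continuous.aestronglyMeasurable) (K := fun _ => ∑ i, M i)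
      (integrableOn_const (volume_lt_top_of_isBounded (isBounded_bottom n l)).ne) ?_
    filter_upwards [ae_restrict_mem hm, hu.ae_abs_eq] with y hy hy1 i
    rw [PiLp.smul_apply, smul_eq_mul, abs_mul, hy1, one_mul]
    refine (hM i y hy).trans (mul_le_mul_of_nonneg_right
      (Finset.single_le_sum (fun i _ => hM0 i) (Finset.mem_univ i)) ?_)
    exact sub_nonneg.2 (hy i).le
  have t3 := t1.add t2
  rw [add_zero] at t3
  refine le_of_tendsto ((ENNReal.continuous_ofReal.tendsto _).comp t3) ?_
  filter_upwards [eventually_gt_atTop 0] with j hj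
  simp only [Function.comp]
  rw [← integral_divergence_cutoff hu j hψ]
  exact ofReal_integral_divergence_cutoff_le hj hψ hψ1

lemma volume_strip_le (hl : 0 ≤ l) (i : Fin n) {r : ℝ} :
    volume {y ∈ bottom n l | l / 2 - r ≤ |y i|} ≤ ENNReal.ofReal (2 * r * l ^ (n - 1)) := by
  have h := (EuclideanSpace.volume_preserving_symm_measurableEquiv_toLp (Fin n))
  set s : Fin n → Set ℝ := fun k =>
    if k = i then Icc (l / 2 - r) (l / 2) ∪ Icc (-(l / 2)) (-(l / 2) + r)
    else Ioo (-(l / 2)) (l / 2) with hs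
  have hsm : ∀ k, MeasurableSet (s k) := fun k => by
    simp only [hs]
    split_ifs <;> measurability
  have hsub : {y ∈ bottom n l | l / 2 - r ≤ |y i|}
      ⊆ (MeasurableEquiv.toLp 2 (Fin n → ℝ)).symm ⁻¹' (univ.pi s) := by
    rintro y ⟨hy, hyi⟩ k -
    change y k ∈ s k
    have hk := abs_lt.1 (hy k)
    simp only [hs]
    split_ifs with hki
    · subst hki
      rcases abs_cases (y k) with ⟨h, -⟩ | ⟨h, -⟩ <;> rw [h] at hyi
      · exact Or.inl ⟨hyi, hk.2.le⟩
      · exact Or.inr ⟨hk.1.le, by linarith⟩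
    · exact hk
  refine (measure_mono hsub).trans ?_
  rw [h.measure_preimage (MeasurableSet.univ_pi hsm).nullMeasurableSet, volume_pi, Measure.pi_pi,
    ← Finset.mul_prod_erase _ _ (Finset.mem_univ i)]
  have h1 : volume (s i) ≤ ENNReal.ofReal (2 * r) := by
    simp only [hs, if_true]
    refine (measure_union_le _ _).trans ?_
    rw [Real.volume_Icc, Real.volume_Icc]
    -- No sign is assumed on `r`; for nonpositive `r` both intervals have measure zero.
    rcases le_total 0 r with hr | hr
    · rw [← ENNReal.ofReal_add (by linarith) (by linarith)]
      exact ENNReal.ofReal_le_ofReal (by linarith)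
    · rw [ENNReal.ofReal_of_nonpos (by linarith), ENNReal.ofReal_of_nonpos (by linarith)]
      simp
  have h2 : ∏ k ∈ Finset.univ.erase i, volume (s k) = ENNReal.ofReal (l ^ (n - 1)) := by
    rw [Finset.prod_congr rfl (g := fun _ => ENNReal.ofReal l), Finset.prod_const,
      Finset.card_erase_of_mem (Finset.mem_univ i), Finset.card_univ, Fintype.card_fin,
      ENNReal.ofReal_pow hl]
    intro k hk
    simp only [hs, if_neg (Finset.ne_of_mem_erase hk), Real.volume_Ioo]
    congr 1
    ring
  rw [h2]
  calc _ ≤ ENNReal.ofReal (2 * r) * ENNReal.ofReal (l ^ (n - 1)) := by gcongr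
    _ = _ := (ENNReal.ofReal_mul' (pow_nonneg hl _)).symm

variable (n) in
/-- A field that is not tangential on the faces costs at most the area of the faces. -/
lemma exists_ofReal_integral_divergence_le :
    ∃ C : ℝ, 0 < C ∧ ∀ (l : ℝ) (u : Euc n → ℝ) (ψ : Euc n → Euc n), 0 ≤ l → IsCharge n l u →
      ContDiff ℝ 1 ψ → (∀ y, ‖ψ y‖ ≤ 1) →
      ENNReal.ofReal (∫ y in bottom n l, u y * divergence ψ y)
        ≤ variation (bottom n l) u + ENNReal.ofReal (C * l ^ (n - 1)) := by
  obtain ⟨M, hM0, hM⟩ := exists_bound_deriv_cut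
  -- On each of the `n` strips the derivative is at most `M * j` and the volume at most `2 * (2 / j)
  -- * l ^ (n - 1)`, so `j` cancels and `4 * M` remains. The summand 1 gives positivity also for `n
  -- = 0`.
  refine ⟨4 * M * n + 1, by positivity, fun l u ψ hl hu hψ hψ1 => ?_⟩
  have hm := (isOpen_bottom n l).measurableSet
  have t1 := tendsto_setIntegral_mul_cutoff (e := id) hm (fun y hy i => hy i)
    (hu.integrableOn_mul (continuous_divergence hψ))
  refine le_of_tendsto ((ENNReal.continuous_ofReal.tendsto _).comp t1) ?_
  filter_upwards [eventually_gt_atTop 0] with j hj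
  have hj' : (0 : ℝ) < j := by exact_mod_cast hj
  have hD : |∫ y in bottom n l, fderiv ℝ (cutoff id l j) y (u y • ψ y)|
      ≤ (4 * M * n + 1) * l ^ (n - 1) := by
    set st : Fin n → Set (Euc n) := fun i => {y ∈ bottom n l | l / 2 - 2 / j ≤ |y i|} with hst
    have hstm : ∀ i, MeasurableSet (st i) := fun i =>
      hm.inter (isClosed_le continuous_const
        (show Continuous fun y : Euc n => |y i| by fun_prop)).measurableSet
    have hi : ∀ i, IntegrableOn ((st i).indicator fun _ => M * j) (bottom n l) := fun i =>
      (integrableOn_const (volume_lt_top_of_isBounded (isBounded_bottom n l)).ne).indicator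
        (hstm i)
    have h1 : |∫ y in bottom n l, fderiv ℝ (cutoff id l j) y (u y • ψ y)|
        ≤ ∫ y in bottom n l, ∑ i, (st i).indicator (fun _ => M * j) y := by
      rw [← Real.norm_eq_abs]
      refine norm_integral_le_of_norm_le (integrable_finsetSum _ fun i _ => hi i) ?_
      filter_upwards [ae_restrict_mem hm, hu.ae_abs_eq] with y hy hy1
      refine (abs_fderiv_cutoff_le id l j y _).trans (Finset.sum_le_sum fun i _ => ?_)
      have h2 : |(u y • ψ y) (id i)| ≤ 1 := by
        rw [PiLp.smul_apply, smul_eq_mul, abs_mul, hy1, one_mul]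
        exact (abs_coord_le_norm _ _).trans (hψ1 y)
      by_cases h : y ∈ st i
      · rw [indicator_of_mem h]
        calc _ ≤ M * j * 1 := mul_le_mul (hM l j _) h2 (abs_nonneg _) (by positivity)
          _ = _ := mul_one _
      · rw [indicator_of_notMem h, id, deriv_cut_eq_zero hj, abs_zero, zero_mul]
        by_contra h3
        exact h ⟨hy, not_lt.1 h3⟩
    refine h1.trans ?_
    rw [integral_finsetSum _ fun i _ => hi i]
    have h4 : ∀ i, ∫ y in bottom n l, (st i).indicator (fun _ => M * j) y
        ≤ 4 * M * l ^ (n - 1) := by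
      intro i
      rw [setIntegral_indicator (hstm i), setIntegral_const, smul_eq_mul,
        inter_eq_self_of_subset_right (fun y hy => hy.1)]
      have h5 : volume.real (st i) ≤ 2 * (2 / j) * l ^ (n - 1) :=
        ENNReal.toReal_le_of_le_ofReal (by positivity) (volume_strip_le hl i)
      calc _ ≤ 2 * (2 / j) * l ^ (n - 1) * (M * j) := by gcongr
        _ = _ := by field_simp; ring
    calc _ ≤ ∑ _i : Fin n, 4 * M * l ^ (n - 1) := Finset.sum_le_sum fun i _ => h4 i
      _ = 4 * M * n * l ^ (n - 1) := by
        rw [Finset.sum_const, Finset.card_univ, Fintype.card_fin, nsmul_eq_mul]; ring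
      _ ≤ _ := by
        have := pow_nonneg hl (n - 1)
        nlinarith
  have h6 : ∫ y in bottom n l, cutoff id l j y * (u y * divergence ψ y)
      ≤ (∫ y in bottom n l, u y * divergence (fun y => cutoff id l j y • ψ y) y)
        + (4 * M * n + 1) * l ^ (n - 1) := by
    rw [integral_divergence_cutoff hu j hψ]
    linarith [(abs_le.1 hD).1]
  calc _ ≤ _ := ENNReal.ofReal_le_ofReal h6
    _ ≤ _ := ENNReal.ofReal_add_le
    _ ≤ _ := by
      gcongr
      exact ofReal_integral_divergence_cutoff_le hj hψ hψ1

end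

/-! ### Enlarging the class of test functions in a column. -/

/-- The analogue of `TestedBy` for columns. -/
def TestedOn {n : ℕ} (l h : ℝ) (u : Euc n → ℝ) (b : Euc (n + 1) → Euc (n + 1))
    (ζ : Euc (n + 1) → ℝ) : Prop :=
  ∫ x in col n l h, fderiv ℝ ζ x (b x) = - ∫ y in bottom n l, u y * ζ (incl y)

/-- The class of admissible pairs in a column, with free boundary conditions. -/
def colAdmissible (n : ℕ) (l h : ℝ) : Set ((Euc n → ℝ) × (Euc (n + 1) → Euc (n + 1))) :=
  {p | IsCharge n l p.1 ∧ variation (bottom n l) p.1 < ⊤ ∧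
    MemLp p.2 2 (volume.restrict (col n l h)) ∧
    ∀ ζ : Euc (n + 1) → ℝ, ContDiff ℝ ∞ ζ → HasCompactSupport ζ →
      tsupport ζ ⊆ {x | (∀ i : Fin n, |x i.castSucc| < l / 2) ∧ x (Fin.last n) < h} →
      TestedOn l h p.1 p.2 ζ}

section

variable {n : ℕ} {l h : ℝ} {u : Euc n → ℝ} {b : Euc (n + 1) → Euc (n + 1)}

/-- A test function that only vanishes on the lateral boundary is admissible. -/
lemma testedOn_of_vanish_aux (hp : (u, b) ∈ colAdmissible n l h) {Z : Euc (n + 1) → ℝ}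
    (hZ : ContDiff ℝ ∞ Z) (hZ0 : ∀ (i : Fin n) x, |x i.castSucc| = l / 2 → Z x = 0)
    (hZh : tsupport Z ⊆ {x | x (Fin.last n) < h}) {a : ℝ}
    (hZa : tsupport Z ⊆ {x | a ≤ x (Fin.last n)}) : TestedOn l h u b Z := by
  obtain ⟨hu, -, hb, htest⟩ := hp
  have hm := (isOpen_col n l h).measurableSet
  have hbi := integrableOn_of_memLp_two (isBounded_col n l h) hb
  have hZ1 : ContDiff ℝ 1 Z := hZ.of_le (by exact_mod_cast le_top)
  have hdZ := integrableOn_apply (isBounded_col n l h) hm hbi (hZ1.continuous_fderiv one_ne_zero)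
  set e : Fin n → Fin (n + 1) := Fin.castSucc
  have hbd : ∀ i : Fin n, ∃ M : ℝ, 0 ≤ M ∧
      ∀ x ∈ col n l h, |Z x| ≤ M * (l / 2 - |x i.castSucc|) := fun i =>
    exists_bound_of_vanish_on_faces (isBounded_col n l h) _ (fun x hx => (hx.1 i).le) hZ1 (hZ0 i)
  choose M hM0 hM using hbd
  have t1 := tendsto_setIntegral_mul_cutoff (e := e) hm (fun x hx i => hx.1 i) hdZ
  -- Since `Z` vanishes linearly at the lateral faces, `Z b` satisfies the decay hypothesis with a
  -- multiple of `‖b‖`, which is integrable on the bounded column.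
  have t2 : Tendsto (fun j => ∫ x in col n l h, fderiv ℝ (cutoff e l j) x (Z x • b x)) atTop
      (𝓝 0) := by
    refine tendsto_setIntegral_fderiv_cutoff (e := e) hm (fun x hx i => hx.1 i)
      (hZ.continuous.aestronglyMeasurable.smul hb.1) (K := fun x => (∑ i, M i) * ‖b x‖)
      (hbi.norm.const_mul _) ?_
    filter_upwards [ae_restrict_mem hm] with x hx i
    rw [PiLp.smul_apply, smul_eq_mul, abs_mul]
    have h1 : 0 ≤ l / 2 - |x (e i)| := by linarith [hx.1 i]
    have h2 : M i ≤ ∑ i, M i := Finset.single_le_sum (fun i _ => hM0 i) (Finset.mem_univ i)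
    calc |Z x| * |b x (e i)| ≤ (M i * (l / 2 - |x (e i)|)) * ‖b x‖ := by
          gcongr
          · exact mul_nonneg (hM0 i) h1
          · exact hM i x hx
          · exact abs_coord_le_norm _ _
      _ ≤ ((∑ i, M i) * (l / 2 - |x (e i)|)) * ‖b x‖ := by gcongr
      _ = _ := by ring
  have t3 : Tendsto (fun j => ∫ y in bottom n l, cutoff id l j y * (u y * Z (incl y))) atTop
      (𝓝 (∫ y in bottom n l, u y * Z (incl y))) :=
    tendsto_setIntegral_mul_cutoff (e := id) (isOpen_bottom n l).measurableSet
      (fun x hx i => hx i) (hu.integrableOn_mul (hZ.continuous.comp continuous_incl))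
  have t4 := t1.add t2
  rw [add_zero] at t4
  refine tendsto_nhds_unique t4 (t3.neg.congr' ?_)
  filter_upwards [eventually_gt_atTop 0] with j hj
  have hc : ContDiff ℝ 1 (cutoff e l j) := contDiff_cutoff e l j
  have hs : tsupport (fun x => cutoff e l j x * Z x)
      ⊆ {x | ∀ i, |x (e i)| ≤ l / 2 - 1 / j} ∩ tsupport Z :=
    subset_inter ((tsupport_mul_subset_left).trans (tsupport_cutoff_subset e l j hj))
      tsupport_mul_subset_right
  have key := htest (fun x => cutoff e l j x * Z x) ((contDiff_cutoff e l j).mul hZ) ?_ ?_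
  · unfold TestedOn at key
    have h1 : ∀ x, fderiv ℝ (fun x => cutoff e l j x * Z x) x (b x)
        = cutoff e l j x * fderiv ℝ Z x (b x) + fderiv ℝ (cutoff e l j) x (Z x • b x) := by
      intro x
      rw [fderiv_fun_mul (hc.differentiable one_ne_zero x) (hZ1.differentiable one_ne_zero x)]
      simp
    have i1 : IntegrableOn (fun x => cutoff e l j x * fderiv ℝ Z x (b x)) (col n l h) := by
      have := integrableOn_apply (isBounded_col n l h) hm hbi
        (hc.continuous.smul (hZ1.continuous_fderiv one_ne_zero))
      simpa using this
    have i2 : IntegrableOn (fun x => fderiv ℝ (cutoff e l j) x (Z x • b x)) (col n l h) := by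
      have := integrableOn_apply (isBounded_col n l h) hm hbi
        (hZ.continuous.smul (hc.continuous_fderiv one_ne_zero))
      simpa using this
    rw [← integral_add i1 i2]
    simp_rw [h1] at key
    rw [key]
    congr 1
    refine integral_congr_ae (ae_of_all _ fun y => ?_)
    have : cutoff e l j (incl y) = cutoff id l j y := by
      simp only [cutoff, e, incl_castSucc, id]
    simp only [this]
    ring
  · refine isCompact_tsupport_of_isBounded
      (isBounded_of_coord_le (max (l / 2) (max |a| |h|)) fun x hx i => ?_)
    refine Fin.lastCases ?_ (fun i => ?_) i
    · refine le_max_of_le_right ?_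
      have h1 : a ≤ x (Fin.last n) := hZa (hs hx).2
      have h2 : x (Fin.last n) < h := hZh (hs hx).2
      exact abs_le_max_abs_abs h1 h2.le
    · refine le_max_of_le_left ?_
      have := (hs hx).1 i
      have h2 := one_div_cast_pos hj
      change |x (e i)| ≤ _
      linarith
  · intro x hx
    refine ⟨fun i => ?_, hZh (hs hx).2⟩
    have := (hs hx).1 i
    have h2 := one_div_cast_pos hj
    change |x (e i)| < _
    linarith

/-- Only the values and first derivatives of the test function at heights `≥ 0` enter; the margin
down to `-1` makes the two functions agree on a neighbourhood. -/
lemma testedOn_congr {Z Z' : Euc (n + 1) → ℝ} (hZ : ∀ x, -1 < x (Fin.last n) → Z x = Z' x)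
    (h' : TestedOn l h u b Z') : TestedOn l h u b Z := by
  unfold TestedOn at *
  have h1 : ∀ x ∈ col n l h, fderiv ℝ Z x (b x) = fderiv ℝ Z' x (b x) := by
    intro x hx
    have : Z =ᶠ[𝓝 x] Z' := by
      have hopen : IsOpen {x : Euc (n + 1) | -1 < x (Fin.last n)} :=
        isOpen_lt continuous_const (by fun_prop)
      filter_upwards [hopen.mem_nhds (show -1 < x (Fin.last n) by linarith [hx.2.1])] with z hz
      exact hZ z hz
    rw [this.fderiv_eq]
  rw [setIntegral_congr_fun (isOpen_col n l h).measurableSet h1, h']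
  congr 1
  refine integral_congr_ae (ae_of_all _ fun y => ?_)
  simp only
  rw [hZ (incl y) (by rw [incl_last]; norm_num)]

/-- A smooth function of the vertical coordinate that cuts off below the hyperplane. -/
def lowerCut (x : Euc (n + 1)) : ℝ := Real.smoothTransition (x (Fin.last n) + 2)

lemma contDiff_lowerCut : ContDiff ℝ ∞ (lowerCut : Euc (n + 1) → ℝ) :=
  Real.smoothTransition.contDiff.comp (by fun_prop)

lemma lowerCut_eq_one {x : Euc (n + 1)} (hx : -1 < x (Fin.last n)) : lowerCut x = 1 :=
  Real.smoothTransition.one_of_one_le (by linarith)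

lemma tsupport_lowerCut : tsupport (lowerCut : Euc (n + 1) → ℝ) ⊆ {x | -2 ≤ x (Fin.last n)} := by
  refine closure_minimal (fun x hx => ?_) (isClosed_le continuous_const (by fun_prop))
  by_contra hlt
  exact hx (Real.smoothTransition.zero_of_nonpos
    (by linarith [not_le.1 (show ¬ (-2 ≤ x (Fin.last n)) from hlt)]))

/-- Periodic test functions may be unbounded in support, sideways and downwards. Multiplication by
`lowerCut` bounds the support from below without changing the identity; the lateral cutoff takes
care of the horizontal directions. -/
lemma testedOn_of_vanish (hp : (u, b) ∈ colAdmissible n l h) {Z : Euc (n + 1) → ℝ}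
    (hZ : ContDiff ℝ ∞ Z) (hZ0 : ∀ (i : Fin n) x, |x i.castSucc| = l / 2 → Z x = 0)
    (hZh : tsupport Z ⊆ {x | x (Fin.last n) < h}) : TestedOn l h u b Z := by
  refine testedOn_congr (Z' := fun x => lowerCut x * Z x)
    (fun x hx => by rw [lowerCut_eq_one hx, one_mul]) ?_
  refine testedOn_of_vanish_aux hp (contDiff_lowerCut.mul hZ)
    (fun i x hx => by rw [hZ0 i x hx, mul_zero]) (tsupport_mul_subset_right.trans hZh)
    (tsupport_mul_subset_left.trans tsupport_lowerCut)

end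

/-! ### Cutting into columns: monotonicity of σ along multiples. -/

section Subdivision

lemma divergence_of_notMem_tsupport {m : ℕ} {φ : Euc m → Euc m} {y : Euc m}
    (hy : y ∉ tsupport φ) : divergence φ y = 0 := by
  unfold divergence
  rw [fderiv_of_notMem_tsupport ℝ hy]
  simp

lemma divergence_comp_add_right {m : ℕ} (φ : Euc m → Euc m) (a y : Euc m) :
    divergence (fun y => φ (y + a)) y = divergence φ (y + a) := by
  unfold divergence
  simp_rw [fderiv_comp_add_right a]

lemma tsupport_comp_add_right {m : ℕ} {F : Type*} [Zero F] (f : Euc m → F) (a : Euc m) :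
    tsupport (fun y => f (y + a)) = (fun y => y + a) ⁻¹' tsupport f :=
  tsupport_comp_eq_preimage f (Homeomorph.addRight a)

lemma hasCompactSupport_comp_add_right {m : ℕ} {F : Type*} [Zero F] {f : Euc m → F}
    (hf : HasCompactSupport f) (a : Euc m) : HasCompactSupport (fun y => f (y + a)) :=
  hf.comp_homeomorph (Homeomorph.addRight a)

/-- The integral of a function that vanishes off a translate. -/
lemma setIntegral_translate {m : ℕ} {S T : Set (Euc m)} (hT : MeasurableSet T) {a : Euc m}
    (hST : ∀ y ∈ S, y + a ∈ T) {f : Euc m → ℝ} (hf : ∀ x ∈ T, x + -a ∉ S → f x = 0) :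
    ∫ x in T, f x = ∫ y in S, f (y + a) := by
  have h1 : ∫ x in T, f x = ∫ x in (fun y => y + a) '' S, f x := by
    apply setIntegral_eq_of_subset_of_forall_sdiff_eq_zero hT
    · rintro _ ⟨y, hy, rfl⟩
      exact hST y hy
    · rintro x ⟨hx, hxS⟩
      refine hf x hx fun h => hxS ⟨x + -a, h, ?_⟩
      simp
  rw [h1]
  exact (measurePreserving_add_right volume a).setIntegral_image_emb
    (measurableEmbedding_addRight a) f S

/-- The total variation is superadditive on disjoint translates. -/
lemma sum_variation_translate_le {n : ℕ} {ι : Type*} (s : Finset ι) (a : ι → Euc n)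
    {S T : Set (Euc n)} (hT : MeasurableSet T)
    (hST : ∀ c ∈ s, ∀ y ∈ S, y + a c ∈ T)
    (hdisj : ∀ c ∈ s, ∀ c' ∈ s, ∀ x ∈ S, ∀ x' ∈ S, x + a c = x' + a c' → c = c')
    {u : Euc n → ℝ} (hu : ∀ g : Euc n → ℝ, Continuous g → IntegrableOn (fun y => u y * g y) T) :
    ∑ c ∈ s, variation S (fun y => u (y + a c)) ≤ variation T u := by
  classical
  set TF := {φ : Euc n → Euc n // ContDiff ℝ 1 φ ∧ HasCompactSupport φ ∧ tsupport φ ⊆ S ∧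
    ∀ y, ‖φ y‖ ≤ 1} with hTF
  let zeroTF : TF := ⟨fun _ => 0, contDiff_const, HasCompactSupport.zero,
    (by simp [tsupport]), by simp⟩
  set I : ι → TF → ℝ := fun c φ => ∫ y in S, u (y + a c) * divergence φ.1 y with hI
  have hI0 : ∀ c, I c zeroTF = 0 := fun c => by
    simp [hI, zeroTF, divergence]
  -- One test field per translate is glued into a single field on `T`; at each point at most one
  -- summand is nonzero, so the norm stays at most one.
  have hsum : ∀ φ : ι → TF, ENNReal.ofReal (∑ c ∈ s, I c (φ c)) ≤ variation T u := by
    intro φ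
    set Φ : Euc n → Euc n := fun y => ∑ c ∈ s, (φ c).1 (y + -a c) with hΦ
    have hC : ∀ c, ContDiff ℝ 1 fun y => (φ c).1 (y + -a c) := fun c =>
      (φ c).2.1.comp (contDiff_id.add contDiff_const)
    have hval : ∫ y in T, u y * divergence Φ y = ∑ c ∈ s, I c (φ c) := by
      have h1 : ∀ y, u y * divergence Φ y
          = ∑ c ∈ s, u y * divergence (fun y => (φ c).1 (y + -a c)) y := by
        intro y
        rw [hΦ, divergence_sum _ fun c _ => (hC c).differentiable one_ne_zero y, Finset.mul_sum]
      simp_rw [h1]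
      rw [integral_finsetSum _ fun c _ => hu _ (continuous_divergence (hC c))]
      refine Finset.sum_congr rfl fun c hc => ?_
      rw [setIntegral_translate hT (hST c hc)]
      · simp_rw [divergence_comp_add_right, add_neg_cancel_right, hI]
      · intro x _ hxS
        rw [divergence_comp_add_right, divergence_of_notMem_tsupport
          fun h => hxS ((φ c).2.2.2.1 h), mul_zero]
    rw [← hval]
    have hsupp : tsupport Φ ⊆ ⋃ c ∈ s, tsupport fun y => (φ c).1 (y + -a c) := by
      refine closure_minimal (fun y hy => ?_)
        (s.finite_toSet.isClosed_biUnion fun c _ => isClosed_tsupport _)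
      obtain ⟨c, hc, hcy⟩ := Finset.exists_ne_zero_of_sum_ne_zero hy
      exact mem_biUnion (Finset.mem_coe.2 hc) (subset_tsupport _ hcy)
    refine le_variation (ContDiff.sum fun c _ => hC c) ?_ ?_ ?_
    · refine HasCompactSupport.intro' (K := ⋃ c ∈ s, tsupport fun y => (φ c).1 (y + -a c))
        (s.finite_toSet.isCompact_biUnion fun c _ =>
          hasCompactSupport_comp_add_right (φ c).2.2.1 (-a c))
        (s.finite_toSet.isClosed_biUnion fun c _ => isClosed_tsupport _) fun x hx => ?_
      by_contra h
      exact hx (hsupp (subset_tsupport _ h))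
    · refine hsupp.trans (iUnion₂_subset fun c hc y hy => ?_)
      rw [tsupport_comp_add_right] at hy
      have := hST c hc _ ((φ c).2.2.2.1 hy)
      rwa [neg_add_cancel_right] at this
    · intro y
      by_cases h : ∃ c ∈ s, (φ c).1 (y + -a c) ≠ 0
      · obtain ⟨c, hc, hcy⟩ := h
        have hyS := (φ c).2.2.2.1 (subset_tsupport _ hcy)
        rw [hΦ]
        simp only
        rw [Finset.sum_eq_single_of_mem c hc]
        · exact (φ c).2.2.2.2 _
        · intro c' hc' hne
          by_contra h
          refine hne (hdisj c' hc' c hc _ ((φ c').2.2.2.1 (subset_tsupport _ h)) _ hyS ?_)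
          simp
      · push Not at h
        rw [hΦ]
        simp only
        rw [Finset.sum_eq_zero h, norm_zero]
        exact zero_le_one
  -- All variations are written as suprema over the same index set, families of test fields, so that
  -- the finite sum and the supremum can be exchanged.
  have hsup : ∀ c, variation S (fun y => u (y + a c))
      = ⨆ φ : ι → TF, ENNReal.ofReal (I c (φ c)) := by
    intro c
    refine le_antisymm (iSup₂_le fun φ hφ => ?_) (iSup_le fun φ => ?_)
    · exact le_iSup_of_le (fun _ => ⟨φ, hφ⟩) le_rfl
    · exact le_variation (φ c).2.1 (φ c).2.2.1 (φ c).2.2.2.1 (φ c).2.2.2.2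
  simp_rw [hsup]
  rw [ENNReal.finsetSum_iSup]
  · refine iSup_le fun φ => ?_
    -- `ENNReal.ofReal` is additive on nonnegative numbers only, so fields with a negative integral
    -- are replaced by zero.
    set φ' : ι → TF := fun c => if 0 ≤ I c (φ c) then φ c else zeroTF with hφ'
    have h1 : ∀ c, ENNReal.ofReal (I c (φ c)) = ENNReal.ofReal (I c (φ' c)) ∧ 0 ≤ I c (φ' c) := by
      intro c
      simp only [hφ']
      split_ifs with h
      · exact ⟨rfl, h⟩
      · rw [hI0, ENNReal.ofReal_of_nonpos (not_le.1 h).le, ENNReal.ofReal_zero]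
        exact ⟨rfl, le_rfl⟩
    rw [Finset.sum_congr rfl fun c _ => (h1 c).1,
      ← ENNReal.ofReal_sum_of_nonneg fun c _ => (h1 c).2]
    exact hsum φ'
  -- Directedness: for each translate keep the better of the two fields.
  · intro φ φ'
    refine ⟨fun c => if I c (φ c) ≤ I c (φ' c) then φ' c else φ c, fun c => ?_⟩
    simp only
    split_ifs with h
    · exact ⟨ENNReal.ofReal_le_ofReal h, le_rfl⟩
    · exact ⟨le_rfl, ENNReal.ofReal_le_ofReal (not_le.1 h).le⟩

/-- The energy in a column. -/
def colEnergy (n : ℕ) (l h : ℝ) (p : (Euc n → ℝ) × (Euc (n + 1) → Euc (n + 1))) : ℝ≥0∞ :=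
  variation (bottom n l) p.1 + ∫⁻ x in col n l h, ENNReal.ofReal (‖p.2 x‖ ^ 2 / 2)

variable {n : ℕ} (k : ℕ) {l h H : ℝ}

lemma cellMap_one_apply (c : Fin n → ℤ) (y : Euc n) :
    cellMap (fun _ => 1) k l c y = y + WithLp.toLp 2 fun i => ctr k l (c i) := by
  rw [cellMap, aff_apply, flip_one]

lemma sgnH_one (c : Fin n → ℤ) : sgnH (fun _ => 1) c = fun _ => 1 := by
  funext i
  refine Fin.lastCases ?_ (fun i => ?_) i <;> simp [sgnH]

lemma cellMapH_one_apply (c : Fin n → ℤ) (x : Euc (n + 1)) :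
    cellMapH (fun _ => 1) k l c x = x + ctrH k l c := by
  rw [cellMapH, aff_apply, sgnH_one, flip_one]

lemma map_add_restrict_le {m : ℕ} {S T : Set (Euc m)} {a : Euc m} (hST : ∀ y ∈ S, y + a ∈ T) :
    (volume.restrict S).map (fun y => y + a) ≤ volume.restrict T := by
  rw [((measurePreserving_add_right volume a).restrict_image_emb
    (measurableEmbedding_addRight a) S).map_eq]
  refine Measure.restrict_mono ?_ le_rfl
  rintro _ ⟨y, hy, rfl⟩
  exact hST y hy

/-- Restriction of an admissible pair to a translated smaller column. -/
lemma colAdmissible_translate {l' : ℝ} (hhH : h ≤ H) {a : Euc n} {aH : Euc (n + 1)}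
    (haH : ∀ i : Fin n, aH i.castSucc = a i) (haH0 : aH (Fin.last n) = 0)
    (hsub : ∀ y ∈ bottom n l, y + a ∈ bottom n l')
    {p : (Euc n → ℝ) × (Euc (n + 1) → Euc (n + 1))} (hp : p ∈ colAdmissible n l' H)
    (hvar : variation (bottom n l) (fun y => p.1 (y + a)) < ⊤) :
    (fun y => p.1 (y + a), fun x => p.2 (x + aH)) ∈ colAdmissible n l h := by
  obtain ⟨⟨hu1, hu2⟩, -, hb, htest⟩ := hp
  have hsub' : ∀ z : Euc (n + 1), (∀ i : Fin n, |z i.castSucc| < l / 2) →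
      ∀ i : Fin n, |(z + aH) i.castSucc| < l' / 2 := by
    intro z hz i
    have := hsub (hor z) hz i
    rw [PiLp.add_apply, haH]
    exact this
  have hsubH : ∀ x ∈ col n l h, x + aH ∈ col n l' H := by
    intro x hx
    refine ⟨hsub' x hx.1, ?_, ?_⟩ <;> rw [PiLp.add_apply, haH0, add_zero]
    · exact hx.2.1
    · exact hx.2.2.trans_le hhH
  have hle := map_add_restrict_le hsub
  have hleH := map_add_restrict_le hsubH
  have hemb := measurableEmbedding_addRight a
  have hembH := measurableEmbedding_addRight aH
  refine ⟨⟨?_, ?_⟩, hvar, ?_, ?_⟩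
  · exact hemb.aestronglyMeasurable_map_iff.1 (hu1.mono_measure hle)
  · exact hemb.ae_map_iff.1 (hu2.filter_mono (ae_mono hle))
  · exact (hembH.memLp_map_measure_iff).1 (hb.mono_measure hleH)
  · intro ζ hζ hζc hζs
    -- The test function is carried to the large column; its support stays over the translated small
    -- one, so both integrals reduce to the latter.
    set ζ' : Euc (n + 1) → ℝ := fun x => ζ (x + -aH) with hζ'
    have hs' : tsupport ζ' = (fun y => y + -aH) ⁻¹' tsupport ζ := tsupport_comp_add_right _ _
    have key := htest ζ' (hζ.comp (contDiff_id.add contDiff_const))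
      (hasCompactSupport_comp_add_right hζc _) ?_
    · unfold TestedOn at key ⊢
      rw [setIntegral_translate (isOpen_col n l' H).measurableSet hsubH,
        setIntegral_translate (isOpen_bottom n l').measurableSet hsub] at key
      · simp only [hζ'] at key
        simp_rw [fderiv_comp_add_right, add_neg_cancel_right] at key
        rw [key]
        congr 1
        refine integral_congr_ae (ae_of_all _ fun y => ?_)
        have : incl (y + a) + -aH = incl y := by
          ext i
          refine Fin.lastCases ?_ (fun i => ?_) i
          · simp [incl_last, haH0]
          · simp [incl_castSucc, haH]
        simp only [this]
      · intro y _ hyS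
        have : ζ' (incl y) = 0 := by
          refine image_eq_zero_of_notMem_tsupport fun hmem => hyS fun i => ?_
          rw [hs'] at hmem
          have := (hζs hmem).1 i
          simpa [incl_castSucc, haH] using this
        rw [this, mul_zero]
      · intro x hx hxS
        have : fderiv ℝ ζ' x = 0 := by
          refine fderiv_of_notMem_tsupport ℝ fun hmem => hxS ?_
          rw [hs'] at hmem
          refine ⟨(hζs hmem).1, ?_, (hζs hmem).2⟩
          have := hx.2.1
          simpa [haH0] using this
        rw [this, zero_apply]
    · intro x hx
      rw [hs'] at hx
      have h1 := hζs hx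
      have h2 := hsub' _ h1.1
      simp only [neg_add_cancel_right] at h2
      refine ⟨h2, ?_⟩
      have := h1.2
      simp only [PiLp.add_apply, PiLp.neg_apply, haH0, neg_zero, add_zero] at this
      exact this.trans_le hhH

/-- One of the `k^n` columns of a subdivision carries at most its share of the energy. -/
lemma exists_colAdmissible_subdivide (hl : 0 < l) (hk : 0 < k) (hhH : h ≤ H)
    {p : (Euc n → ℝ) × (Euc (n + 1) → Euc (n + 1))} (hp : p ∈ colAdmissible n (k * l) H) :
    ∃ p' ∈ colAdmissible n l h, (k : ℝ≥0∞) ^ n * colEnergy n l h p' ≤ colEnergy n (k * l) H p := by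
  set σ : ℤ → ℤˣ := fun _ => 1
  set a : (Fin n → ℤ) → Euc n := fun c => WithLp.toLp 2 fun i => ctr k l (c i) with ha
  have hST : ∀ c ∈ cells n k, ∀ y ∈ bottom n l, y + a c ∈ bottom n (k * l) := fun c hc y hy => by
    rw [← cellMap_one_apply]
    exact cellMap_mem _ hl hc hy
  have hdisj : ∀ c ∈ cells n k, ∀ c' ∈ cells n k, ∀ x ∈ bottom n l, ∀ x' ∈ bottom n l,
      x + a c = x' + a c' → c = c' := by
    intro c _ c' _ x hx x' hx' he
    rw [← idx_cellMap σ k c hl hx, ← idx_cellMap σ k c' hl hx', cellMap_one_apply,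
      cellMap_one_apply]
    exact congrArg _ he
  have hvar := sum_variation_translate_le (cells n k) a (isOpen_bottom n (k * l)).measurableSet
    hST hdisj fun g hg => hp.1.integrableOn_mul hg
  have hfield : ∑ c ∈ cells n k, ∫⁻ x in col n l h, ENNReal.ofReal (‖p.2 (x + ctrH k l c)‖ ^ 2 / 2)
      ≤ ∫⁻ x in col n (k * l) H, ENNReal.ofReal (‖p.2 x‖ ^ 2 / 2) := by
    have h1 : col n (k * l) h ⊆ col n (k * l) H := fun x hx => ⟨hx.1, hx.2.1, hx.2.2.trans_le hhH⟩
    refine le_trans (le_of_eq ?_) (lintegral_mono_set h1)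
    rw [setLIntegral_cells (restrict_col_eq n σ k hl h)]
    refine Finset.sum_congr rfl fun c _ => ?_
    refine lintegral_congr fun x => ?_
    rw [← cellMapH_one_apply]
    rfl
  set q : (Fin n → ℤ) → (Euc n → ℝ) × (Euc (n + 1) → Euc (n + 1)) :=
    fun c => (fun y => p.1 (y + a c), fun x => p.2 (x + ctrH k l c)) with hq
  have hsum : ∑ c ∈ cells n k, colEnergy n l h (q c) ≤ colEnergy n (k * l) H p := by
    unfold colEnergy
    rw [Finset.sum_add_distrib]
    exact add_le_add hvar hfield
  have hne : (cells n k).Nonempty := by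
    rw [← Finset.card_pos, card_cells]
    positivity
  -- The minimum is taken of the total energy, so that one cell serves the variation and the field
  -- at once.
  obtain ⟨c, hc, hmin⟩ := Finset.exists_min_image (cells n k) (fun c => colEnergy n l h (q c)) hne
  refine ⟨q c, colAdmissible_translate hhH (a := a c) (fun i => ?_) ?_ (hST c hc) hp ?_, ?_⟩
  · simp [ctrH, ha]
  · simp [ctrH]
  · exact ((Finset.single_le_sum (f := fun c => variation (bottom n l) fun y => p.1 (y + a c))
      (fun _ _ => zero_le) hc).trans hvar).trans_lt hp.2.1
  · refine le_trans ?_ hsum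
    have := Finset.card_nsmul_le_sum (cells n k) (fun c => colEnergy n l h (q c)) _ hmin
    rwa [card_cells, nsmul_eq_mul, Nat.cast_pow] at this

end Subdivision

/-! ### Periodic extension of test functions: σ is at most σ^per and σ⁰. -/

section Periodization

variable {m : ℕ} (P : Fin m → Prop) [DecidablePred P] (L : ℝ)

/-- The lattice vector with the coordinates `L * r i` for the `i` that satisfy `P`. -/
def latticeVec (r : Fin m → ℤ) : Euc m := WithLp.toLp 2 fun i => if P i then L * r i else 0

/-- Translation into the cell at the origin, in the coordinates that satisfy `P`. -/
def wrap (x : Euc m) : Euc m := x - latticeVec P L fun i => round (x i / L)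

variable {P L}

lemma wrap_coord (x : Euc m) (i : Fin m) :
    wrap P L x i = x i - if P i then L * round (x i / L) else 0 := rfl

lemma abs_sub_mul_round_le (hL : 0 < L) (t : ℝ) : |t - L * round (t / L)| ≤ L / 2 := by
  have h := abs_sub_round (t / L)
  have h1 : t - L * round (t / L) = L * (t / L - round (t / L)) := by field_simp
  rw [h1, abs_mul, abs_of_pos hL]
  nlinarith

lemma le_abs_sub_int {t : ℝ} (hL : 0 < L) {a b : ℤ} (hab : a ≠ b) :
    L - |t - L * a| ≤ |t - L * b| := by
  have h1 : (1 : ℝ) ≤ |(a : ℝ) - b| := by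
    have : (1 : ℤ) ≤ |a - b| := Int.one_le_abs (sub_ne_zero.2 hab)
    exact_mod_cast this
  have h2 : L ≤ |L * a - L * b| := by
    rw [← mul_sub, abs_mul, abs_of_pos hL]
    nlinarith
  have h3 : |L * a - L * b| ≤ |t - L * a| + |t - L * b| := by
    have := abs_sub (t - L * b) (t - L * a)
    have h4 : t - L * b - (t - L * a) = L * a - L * b := by ring
    rw [h4] at this
    linarith
  linarith

lemma wrap_of_mem (hL : 0 < L) {x : Euc m} (hx : ∀ i, P i → |x i| < L / 2) : wrap P L x = x := by
  ext i
  rw [wrap_coord]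
  split_ifs with h
  · have h1 := abs_lt.1 (hx i h)
    have : round (x i / L) = 0 := by
      rw [round_eq_zero_iff]
      exact ⟨by rw [le_div_iff₀ hL]; linarith, by rw [div_lt_iff₀ hL]; linarith⟩
    rw [this, Int.cast_zero, mul_zero, sub_zero]
  · exact sub_zero _

lemma wrap_add_single (hL : 0 < L) (x : Euc m) {i : Fin m} (hi : P i) :
    wrap P L (x + EuclideanSpace.single i L) = wrap P L x := by
  ext j
  rw [wrap_coord, wrap_coord, PiLp.add_apply]
  by_cases hj : j = i
  · subst hj
    simp only [PiLp.single_apply, if_true, if_pos hi]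
    rw [add_div, div_self hL.ne', round_add_one]
    push_cast
    ring
  · simp [hj]

/-- The map `wrap` jumps only at half-lattice points of a coordinate, where `f` vanishes with a
margin `L / 2 - ρ`. Near any `x₀` the composition therefore equals one fixed translate of `f`. -/
lemma contDiff_comp_wrap {F : Type*} [NormedAddCommGroup F] [NormedSpace ℝ F] {r : WithTop ℕ∞}
    {f : Euc m → F} (hf : ContDiff ℝ r f) (hL : 0 < L) {ρ : ℝ} (hρ : ρ < L / 2)
    (hfρ : ∀ x, f x ≠ 0 → ∀ i, P i → |x i| ≤ ρ) : ContDiff ℝ r fun x => f (wrap P L x) := by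
  rw [contDiff_iff_contDiffAt]
  intro x₀
  set r₀ : Fin m → ℤ := fun i => round (x₀ i / L) with hr₀
  have hg : ContDiff ℝ r fun x => f (x - latticeVec P L r₀) :=
    hf.comp (contDiff_id.sub contDiff_const)
  refine hg.contDiffAt.congr_of_eventuallyEq ?_
  have hU : {x : Euc m | ∀ i, |x i - x₀ i| < L / 2 - ρ} ∈ 𝓝 x₀ := by
    refine IsOpen.mem_nhds ?_ fun i => by rw [sub_self, abs_zero]; linarith
    have : {x : Euc m | ∀ i, |x i - x₀ i| < L / 2 - ρ}
        = ⋂ i, {x : Euc m | |x i - x₀ i| < L / 2 - ρ} := by ext; simp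
    rw [this]
    exact isOpen_iInter_of_finite fun i => isOpen_lt (by fun_prop) continuous_const
  filter_upwards [hU] with x hx
  by_cases h : ∀ i, P i → round (x i / L) = r₀ i
  · congr 1
    ext i
    rw [wrap_coord, PiLp.sub_apply]
    simp only [latticeVec]
    split_ifs with hi
    · rw [h i hi]
    · rfl
  -- If `x` and `x₀` round to different lattice points in coordinate `i`, then `x i` is farther than
  -- `ρ` from both of them, so both values of `f` are zero.
  · push Not at h
    obtain ⟨i, hi, hne⟩ := h
    have a1 := abs_sub_mul_round_le hL (x i)
    have a2 := abs_sub_mul_round_le hL (x₀ i)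
    have a3 := hx i
    have a4 : |x i - L * r₀ i| < L - ρ := by
      have h1 := abs_add_le (x i - x₀ i) (x₀ i - L * r₀ i)
      have h2 : x i - x₀ i + (x₀ i - L * r₀ i) = x i - L * r₀ i := by ring
      rw [h2] at h1
      change |x₀ i - L * r₀ i| ≤ L / 2 at a2
      linarith
    have z1 : f (wrap P L x) = 0 := by
      by_contra h0
      have h1 := hfρ _ h0 i hi
      rw [wrap_coord, if_pos hi] at h1
      have h2 := le_abs_sub_int (t := x i) hL hne.symm
      linarith
    have z2 : f (x - latticeVec P L r₀) = 0 := by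
      by_contra h0
      have h1 := hfρ _ h0 i hi
      rw [PiLp.sub_apply] at h1
      simp only [latticeVec, if_pos hi] at h1
      have h2 := le_abs_sub_int (t := x i) hL hne
      linarith
    rw [z1, z2]

/-- The support of a compactly supported function stays away from the boundary. -/
lemma exists_lt_of_hasCompactSupport {F : Type*} [Zero F] {f : Euc m → F}
    (hf : HasCompactSupport f) {g : Euc m → ℝ} (hg : Continuous g) {t : ℝ}
    (hfg : tsupport f ⊆ {x | g x < t}) : ∃ ρ < t, ∀ x, f x ≠ 0 → g x ≤ ρ := by
  rcases (tsupport f).eq_empty_or_nonempty with h | h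
  · refine ⟨t - 1, by linarith, fun x hx => ?_⟩
    have := subset_tsupport f hx
    rw [h] at this
    exact absurd this (notMem_empty x)
  · obtain ⟨x₀, hx₀, hmax⟩ := hf.isCompact.exists_isMaxOn h hg.continuousOn
    exact ⟨g x₀, hfg hx₀, fun x hx => hmax (subset_tsupport f hx)⟩

/-- The sup norm of the selected coordinates is a single continuous function, which attains its
maximum on the compact support. -/
lemma exists_uniform_coord_lt {F : Type*} [Zero F] {f : Euc m → F} (hL : 0 < L)
    (hf : HasCompactSupport f) (hfP : tsupport f ⊆ {x | ∀ i, P i → |x i| < L / 2}) :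
    ∃ ρ < L / 2, ∀ x, f x ≠ 0 → ∀ i, P i → |x i| ≤ ρ := by
  have hg : Continuous fun x : Euc m => ‖fun i => if P i then x i else 0‖ := by
    refine continuous_norm.comp (continuous_pi fun i => ?_)
    split_ifs <;> fun_prop
  have hfg : tsupport f ⊆ {x | ‖fun i => if P i then x i else 0‖ < L / 2} := by
    intro x hx
    rw [mem_ofPred_eq, pi_norm_lt_iff (by linarith)]
    intro i
    split_ifs with hi
    · exact hfP hx i hi
    · rw [norm_zero]; linarith
  obtain ⟨ρ, hρ, h⟩ := exists_lt_of_hasCompactSupport hf hg hfg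
  refine ⟨ρ, hρ, fun x hx i hi => ?_⟩
  have h1 := norm_le_pi_norm (fun i => if P i then x i else 0) i
  simp only [if_pos hi, Real.norm_eq_abs] at h1
  exact h1.trans (h x hx)

end Periodization

variable {n : ℕ} {L : ℝ}

/-- A test field supported in the open cell has a smooth periodic extension with the same bound,
hence competes on the torus. -/
lemma variation_le_variationPer (hL : 0 < L) (u : Euc n → ℝ) :
    variation (bottom n L) u ≤ variationPer L u := by
  refine iSup₂_le fun φ ⟨h1, h2, h3, h4⟩ => ?_
  obtain ⟨ρ, hρ, hφρ⟩ := exists_uniform_coord_lt (P := fun _ => True) hL h2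
    (h3.trans fun x hx i _ => hx i)
  have hval : ∀ y ∈ bottom n L,
      u y * divergence φ y = u y * divergence (fun y => φ (wrap (fun _ => True) L y)) y := by
    intro y hy
    have : (fun y => φ (wrap (fun _ => True) L y)) =ᶠ[𝓝 y] φ := by
      filter_upwards [(isOpen_bottom n L).mem_nhds hy] with z hz
      rw [wrap_of_mem hL fun i _ => hz i]
    unfold divergence
    rw [this.fderiv_eq]
  rw [setIntegral_congr_fun (isOpen_bottom n L).measurableSet hval]
  exact le_iSup₂_of_le (f := fun (φ : Euc n → Euc n) (_ : ContDiff ℝ 1 φ ∧ IsPeriodic L φ ∧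
    ∀ y, ‖φ y‖ ≤ 1) => ENNReal.ofReal (∫ y in bottom n L, u y * divergence φ y)) _
    ⟨contDiff_comp_wrap h1 hL hρ hφρ, fun y i => congrArg φ (wrap_add_single hL y trivial),
      fun y => h4 _⟩ le_rfl

lemma admissiblePer_subset (hL : 0 < L) : admissiblePer n L ⊆ admissible n L := by
  rintro ⟨u, b⟩ ⟨-, -, hu, hvar, hb, htest⟩
  refine ⟨hu, (variation_le_variationPer hL u).trans_lt hvar, hb, fun ζ hζ hζc hζs => ?_⟩
  -- Only the horizontal coordinates are wrapped; the vertical one, and with it the support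
  -- condition at the top, is left alone.
  set P : Fin (n + 1) → Prop := fun i => i ≠ Fin.last n with hP
  have hPc : ∀ i : Fin n, P i.castSucc := fun i => (Fin.castSucc_lt_last i).ne
  obtain ⟨ρ, hρ, hζρ⟩ := exists_uniform_coord_lt (P := P) hL hζc (by
    intro x hx i hi
    obtain ⟨j, rfl⟩ := Fin.exists_castSucc_eq.2 hi
    exact (hζs hx).1 j)
  obtain ⟨t, ht, hζt⟩ := exists_lt_of_hasCompactSupport hζc
    (g := fun x => x (Fin.last n)) (by fun_prop) (hζs.trans fun x hx => hx.2)
  have hlast : ∀ x : Euc (n + 1), wrap P L x (Fin.last n) = x (Fin.last n) := fun x => by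
    rw [wrap_coord, if_neg (by simp [hP]), sub_zero]
  have hcell : ∀ x : Euc (n + 1), (∀ i : Fin n, |x i.castSucc| < L / 2) → wrap P L x = x := by
    intro x hx
    refine wrap_of_mem hL fun i hi => ?_
    obtain ⟨j, rfl⟩ := Fin.exists_castSucc_eq.2 hi
    exact hx j
  have key := htest (fun x => ζ (wrap P L x)) (contDiff_comp_wrap hζ hL hρ hζρ)
    (fun x i => congrArg ζ (wrap_add_single hL x (hPc i))) ?_
  · unfold TestedBy at key ⊢
    have e1 : ∀ x ∈ cube n L, fderiv ℝ (fun x => ζ (wrap P L x)) x (b x) = fderiv ℝ ζ x (b x) := by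
      intro x hx
      have : (fun x => ζ (wrap P L x)) =ᶠ[𝓝 x] ζ := by
        filter_upwards [(isOpen_col n L L).mem_nhds hx] with z hz
        rw [hcell z hz.1]
      rw [this.fderiv_eq]
    have e2 : ∀ y ∈ bottom n L, u y * ζ (wrap P L (incl y)) = u y * ζ (incl y) := by
      intro y hy
      rw [hcell (incl y) fun i => by rw [incl_castSucc]; exact hy i]
    refine (setIntegral_congr_fun (isOpen_col n L L).measurableSet e1).symm.trans (key.trans ?_)
    exact congrArg _ (setIntegral_congr_fun (isOpen_bottom n L).measurableSet e2)
  · have : tsupport (fun x => ζ (wrap P L x)) ⊆ {x | x (Fin.last n) ≤ t} := by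
      refine closure_minimal (fun x hx => ?_) (isClosed_le (by fun_prop) continuous_const)
      have := hζt _ hx
      rwa [hlast] at this
    exact this.trans fun x hx => lt_of_le_of_lt hx ht

lemma sigma_le_sigmaPer (hL : 0 < L) : sigma n L ≤ sigmaPer n L := by
  refine le_iInf₂ fun p hp => iInf₂_le_of_le p (admissiblePer_subset hL hp) ?_
  unfold energy energyPer
  gcongr
  exact variation_le_variationPer hL p.1

lemma sigma_le_sigmaZero : sigma n L ≤ sigmaZero n L :=
  le_iInf₂ fun p hp => iInf₂_le_of_le p hp.1 le_rfl

lemma energy_div_le {k : ℕ} (hk : 0 < k) {a b : ℝ≥0∞}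
    (h : (k : ℝ≥0∞) ^ n * a ≤ b) :
    a / ENNReal.ofReal (L ^ n) ≤ b / ENNReal.ofReal ((k * L) ^ n) := by
  have hk0 : (k : ℝ≥0∞) ^ n ≠ 0 := by
    simp [hk.ne']
  have hkt : (k : ℝ≥0∞) ^ n ≠ ⊤ := by simp
  rw [mul_pow, ENNReal.ofReal_mul (by positivity), ENNReal.ofReal_pow (Nat.cast_nonneg k),
    ENNReal.ofReal_natCast, ← ENNReal.mul_div_mul_left a _ hk0 hkt]
  gcongr

lemma sigma_le_sigma_mul (hL : 0 < L) {k : ℕ} (hk : 0 < k) : sigma n L ≤ sigma n (k * L) := by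
  refine le_iInf₂ fun p hp => ?_
  have hk1 : (1 : ℝ) ≤ k := by exact_mod_cast hk
  -- Columns of height equal to their width are cubes by definition, so the columns of width `L` are
  -- truncated to height `L`.
  obtain ⟨p', hp', hE⟩ := exists_colAdmissible_subdivide (h := L) (H := k * L) k hL hk
    (by nlinarith) hp
  exact iInf₂_le_of_le p' hp' (energy_div_le hk hE)

lemma negOnePow_add_unit (m : ℤ) (e : ℤˣ) : (m + (e : ℤ)).negOnePow = -m.negOnePow := by
  rcases Int.units_eq_one_or e with h | h <;> subst h
  · rw [Units.val_one, Int.negOnePow_succ]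
  · have := Int.negOnePow_succ (m - 1)
    rw [sub_add_cancel] at this
    rw [this, Units.val_neg, Units.val_one, neg_neg, sub_eq_add_neg]

lemma exists_unit_of_abs_eq {t r : ℝ} (h : |t| = r) : ∃ e : ℤˣ, t = ((e : ℤ) : ℝ) * r := by
  rcases abs_choice t with h1 | h1
  · exact ⟨1, by simp [← h, h1]⟩
  · exact ⟨-1, by simp [← h, h1]⟩

section Scale

variable {n : ℕ} {l : ℝ} {u : Euc n → ℝ} {ψ : Euc n → Euc n} {N : ℝ}

lemma ofReal_integral_divergence_scale (hN : 0 < N) (hψ : ContDiff ℝ 1 ψ) :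
    ENNReal.ofReal (∫ y in bottom n l, u y * divergence ψ y) = ENNReal.ofReal N *
      ENNReal.ofReal (∫ y in bottom n l, u y * divergence (fun y => N⁻¹ • ψ y) y) := by
  rw [← ENNReal.ofReal_mul hN.le, ← integral_const_mul]
  congr 1
  refine integral_congr_ae (ae_of_all _ fun y => ?_)
  simp only
  rw [divergence_const_smul _ (hψ.differentiable one_ne_zero y)]
  field_simp

lemma norm_inv_smul_le (hN : 0 < N) (hψN : ∀ y, ‖ψ y‖ ≤ N) (y : Euc n) : ‖N⁻¹ • ψ y‖ ≤ 1 := by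
  rw [norm_smul, norm_inv, Real.norm_of_nonneg hN.le, inv_mul_le_iff₀ hN, mul_one]
  exact hψN y

end Scale

/-! ### Even reflection: monotonicity of σ⁰ along multiples. -/

section EvenReflection

variable {n k : ℕ} {L : ℝ}

lemma unfoldVec_one_apply {σ : ℤ → ℤˣ} {l : ℝ} (φ : Euc n → Euc n) (y : Euc n) (i : Fin n) :
    unfoldVec σ (fun _ => 1) k l φ y i
      = ∑ c ∈ cells n k, ((σ (c i) : ℤ) : ℝ) * φ (cellMap σ k l c y) i := by
  simp [unfoldVec, flip_apply]

/-- Under even reflections the contributions of neighbouring cells to the normal component of the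
test field cancel. -/
lemma unfoldVec_tangential {φ : Euc n → Euc n} (hφ : ∀ y, y ∉ bottom n (k * L) → φ y = 0)
    (i : Fin n) (y : Euc n) (hy : |y i| = L / 2) :
    unfoldVec Int.negOnePow (fun _ => 1) k L φ y i = 0 := by
  classical
  obtain ⟨s, hs⟩ := exists_unit_of_abs_eq hy
  rw [unfoldVec_one_apply]
  -- With `y i = s * L / 2`, the cell `m` sends `y` to its face on the side `s * (-1) ^ m`, which it
  -- shares with the cell `τ m`. Both cells send `y` to the same point, with opposite orientations.
  set τ : ℤ → ℤ := fun m => m + ((s * m.negOnePow : ℤˣ) : ℤ) with hτ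
  have hττ : ∀ m, τ (τ m) = m := by
    intro m
    simp only [hτ, negOnePow_add_unit]
    push_cast
    ring
  have hpos : ∀ m : ℤ, ((m.negOnePow : ℤ) : ℝ) * y i + ctr k L m
      = L * (m + ((s * m.negOnePow : ℤˣ) : ℤ) / 2 + 1 / 2 - k / 2) := by
    intro m
    rw [hs, ctr]
    push_cast
    ring
  have hposτ : ∀ m : ℤ, (((τ m).negOnePow : ℤ) : ℝ) * y i + ctr k L (τ m)
      = ((m.negOnePow : ℤ) : ℝ) * y i + ctr k L m := by
    intro m
    rw [hpos, hpos]
    simp only [hτ, negOnePow_add_unit]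
    push_cast
    ring
  set f : (Fin n → ℤ) → ℝ := fun c =>
    (((c i).negOnePow : ℤ) : ℝ) * φ (cellMap Int.negOnePow k L c y) i with hf
  -- A missing neighbour means that the point lies on the outer boundary, where `φ` vanishes. Such
  -- cells are the fixed points of the involution below.
  have hf0 : ∀ c ∈ cells n k, τ (c i) ∉ Finset.Ico (0 : ℤ) k → f c = 0 := by
    intro c hc hτc
    have h1 := Finset.mem_Ico.1 (Fintype.mem_piFinset.1 hc i)
    rw [hf]
    simp only
    rw [hφ _ fun hmem => ?_, PiLp.zero_apply, mul_zero]
    have h2 := hmem i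
    rw [cellMap_coord, hpos] at h2
    obtain ⟨h3, h4⟩ := abs_lt.1 h2
    simp only [hτ, Finset.mem_Ico, not_and_or, not_le, not_lt] at hτc
    rcases Int.units_eq_one_or (s * (c i).negOnePow) with he | he
    · simp only [he, Units.val_one] at hτc h4
      have h5 : c i = k - 1 := by omega
      rw [h5] at h4
      push_cast at h4
      linarith
    · simp only [he, Units.val_neg, Units.val_one] at hτc h3
      have h5 : c i = 0 := by omega
      rw [h5] at h3
      push_cast at h3
      linarith
  refine Finset.sum_involution
    (fun c _ => if τ (c i) ∈ Finset.Ico (0 : ℤ) k then Function.update c i (τ (c i)) else c)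
    ?_ ?_ ?_ ?_
  · intro c hc
    change f c + f _ = 0
    split_ifs with h
    · have h1 : cellMap Int.negOnePow k L (Function.update c i (τ (c i))) y
          = cellMap Int.negOnePow k L c y := by
        ext j
        rw [cellMap_coord, cellMap_coord]
        by_cases hj : j = i
        · subst hj
          rw [Function.update_self]
          exact hposτ _
        · rw [Function.update_of_ne hj]
      simp only [hf, h1, Function.update_self]
      simp only [hτ, negOnePow_add_unit]
      push_cast
      ring
    · rw [hf0 c hc h, add_zero]
  · intro c hc hne
    split_ifs with h
    · intro he
      have := congrFun he i
      rw [Function.update_self] at this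
      simp only [hτ] at this
      rcases Int.units_eq_one_or (s * (c i).negOnePow) with he | he <;> rw [he] at this <;>
        simp at this
    · exact absurd (hf0 c hc h) hne
  · intro c hc
    split_ifs with h
    · refine Fintype.mem_piFinset.2 fun j => ?_
      by_cases hj : j = i
      · subst hj; rwa [Function.update_self]
      · rw [Function.update_of_ne hj]; exact Fintype.mem_piFinset.1 hc j
    · exact hc
  · intro c hc
    by_cases h : τ (c i) ∈ Finset.Ico (0 : ℤ) k
    · simp only [if_pos h, Function.update_self, hττ, if_pos (Fintype.mem_piFinset.1 hc i),
        Function.update_idem, Function.update_eq_self]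
    · simp only [if_neg h]

/-- Divided by `k ^ n`, the unfolded test field has norm at most one and is tangential on the faces,
hence is a test field for the variation of `u`; no boundary term appears. -/
lemma variation_foldCharge_even_le (hL : 0 < L) (hk : 0 < k) {u : Euc n → ℝ}
    (hu : IsCharge n L u) :
    variation (bottom n (k * L)) (foldCharge Int.negOnePow (fun _ => 1) k L u)
      ≤ (k : ℝ≥0∞) ^ n * variation (bottom n L) u := by
  refine iSup₂_le fun φ ⟨h1, _, h3, h4⟩ => ?_
  rw [setIntegral_foldCharge_divergence _ _ k hL hu h1]
  have hN : (0 : ℝ) < (k : ℝ) ^ n := by positivity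
  have hψ := contDiff_unfoldVec (l := L) Int.negOnePow (fun _ => 1) k h1
  have hψN : ∀ y, ‖unfoldVec Int.negOnePow (fun _ => 1) k L φ y‖ ≤ (k : ℝ) ^ n := fun y => by
    simpa using norm_unfoldVec_le Int.negOnePow (fun _ => 1) k (l := L) h4 y
  rw [ofReal_integral_divergence_scale hN hψ, ENNReal.ofReal_pow (Nat.cast_nonneg k),
    ENNReal.ofReal_natCast]
  gcongr
  refine ofReal_integral_divergence_le_of_tangential hu (hψ.const_smul _)
    (norm_inv_smul_le hN hψN) fun i y hy => ?_
  rw [PiLp.smul_apply, unfoldVec_tangential (fun y hy => ?_) i y hy, smul_zero]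
  exact image_eq_zero_of_notMem_tsupport fun h => hy (h3 h)

lemma div_energy_le (hk : 0 < k) {a b : ℝ≥0∞} (h : a ≤ (k : ℝ≥0∞) ^ n * b) :
    a / ENNReal.ofReal ((k * L) ^ n) ≤ b / ENNReal.ofReal (L ^ n) := by
  have hk0 : (k : ℝ≥0∞) ^ n ≠ 0 := by
    simp [hk.ne']
  have hkt : (k : ℝ≥0∞) ^ n ≠ ⊤ := by simp
  rw [mul_pow, ENNReal.ofReal_mul (by positivity), ENNReal.ofReal_pow (Nat.cast_nonneg k),
    ENNReal.ofReal_natCast, ← ENNReal.mul_div_mul_left b _ hk0 hkt]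
  gcongr

lemma sigmaZero_mul_le (hL : 0 < L) (hk : 0 < k) : sigmaZero n (k * L) ≤ sigmaZero n L := by
  refine le_iInf₂ fun p hp => ?_
  obtain ⟨u, b⟩ := p
  obtain ⟨⟨hu, hvar, hb, -⟩, htest⟩ := hp
  have hk1 : (1 : ℝ) ≤ k := by exact_mod_cast hk
  have hLk : L ≤ k * L := by nlinarith
  set S : Set (Euc (n + 1)) := {x | x (Fin.last n) < L} with hS
  have hSm : MeasurableSet S := (isOpen_lt (by fun_prop) continuous_const).measurableSet
  set U := foldCharge Int.negOnePow (fun _ => 1) k L u with hU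
  -- The folded field fills height `L` only and is extended by zero up to `k * L`; this is
  -- compatible with zero divergence because no flux crosses the top at height `L`.
  set B := S.indicator (foldField Int.negOnePow (fun _ => 1) k L b) with hB
  have hinter : cube n (k * L) ∩ S = col n (k * L) L := by
    ext x
    constructor
    · rintro ⟨h1, h2⟩
      exact ⟨h1.1, h1.2.1, h2⟩
    · rintro ⟨h1, h2, h3⟩
      exact ⟨⟨h1, h2, lt_of_lt_of_le h3 hLk⟩, h3⟩
  have hUc : IsCharge n (k * L) U := isCharge_foldCharge _ _ k hL hu
  have hvarU := variation_foldCharge_even_le hL hk hu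
  have htestB : ∀ ζ : Euc (n + 1) → ℝ, ContDiff ℝ ∞ ζ → HasCompactSupport ζ →
      TestedBy (k * L) U B ζ := by
    intro ζ hζ hζc
    unfold TestedBy
    have h1 : ∀ x, fderiv ℝ ζ x (B x) = S.indicator
        (fun x => fderiv ℝ ζ x (foldField Int.negOnePow (fun _ => 1) k L b x)) x := by
      intro x
      by_cases hx : x ∈ S
      · rw [hB, indicator_of_mem hx, indicator_of_mem hx]
      · rw [hB, indicator_of_notMem hx, indicator_of_notMem hx, map_zero]
    simp_rw [h1]
    rw [setIntegral_indicator hSm, hinter,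
      setIntegral_foldField _ _ k hL (integrableOn_of_memLp_two (isBounded_col n L L) hb)
        (hζ.of_le (by exact_mod_cast le_top)),
      setIntegral_foldCharge _ _ k hL hu hζ.continuous]
    -- The unfolded test function has no reason to vanish on the faces, which is where the zero flux
    -- condition of the original pair is needed.
    refine htest _ (contDiff_unfoldTest _ _ k hζ) ?_
    unfold unfoldTest
    have hc : ∀ c : Fin n → ℤ, HasCompactSupport
        fun x => (((1 : ℤˣ) : ℤ) : ℝ) * ζ (cellMapH Int.negOnePow k L c x) := fun c =>
      (hζc.comp_homeomorph (cellMapH Int.negOnePow k L c).toHomeomorph).mul_left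
    refine HasCompactSupport.intro (K := ⋃ c ∈ cells n k, tsupport
      fun x => (((1 : ℤˣ) : ℤ) : ℝ) * ζ (cellMapH Int.negOnePow k L c x))
      ((cells n k).finite_toSet.isCompact_biUnion fun c _ => hc c) fun x hx => ?_
    refine Finset.sum_eq_zero fun c hcc => ?_
    by_contra hne
    exact hx (mem_biUnion (Finset.mem_coe.2 hcc)
      (subset_tsupport (fun x => (((1 : ℤˣ) : ℤ) : ℝ) * ζ (cellMapH Int.negOnePow k L c x)) hne))
  have hmemB : MemLp B 2 (volume.restrict (cube n (k * L))) := by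
    rw [hB, memLp_indicator_iff_restrict hSm, Measure.restrict_restrict hSm, inter_comm, hinter]
    exact memLp_foldField _ _ k hL hb
  refine iInf₂_le_of_le (U, B) ⟨⟨hUc, hvarU.trans_lt ?_, hmemB,
    fun ζ h1 h2 _ => htestB ζ h1 h2⟩, htestB⟩ (div_energy_le hk ?_)
  · exact ENNReal.mul_lt_top (by simp) hvar
  · unfold energy fieldEnergy
    rw [mul_add]
    refine add_le_add hvarU (le_of_eq ?_)
    have h2 : ∀ x, ENNReal.ofReal (‖B x‖ ^ 2 / 2) = S.indicator (fun x =>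
        ENNReal.ofReal (‖foldField Int.negOnePow (fun _ => 1) k L b x‖ ^ 2 / 2)) x := by
      intro x
      by_cases hx : x ∈ S
      · rw [hB, indicator_of_mem hx, indicator_of_mem hx]
      · rw [hB, indicator_of_notMem hx, indicator_of_notMem hx]
        simp
    simp only [h2]
    rw [lintegral_indicator hSm, Measure.restrict_restrict hSm, inter_comm, hinter]
    exact lintegral_foldField _ _ k hL

end EvenReflection

/-! ### Odd reflection: σ^per is at most σ plus C/L. -/

section OddReflection

variable {n : ℕ} {l h : ℝ}

/-- The sign of the cell number `c` under odd reflections. -/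
def oddSign (c : Fin n → ℤ) : ℤˣ := (∑ i, c i).negOnePow

lemma sum_update_eq (c : Fin n → ℤ) (i : Fin n) (v : ℤ) :
    ∑ j, Function.update c i v j = ∑ j, c j + (v - c i) := by
  have h1 := Finset.sum_update_of_mem (Finset.mem_univ i) c v
  have h2 := Finset.sum_update_of_mem (Finset.mem_univ i) c (c i)
  rw [Function.update_eq_self] at h2
  linarith

/-- The variation on the torus of an odd reflection: the jumps cost the area of the faces. -/
lemma exists_variationPer_foldCharge_odd_le (n : ℕ) :
    ∃ C : ℝ, 0 < C ∧ ∀ (l : ℝ) (u : Euc n → ℝ), 0 < l → IsCharge n l u →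
      variationPer ((2 : ℕ) * l) (foldCharge Int.negOnePow oddSign 2 l u)
        ≤ 2 ^ n * (variation (bottom n l) u + ENNReal.ofReal (C * l ^ (n - 1))) := by
  obtain ⟨C, hC, h⟩ := exists_ofReal_integral_divergence_le n
  refine ⟨C, hC, fun l u hl hu => iSup₂_le fun φ ⟨h1, _, h4⟩ => ?_⟩
  rw [setIntegral_foldCharge_divergence _ _ 2 hl hu h1]
  have hN : (0 : ℝ) < ((2 : ℕ) : ℝ) ^ n := by positivity
  have hψ := contDiff_unfoldVec (l := l) Int.negOnePow oddSign 2 h1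
  have hψN : ∀ y, ‖unfoldVec Int.negOnePow oddSign 2 l φ y‖ ≤ ((2 : ℕ) : ℝ) ^ n := fun y => by
    simpa using norm_unfoldVec_le Int.negOnePow oddSign 2 (l := l) h4 y
  rw [ofReal_integral_divergence_scale hN hψ, ENNReal.ofReal_pow (Nat.cast_nonneg 2),
    ENNReal.ofReal_natCast]
  refine mul_le_mul' le_rfl ?_
  exact h l u _ hl.le hu (hψ.const_smul _) (norm_inv_smul_le hN hψN)

lemma ctr_add_two (k : ℕ) (m : ℤ) : ctr k l (m + 2) = ctr k l m + (2 : ℕ) * l := by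
  unfold ctr
  push_cast
  ring

lemma negOnePow_add_two (m : ℤ) : (m + 2).negOnePow = m.negOnePow := by
  rw [Int.negOnePow_add, Int.negOnePow_even 2 (by decide), mul_one]

lemma cellNum_add (hl : 0 < l) (k : ℕ) (t : ℝ) :
    cellNum k l (t + (2 : ℕ) * l) = cellNum k l t + 2 := by
  unfold cellNum
  have : (t + (2 : ℕ) * l) / l + k / 2 = t / l + k / 2 + (2 : ℤ) := by
    field_simp
    push_cast
    ring
  rw [this, Int.floor_add_intCast]

lemma cellMap_update_add_two (c : Fin n → ℤ) (i : Fin n) (y : Euc n) :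
    cellMap Int.negOnePow 2 l (Function.update c i (c i + 2)) y
      = cellMap Int.negOnePow 2 l c y + EuclideanSpace.single i ((2 : ℕ) * l) := by
  ext j
  rw [PiLp.add_apply, cellMap_coord, cellMap_coord]
  by_cases hj : j = i
  · subst hj
    rw [Function.update_self, negOnePow_add_two, ctr_add_two]
    simp [add_assoc]
  · rw [Function.update_of_ne hj]
    simp [hj]

lemma cellMapH_update_add_two (c : Fin n → ℤ) (i : Fin n) (x : Euc (n + 1)) :
    cellMapH Int.negOnePow 2 l (Function.update c i (c i + 2)) x
      = cellMapH Int.negOnePow 2 l c x + EuclideanSpace.single i.castSucc ((2 : ℕ) * l) := by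
  ext j
  rw [PiLp.add_apply]
  refine Fin.lastCases ?_ (fun j => ?_) j
  · rw [cellMapH_last, cellMapH_last]
    simp
  rw [cellMapH_castSucc, cellMapH_castSucc]
  by_cases hj : j = i
  · subst hj
    rw [Function.update_self, negOnePow_add_two, ctr_add_two]
    simp [add_assoc]
  · rw [Function.update_of_ne hj]
    simp [hj]

lemma idx_add_single (hl : 0 < l) (y : Euc n) (i : Fin n) :
    idx 2 l (y + EuclideanSpace.single i ((2 : ℕ) * l))
      = Function.update (idx 2 l y) i (idx 2 l y i + 2) := by
  funext j
  by_cases hj : j = i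
  · subst hj
    rw [Function.update_self]
    simp only [idx, PiLp.add_apply, PiLp.single_apply, if_true]
    exact cellNum_add hl 2 _
  · rw [Function.update_of_ne hj]
    simp [idx, hj]

lemma oddSign_update_add_two (c : Fin n → ℤ) (i : Fin n) :
    oddSign (Function.update c i (c i + 2)) = oddSign c := by
  rw [oddSign, sum_update_eq, add_sub_cancel_left, negOnePow_add_two, oddSign]

/-- A shift by `2 * l` raises one cell index by two, which changes neither orientation nor sign;
periodicity holds at every point, grid included. -/
lemma isPeriodic_foldCharge_odd (hl : 0 < l) (u : Euc n → ℝ) :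
    IsPeriodic ((2 : ℕ) * l) (foldCharge Int.negOnePow oddSign 2 l u) := by
  intro y i
  unfold foldCharge
  rw [idx_add_single hl, oddSign_update_add_two]
  congr 2
  rw [IsometryEquiv.symm_apply_eq, cellMap_update_add_two, IsometryEquiv.apply_symm_apply]

lemma sgnH_update_add_two (c : Fin n → ℤ) (i : Fin n) :
    sgnH Int.negOnePow (Function.update c i (c i + 2)) = sgnH Int.negOnePow c := by
  funext j
  refine Fin.lastCases ?_ (fun j => ?_) j
  · simp [sgnH]
  · simp only [sgnH, Fin.snoc_castSucc]
    by_cases hj : j = i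
    · subst hj; rw [Function.update_self, negOnePow_add_two]
    · rw [Function.update_of_ne hj]

lemma isHorPeriodic_foldField_odd (hl : 0 < l) (b : Euc (n + 1) → Euc (n + 1)) :
    IsHorPeriodic ((2 : ℕ) * l) (foldField Int.negOnePow oddSign 2 l b) := by
  intro x i
  have h1 : hor (x + EuclideanSpace.single i.castSucc ((2 : ℕ) * l))
      = hor x + EuclideanSpace.single i ((2 : ℕ) * l) := by
    ext j
    simp [hor_apply]
  unfold foldField
  rw [h1, idx_add_single hl, oddSign_update_add_two, sgnH_update_add_two]
  congr 3
  rw [IsometryEquiv.symm_apply_eq, cellMapH_update_add_two, IsometryEquiv.apply_symm_apply]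

/-- If the values of `ζ` at the two points over a face coincide, they cancel under odd
reflection. -/
lemma unfoldTest_odd_eq_zero {ζ : Euc (n + 1) → ℝ} (i : Fin n) (x : Euc (n + 1))
    (hζ : ∀ c ∈ cells n 2, ζ (cellMapH Int.negOnePow 2 l (Function.update c i (1 - c i)) x)
      = ζ (cellMapH Int.negOnePow 2 l c x)) :
    unfoldTest Int.negOnePow oddSign 2 l ζ x = 0 := by
  have hc01 : ∀ c ∈ cells n 2, c i = 0 ∨ c i = 1 := fun c hc => by
    have := Finset.mem_Ico.1 (Fintype.mem_piFinset.1 hc i)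
    push_cast at this
    omega
  refine Finset.sum_involution (fun c _ => Function.update c i (1 - c i)) ?_ ?_ ?_ ?_
  · intro c hc
    have h1 : oddSign (Function.update c i (1 - c i)) = -oddSign c := by
      rw [oddSign, sum_update_eq, oddSign]
      rcases hc01 c hc with h | h <;> rw [h]
      · exact negOnePow_add_unit _ 1
      · exact negOnePow_add_unit _ (-1)
    rw [hζ c hc, h1]
    push_cast
    ring
  · intro c _ _ he
    have := congrFun he i
    rw [Function.update_self] at this
    omega
  · intro c hc
    refine Fintype.mem_piFinset.2 fun j => ?_
    by_cases hj : j = i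
    · subst hj
      rw [Function.update_self, Finset.mem_Ico]
      rcases hc01 c hc with h | h <;> rw [h] <;> norm_num
    · rw [Function.update_of_ne hj]; exact Fintype.mem_piFinset.1 hc j
  · intro c _
    simp

/-- The cells 0 and 1 in direction `i` have centres `-l/2` and `l/2` and opposite orientations, so
both send the face `x i = l/2` to the middle hyperplane. -/
lemma cellMapH_swap_eq {c : Fin n → ℤ} (hc : c ∈ cells n 2) {i : Fin n} {x : Euc (n + 1)}
    (hx : x i.castSucc = l / 2) :
    cellMapH Int.negOnePow 2 l (Function.update c i (1 - c i)) x
      = cellMapH Int.negOnePow 2 l c x := by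
  have hc01 : c i = 0 ∨ c i = 1 := by
    have := Finset.mem_Ico.1 (Fintype.mem_piFinset.1 hc i)
    push_cast at this
    omega
  ext j
  refine Fin.lastCases ?_ (fun j => ?_) j
  · rw [cellMapH_last, cellMapH_last]
  rw [cellMapH_castSucc, cellMapH_castSucc]
  by_cases hj : j = i
  · subst hj
    rw [Function.update_self, hx]
    rcases hc01 with h | h <;> simp [h, ctr] <;> ring
  · rw [Function.update_of_ne hj]

/-- The two points over the face `x i = -l/2` differ by a period. -/
lemma periodic_cellMapH_swap_eq {ζ : Euc (n + 1) → ℝ} (hζ : IsHorPeriodic ((2 : ℕ) * l) ζ)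
    {c : Fin n → ℤ} (hc : c ∈ cells n 2) {i : Fin n} {x : Euc (n + 1)}
    (hx : x i.castSucc = -(l / 2)) :
    ζ (cellMapH Int.negOnePow 2 l (Function.update c i (1 - c i)) x)
      = ζ (cellMapH Int.negOnePow 2 l c x) := by
  have hc01 : c i = 0 ∨ c i = 1 := by
    have := Finset.mem_Ico.1 (Fintype.mem_piFinset.1 hc i)
    push_cast at this
    omega
  rcases hc01 with h | h
  · rw [← hζ (cellMapH Int.negOnePow 2 l c x) i]
    congr 1
    ext j
    rw [PiLp.add_apply]
    refine Fin.lastCases ?_ (fun j => ?_) j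
    · rw [cellMapH_last, cellMapH_last]; simp
    rw [cellMapH_castSucc, cellMapH_castSucc]
    by_cases hj : j = i
    · subst hj
      rw [Function.update_self, hx]
      simp [h, ctr]; ring
    · rw [Function.update_of_ne hj]; simp [hj]
  · rw [← hζ (cellMapH Int.negOnePow 2 l (Function.update c i (1 - c i)) x) i]
    congr 1
    ext j
    rw [PiLp.add_apply]
    refine Fin.lastCases ?_ (fun j => ?_) j
    · rw [cellMapH_last, cellMapH_last]; simp
    rw [cellMapH_castSucc, cellMapH_castSucc]
    by_cases hj : j = i
    · subst hj
      rw [Function.update_self, hx]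
      simp [h, ctr]; ring
    · rw [Function.update_of_ne hj]; simp [hj]

lemma tsupport_unfoldTest_subset {σ : ℤ → ℤˣ} {w : (Fin n → ℤ) → ℤˣ} {k : ℕ}
    {ζ : Euc (n + 1) → ℝ} (hζ : tsupport ζ ⊆ {x | x (Fin.last n) < h}) :
    tsupport (unfoldTest σ w k l ζ) ⊆ {x | x (Fin.last n) < h} := by
  have h1 : tsupport (unfoldTest σ w k l ζ)
      ⊆ ⋃ c ∈ cells n k, cellMapH σ k l c ⁻¹' tsupport ζ := by
    refine closure_minimal (fun x hx => ?_) ((cells n k).finite_toSet.isClosed_biUnion fun c _ =>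
      (isClosed_tsupport ζ).preimage (cellMapH σ k l c).continuous)
    obtain ⟨c, hc, hcx⟩ := Finset.exists_ne_zero_of_sum_ne_zero hx
    exact mem_biUnion (Finset.mem_coe.2 hc) (subset_tsupport ζ (right_ne_zero_of_mul hcx))
  refine h1.trans (iUnion₂_subset fun c _ x hx => ?_)
  have := hζ hx
  rwa [mem_ofPred_eq, cellMapH_last] at this

variable (n) in
/-- The odd reflection of an admissible pair in a column is admissible on the torus. -/
lemma exists_sigmaPer_le (hn : 1 ≤ n) :
    ∃ C : ℝ, 0 < C ∧ ∀ L : ℝ, 0 < L →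
      sigmaPer n L ≤ sigma n L + ENNReal.ofReal (C / L) := by
  obtain ⟨C, hC, hvar⟩ := exists_variationPer_foldCharge_odd_le n
  -- With `L = 2 * l` the jumps cost `2 ^ n * C * l ^ (n - 1)`, which divided by `(2 * l) ^ n` is `C
  -- / l = 2 * C / L`.
  refine ⟨2 * C, by positivity, fun L hL => ?_⟩
  obtain ⟨l, hl, rfl⟩ : ∃ l : ℝ, 0 < l ∧ L = (2 : ℕ) * l :=
    ⟨L / 2, by linarith, by push_cast; ring⟩
  simp_rw [sigma, ENNReal.iInf_add]
  refine le_iInf₂ fun p hp => ?_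
  -- The width is halved but the full height is kept, so that the reflected column is again the
  -- whole cube.
  obtain ⟨⟨u, b⟩, hp', hE⟩ := exists_colAdmissible_subdivide 2 hl two_pos le_rfl hp
  have hub := hp'
  obtain ⟨hu, hvu, hb, -⟩ := hp'
  simp only at hu hvu hb
  set U := foldCharge Int.negOnePow oddSign 2 l u
  set B := foldField Int.negOnePow oddSign 2 l b
  have hV : variationPer ((2 : ℕ) * l) U
      ≤ 2 ^ n * (variation (bottom n l) u + ENNReal.ofReal (C * l ^ (n - 1))) := hvar l u hl hu
  have hmem : (U, B) ∈ admissiblePer n ((2 : ℕ) * l) := by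
    refine ⟨isPeriodic_foldCharge_odd hl u, isHorPeriodic_foldField_odd hl b,
      isCharge_foldCharge _ _ 2 hl hu, hV.trans_lt ?_, memLp_foldField _ _ 2 hl hb, ?_⟩
    · exact ENNReal.mul_lt_top (by simp)
        (ENNReal.add_lt_top.2 ⟨hvu, ENNReal.ofReal_lt_top⟩)
    · intro ζ hζ hper hζs
      -- The unfolded test function vanishes on all lateral faces, so nothing needs to be known
      -- about the flux of `b` there. On the inner faces it cancels identically, on the outer ones
      -- by periodicity of `ζ`.
      have key := testedOn_of_vanish hub (contDiff_unfoldTest (l := l) Int.negOnePow oddSign 2 hζ)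
        (fun i x hx => ?_) (tsupport_unfoldTest_subset hζs)
      · unfold TestedOn at key
        unfold TestedBy
        rw [setIntegral_foldCharge _ _ 2 hl hu hζ.continuous, ← key]
        exact setIntegral_foldField _ _ 2 hl (integrableOn_of_memLp_two (isBounded_col n _ _) hb)
          (hζ.of_le (by exact_mod_cast le_top))
      · refine unfoldTest_odd_eq_zero i x fun c hc => ?_
        rcases (abs_eq (by linarith)).1 hx with h | h
        · rw [cellMapH_swap_eq hc h]
        · exact periodic_cellMapH_swap_eq hper hc h
  refine iInf₂_le_of_le (U, B) hmem ?_
  have hF : fieldEnergy n ((2 : ℕ) * l) B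
      = 2 ^ n * ∫⁻ x in col n l ((2 : ℕ) * l), ENNReal.ofReal (‖b x‖ ^ 2 / 2) :=
    lintegral_foldField Int.negOnePow oddSign 2 hl
  have htot : energyPer n ((2 : ℕ) * l) (U, B)
      ≤ energy n ((2 : ℕ) * l) p + ENNReal.ofReal (2 ^ n * (C * l ^ (n - 1))) := by
    rw [ENNReal.ofReal_mul (by positivity), ENNReal.ofReal_pow (by norm_num), ENNReal.ofReal_ofNat]
    calc energyPer n ((2 : ℕ) * l) (U, B) ≤ 2 ^ n * (variation (bottom n l) u +
          ENNReal.ofReal (C * l ^ (n - 1))) +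
          2 ^ n * ∫⁻ x in col n l ((2 : ℕ) * l), ENNReal.ofReal (‖b x‖ ^ 2 / 2) :=
        add_le_add hV hF.le
      _ = 2 ^ n * colEnergy n l ((2 : ℕ) * l) (u, b)
          + 2 ^ n * ENNReal.ofReal (C * l ^ (n - 1)) := by
        unfold colEnergy; ring
      _ ≤ _ := by
        gcongr
        exact_mod_cast hE
  calc energyPer n ((2 : ℕ) * l) (U, B) / ENNReal.ofReal (((2 : ℕ) * l) ^ n)
      ≤ (energy n ((2 : ℕ) * l) p + ENNReal.ofReal (2 ^ n * (C * l ^ (n - 1))))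
        / ENNReal.ofReal (((2 : ℕ) * l) ^ n) := by gcongr
    _ = _ := by
      rw [ENNReal.add_div, ← ENNReal.ofReal_div_of_pos (by positivity)]
      congr 2
      -- Natural subtraction: `l ^ (n - 1) * l = l ^ n` requires `n ≥ 1`.
      obtain ⟨m, rfl⟩ : ∃ m, n = m + 1 := ⟨n - 1, by omega⟩
      rw [Nat.add_sub_cancel]
      push_cast
      field_simp
      ring

end OddReflection

/-! ### The divergence theorem on boxes and the upper bound. -/

lemma setIntegral_openBox {m : ℕ} (lo up : Fin m → ℝ) (g : Euc m → ℝ) :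
    ∫ x in {x : Euc m | ∀ i, lo i < x i ∧ x i < up i}, g x
      = ∫ z in Icc lo up, g (WithLp.toLp 2 z) := by
  have hae : (univ.pi fun i => Ioo (lo i) (up i)) =ᵐ[(volume : Measure (Fin m → ℝ))] Icc lo up :=
    Measure.univ_pi_Ioo_ae_eq_Icc
  rw [← setIntegral_congr_set hae]
  have h := (EuclideanSpace.volume_preserving_symm_measurableEquiv_toLp (Fin m)).symm
  rw [← h.setIntegral_preimage_emb (MeasurableEquiv.measurableEmbedding _)]
  congr 2
  ext z
  simp

/-- The divergence theorem on an open box. -/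
lemma setIntegral_divergence_openBox {m : ℕ} {lo up : Fin (m + 1) → ℝ} (hle : lo ≤ up)
    {F : Euc (m + 1) → Euc (m + 1)} (hF : ContDiff ℝ 1 F) :
    ∫ x in {x : Euc (m + 1) | ∀ i, lo i < x i ∧ x i < up i}, divergence F x
      = ∑ i : Fin (m + 1),
        ((∫ z in Icc (lo ∘ i.succAbove) (up ∘ i.succAbove),
            F (WithLp.toLp 2 (i.insertNth (up i) z)) i) -
          ∫ z in Icc (lo ∘ i.succAbove) (up ∘ i.succAbove),
            F (WithLp.toLp 2 (i.insertNth (lo i) z)) i) := by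
  rw [setIntegral_openBox]
  set e : Euc (m + 1) ≃L[ℝ] (Fin (m + 1) → ℝ) := PiLp.continuousLinearEquiv 2 ℝ _ with he
  have hd : ∀ z : Fin (m + 1) → ℝ, HasFDerivAt (fun z => e (F (e.symm z)))
      ((e : Euc (m + 1) →L[ℝ] (Fin (m + 1) → ℝ)).comp ((fderiv ℝ F (e.symm z)).comp
        (e.symm : (Fin (m + 1) → ℝ) →L[ℝ] Euc (m + 1)))) z := fun z =>
    e.hasFDerivAt.comp z (((hF.differentiable one_ne_zero _).hasFDerivAt).comp z
      e.symm.hasFDerivAt)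
  have hdiv : ∀ z : Fin (m + 1) → ℝ, divergence F (WithLp.toLp 2 z)
      = ∑ i, (((e : Euc (m + 1) →L[ℝ] (Fin (m + 1) → ℝ)).comp ((fderiv ℝ F (e.symm z)).comp
        (e.symm : (Fin (m + 1) → ℝ) →L[ℝ] Euc (m + 1)))) (Pi.single i 1)) i := fun z => rfl
  simp_rw [hdiv]
  refine integral_divergence_of_hasFDerivAt_off_countable lo up hle (fun z => e (F (e.symm z))) _ ∅
    countable_empty (fun z _ => (hd z).continuousAt.continuousWithinAt) (fun z _ => hd z) ?_
  refine ContinuousOn.integrableOn_Icc (Continuous.continuousOn ?_)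
  simp_rw [← hdiv]
  exact (continuous_divergence hF).comp (PiLp.continuous_toLp 2 _)

lemma bottom_eq_box (n : ℕ) (l : ℝ) :
    bottom n l = {x : Euc n | ∀ i, (fun _ : Fin n => -(l / 2)) i < x i
      ∧ x i < (fun _ : Fin n => l / 2) i} := by
  ext x
  simp [bottom, abs_lt]

lemma col_eq_box (n : ℕ) (l h : ℝ) :
    col n l h = {x : Euc (n + 1) | ∀ i,
      Fin.snoc (α := fun _ => ℝ) (fun _ : Fin n => -(l / 2)) 0 i < x i
      ∧ x i < Fin.snoc (α := fun _ => ℝ) (fun _ : Fin n => l / 2) h i} := by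
  ext x
  constructor
  · intro hx i
    refine Fin.lastCases ?_ (fun i => ?_) i
    · simpa using hx.2
    · simpa using abs_lt.1 (hx.1 i)
  · intro hx
    refine ⟨fun i => abs_lt.2 ?_, ?_⟩
    · simpa using hx i.castSucc
    · simpa using hx (Fin.last n)

lemma variation_one {n : ℕ} (hn : 1 ≤ n) {l : ℝ} (hl : 0 ≤ l) :
    variation (bottom n l) (fun _ => 1) = 0 := by
  obtain ⟨m, rfl⟩ : ∃ m, n = m + 1 := ⟨n - 1, by omega⟩
  rw [← nonpos_iff_eq_zero]
  refine iSup₂_le fun φ ⟨h1, _, h3, _⟩ => ?_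
  have h0 : ∀ y, y ∉ bottom (m + 1) l → φ y = 0 := fun y hy =>
    image_eq_zero_of_notMem_tsupport fun h => hy (h3 h)
  simp only [one_mul]
  rw [bottom_eq_box, setIntegral_divergence_openBox (fun _ => by linarith) h1, Finset.sum_eq_zero,
    ENNReal.ofReal_zero]
  intro i _
  have hz : ∀ (t : ℝ) (z : Fin m → ℝ), |t| = l / 2 →
      φ (WithLp.toLp 2 (i.insertNth (α := fun _ => ℝ) t z)) i = 0 := by
    intro t z ht
    rw [h0 _ fun h => ?_, PiLp.zero_apply]
    have := h i
    simp only [Fin.insertNth_apply_same] at this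
    linarith
  simp_rw [hz (l / 2) _ (abs_of_nonneg (by linarith)),
    hz (-(l / 2)) _ (by rw [abs_neg, abs_of_nonneg (by linarith)])]
  simp

lemma divergence_add {m : ℕ} {φ ψ : Euc m → Euc m} {y : Euc m} (hφ : DifferentiableAt ℝ φ y)
    (hψ : DifferentiableAt ℝ ψ y) :
    divergence (fun y => φ y + ψ y) y = divergence φ y + divergence ψ y := by
  unfold divergence
  rw [← Finset.sum_add_distrib]
  refine Finset.sum_congr rfl fun i _ => ?_
  rw [fderiv_fun_add hφ hψ]
  simp

lemma divergence_smul_const {m : ℕ} {η : Euc m → ℝ} {y v : Euc m} (hη : DifferentiableAt ℝ η y) :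
    divergence (fun y => η y • v) y = fderiv ℝ η y v := by
  rw [divergence_mul hη (differentiableAt_const v)]
  simp [divergence]

section TurningField

variable {n : ℕ} (i₀ : Fin n) (l h : ℝ)

/-- A divergence-free field that enters through the bottom of the column and leaves it through the
face `x i₀ = l/2`. -/
def turningField (x : Euc (n + 1)) : Euc (n + 1) :=
  ((x i₀.castSucc + l / 2) / h) • EuclideanSpace.single i₀.castSucc 1
    + (1 - x (Fin.last n) / h) • EuclideanSpace.single (Fin.last n) 1

lemma contDiff_turningField {r : WithTop ℕ∞} : ContDiff ℝ r (turningField i₀ l h) := by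
  unfold turningField
  fun_prop

lemma turningField_castSucc (x : Euc (n + 1)) :
    turningField i₀ l h x i₀.castSucc = (x i₀.castSucc + l / 2) / h := by
  simp [turningField]

lemma turningField_last (x : Euc (n + 1)) :
    turningField i₀ l h x (Fin.last n) = 1 - x (Fin.last n) / h := by
  simp [turningField]

lemma turningField_of_ne (x : Euc (n + 1)) {i : Fin (n + 1)} (h1 : i ≠ i₀.castSucc)
    (h2 : i ≠ Fin.last n) : turningField i₀ l h x i = 0 := by
  simp [turningField, h1, h2]

lemma divergence_turningField (x : Euc (n + 1)) : divergence (turningField i₀ l h) x = 0 := by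
  unfold turningField
  have p : ∀ i : Fin (n + 1), HasFDerivAt (fun x : Euc (n + 1) => x i)
      (EuclideanSpace.proj i : Euc (n + 1) →L[ℝ] ℝ) x := fun i =>
    (EuclideanSpace.proj i : Euc (n + 1) →L[ℝ] ℝ).hasFDerivAt
  have h1 : HasFDerivAt (fun x : Euc (n + 1) => (x i₀.castSucc + l / 2) / h)
      (h⁻¹ • (EuclideanSpace.proj i₀.castSucc : Euc (n + 1) →L[ℝ] ℝ)) x := by
    simpa [div_eq_inv_mul] using ((p i₀.castSucc).add_const (l / 2)).const_mul h⁻¹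
  have h2 : HasFDerivAt (fun x : Euc (n + 1) => 1 - x (Fin.last n) / h)
      (-(h⁻¹ • (EuclideanSpace.proj (Fin.last n) : Euc (n + 1) →L[ℝ] ℝ))) x := by
    simpa [div_eq_inv_mul] using ((p (Fin.last n)).const_mul h⁻¹).const_sub 1
  rw [divergence_add (h1.differentiableAt.smul_const _) (h2.differentiableAt.smul_const _),
    divergence_smul_const h1.differentiableAt, divergence_smul_const h2.differentiableAt,
    h1.fderiv, h2.fderiv]
  simp

variable {l h}

/-- By the divergence theorem only normal traces count. The field is tangential on the top, on `x i₀
= -l/2` and on the faces in the other directions; on `x i₀ = l/2` the test function vanishes, and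
the bottom gives the right side. -/
lemma setIntegral_turningField (hl : 0 < l) (hh : 0 < h) {Z : Euc (n + 1) → ℝ}
    (hZ : ContDiff ℝ 1 Z) (hZ0 : ∀ x : Euc (n + 1), x i₀.castSucc = l / 2 → Z x = 0) :
    ∫ x in col n l h, fderiv ℝ Z x (turningField i₀ l h x)
      = - ∫ y in bottom n l, Z (incl y) := by
  have hP : ContDiff ℝ 1 (turningField i₀ l h) := contDiff_turningField i₀ l h
  have h1 : ∀ x, fderiv ℝ Z x (turningField i₀ l h x)
      = divergence (fun x => Z x • turningField i₀ l h x) x := fun x => by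
    rw [divergence_mul (hZ.differentiable one_ne_zero x) (hP.differentiable one_ne_zero x),
      divergence_turningField, mul_zero, zero_add]
  simp_rw [h1]
  rw [col_eq_box, setIntegral_divergence_openBox _
    (F := fun x => Z x • turningField i₀ l h x) (hZ.smul hP)]
  · rw [Fin.sum_univ_castSucc, Finset.sum_eq_zero, zero_add]
    · simp only [PiLp.smul_apply, turningField_last, Fin.insertNth_apply_same, smul_eq_mul,
        Fin.snoc_last, div_self hh.ne', sub_self, mul_zero, integral_zero, zero_sub, zero_div,
        sub_zero, mul_one]
      rw [bottom_eq_box, setIntegral_openBox]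
      congr 1
      have e1 : Fin.snoc (α := fun _ => ℝ) (fun _ : Fin n => -(l / 2)) 0 ∘ (Fin.last n).succAbove
          = fun _ => -(l / 2) := by
        funext i; simp
      have e2 : Fin.snoc (α := fun _ => ℝ) (fun _ : Fin n => l / 2) h ∘ (Fin.last n).succAbove
          = fun _ => l / 2 := by
        funext i; simp
      rw [e1, e2]
      refine integral_congr_ae (ae_of_all _ fun z => ?_)
      simp only [incl, Fin.insertNth_last']
    · intro i _
      simp only [PiLp.smul_apply, smul_eq_mul]
      by_cases hi : i = i₀
      · subst hi
        simp only [turningField_castSucc, Fin.insertNth_apply_same, Fin.snoc_castSucc]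
        have h2 : ∀ z : Fin n → ℝ,
            Z (WithLp.toLp 2 (i.castSucc.insertNth (α := fun _ => ℝ) (l / 2) z)) = 0 := fun z =>
          hZ0 _ (by simp)
        simp [h2]
      · have h3 : ∀ x, turningField i₀ l h x i.castSucc = 0 := fun x =>
          turningField_of_ne i₀ l h x (fun h => hi (Fin.castSucc_injective n h))
            (Fin.castSucc_lt_last i).ne
        simp [h3]
  · intro i
    refine Fin.lastCases ?_ (fun i => ?_) i
    · simpa using hh.le
    · simp only [Fin.snoc_castSucc]; linarith

lemma norm_turningField_le (hl : 0 < l) (hh : l ≤ h) {x : Euc (n + 1)} (hx : x ∈ col n l h) :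
    ‖turningField i₀ l h x‖ ≤ 2 := by
  have hh0 : 0 < h := hl.trans_le hh
  unfold turningField
  refine (norm_add_le _ _).trans ?_
  rw [norm_smul, norm_smul, PiLp.norm_single, PiLp.norm_single, norm_one,
    mul_one, mul_one, Real.norm_eq_abs, Real.norm_eq_abs, abs_div, abs_of_pos hh0]
  have h1 := abs_lt.1 (hx.1 i₀)
  have h2 : |x i₀.castSucc + l / 2| / h ≤ 1 := by
    rw [div_le_one hh0, abs_le]
    constructor <;> linarith
  have h3 : |1 - x (Fin.last n) / h| ≤ 1 := by
    have h4 : 0 ≤ x (Fin.last n) / h := div_nonneg hx.2.1.le hh0.le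
    have h5 : x (Fin.last n) / h ≤ 1 := (div_le_one hh0).2 hx.2.2.le
    rw [abs_le]
    constructor <;> linarith
  linarith

end TurningField

lemma volume_col {n : ℕ} {l h : ℝ} (hl : 0 ≤ l) :
    volume (col n l h) = ENNReal.ofReal (l ^ n) * ENNReal.ofReal h := by
  have h' := (EuclideanSpace.volume_preserving_symm_measurableEquiv_toLp (Fin (n + 1)))
  have : col n l h = (MeasurableEquiv.toLp 2 (Fin (n + 1) → ℝ)).symm ⁻¹'
      (univ.pi fun i => Ioo (Fin.snoc (α := fun _ => ℝ) (fun _ : Fin n => -(l / 2)) 0 i)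
        (Fin.snoc (α := fun _ => ℝ) (fun _ : Fin n => l / 2) h i)) := by
    rw [col_eq_box]
    ext x
    simp
  rw [this, h'.measure_preimage
    (MeasurableSet.univ_pi fun _ => measurableSet_Ioo).nullMeasurableSet,
    Real.volume_pi_Ioo, Fin.prod_univ_castSucc, ENNReal.ofReal_pow hl]
  simp

lemma ofReal_two_pow_mul (n : ℕ) (t : ℝ) :
    ENNReal.ofReal (2 ^ n * t) = 2 ^ n * ENNReal.ofReal t := by
  rw [ENNReal.ofReal_mul (by positivity), ENNReal.ofReal_pow (by norm_num), ENNReal.ofReal_ofNat]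

variable (n : ℕ) in
-- The reflected turning field passes its flux between oppositely charged cells through the middle
-- hyperplane and is tangential on the outer lateral faces and the top.
lemma exists_sigmaZero_le (hn : 1 ≤ n) :
    ∃ C : ℝ, 0 < C ∧ ∀ L : ℝ, 1 ≤ L → sigmaZero n L ≤ ENNReal.ofReal C := by
  obtain ⟨C, hC, hvar⟩ := exists_variationPer_foldCharge_odd_le n
  -- Cubes of side `2 * l` between 1 and 2. The constant adds the jumps, `2 ^ n * C`, to the field
  -- energy: density at most 2 times volume at most 2 in each of `2 ^ n` columns.
  have key : ∀ l : ℝ, 1 / 2 ≤ l → l ≤ 1 →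
      sigmaZero n ((2 : ℕ) * l) ≤ ENNReal.ofReal (2 ^ n * C + 2 ^ n * 4) := by
    intro l hl1 hl2
    have hl : 0 < l := by linarith
    set h : ℝ := (2 : ℕ) * l with hh
    have hlh : l ≤ h := by rw [hh]; push_cast; linarith
    have hh0 : 0 < h := hl.trans_le hlh
    set i₀ : Fin n := ⟨0, hn⟩
    set P := turningField i₀ l h
    have hone : IsCharge n l (fun _ => 1) :=
      ⟨aestronglyMeasurable_const, ae_of_all _ fun _ => Or.inl rfl⟩
    have hPc : Continuous P := (contDiff_turningField i₀ l h (r := 0)).continuous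
    have hcol := volume_lt_top_of_isBounded (isBounded_col n l h)
    have hPm : MemLp P 2 (volume.restrict (col n l h)) := by
      have : IsFiniteMeasure (volume.restrict (col n l h)) := isFiniteMeasure_restrict.2 hcol.ne
      refine MemLp.of_bound hPc.aestronglyMeasurable 2 ?_
      filter_upwards [ae_restrict_mem (isOpen_col n l h).measurableSet] with x hx
      exact norm_turningField_le i₀ hl hlh hx
    set U := foldCharge Int.negOnePow oddSign 2 l (fun _ : Euc n => 1)
    set B := foldField Int.negOnePow oddSign 2 l P
    have hV : variation (bottom n h) U ≤ ENNReal.ofReal (2 ^ n * C) := by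
      refine (variation_le_variationPer hh0 U).trans ((hvar l _ hl hone).trans ?_)
      rw [variation_one hn hl.le, zero_add, ofReal_two_pow_mul]
      gcongr
      exact mul_le_of_le_one_right hC.le (pow_le_one₀ hl.le hl2)
    have htest : ∀ ζ : Euc (n + 1) → ℝ, ContDiff ℝ ∞ ζ → HasCompactSupport ζ →
        TestedBy h U B ζ := by
      intro ζ hζ _
      have hζ1 : ContDiff ℝ 1 ζ := hζ.of_le (by exact_mod_cast le_top)
      unfold TestedBy
      rw [hh, setIntegral_foldCharge _ _ 2 hl hone hζ.continuous]
      refine (setIntegral_foldField _ _ 2 hl (integrableOn_of_memLp_two (isBounded_col n _ _) hPm)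
        hζ1).trans ?_
      rw [setIntegral_turningField i₀ hl hh0 (contDiff_unfoldTest _ _ 2 hζ1)]
      · simp
      · intro x hx
        exact unfoldTest_odd_eq_zero i₀ x fun c hc => by rw [cellMapH_swap_eq hc hx]
    refine iInf₂_le_of_le (U, B) ⟨⟨isCharge_foldCharge Int.negOnePow oddSign 2 hl hone,
      hV.trans_lt ENNReal.ofReal_lt_top, memLp_foldField Int.negOnePow oddSign 2 hl hPm,
      fun ζ h1 h2 _ => htest ζ h1 h2⟩, htest⟩ ?_
    have hF : fieldEnergy n h B ≤ ENNReal.ofReal (2 ^ n * 4) := by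
      have h1 : fieldEnergy n h B
          = 2 ^ n * ∫⁻ x in col n l h, ENNReal.ofReal (‖P x‖ ^ 2 / 2) :=
        lintegral_foldField Int.negOnePow oddSign 2 hl
      rw [h1, ofReal_two_pow_mul]
      gcongr
      calc ∫⁻ x in col n l h, ENNReal.ofReal (‖P x‖ ^ 2 / 2)
          ≤ ∫⁻ _ in col n l h, ENNReal.ofReal 2 := by
            refine setLIntegral_mono measurable_const fun x hx => ENNReal.ofReal_le_ofReal ?_
            have := norm_turningField_le i₀ hl hlh hx
            have h0 := norm_nonneg (P x)
            nlinarith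
        _ = ENNReal.ofReal (2 * (l ^ n * h)) := by
            rw [setLIntegral_const, volume_col hl.le, ← ENNReal.ofReal_mul (by positivity),
              ← ENNReal.ofReal_mul (by norm_num)]
        _ ≤ ENNReal.ofReal 4 := by
            refine ENNReal.ofReal_le_ofReal ?_
            have h2 : l ^ n ≤ 1 := pow_le_one₀ hl.le hl2
            have h3 : h ≤ 2 := by rw [hh]; push_cast; linarith
            nlinarith [mul_le_mul h2 h3 hh0.le zero_le_one]
        _ = _ := by norm_num
    have h1 : (1 : ℝ≥0∞) ≤ ENNReal.ofReal (h ^ n) := by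
      rw [← ENNReal.ofReal_one]
      refine ENNReal.ofReal_le_ofReal (one_le_pow₀ ?_)
      rw [hh]; push_cast; linarith
    calc energy n h (U, B) / ENNReal.ofReal (h ^ n) ≤ energy n h (U, B) / 1 := by gcongr
      _ = energy n h (U, B) := div_one _
      _ ≤ ENNReal.ofReal (2 ^ n * C) + ENNReal.ofReal (2 ^ n * 4) := add_le_add hV hF
      _ = _ := (ENNReal.ofReal_add (by positivity) (by positivity)).symm
  refine ⟨2 ^ n * C + 2 ^ n * 4, by positivity, fun L hL => ?_⟩
  have hk : 0 < ⌊L⌋₊ := Nat.floor_pos.2 hL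
  have hk' : (0 : ℝ) < ⌊L⌋₊ := by exact_mod_cast hk
  have h1 : (⌊L⌋₊ : ℝ) ≤ L := Nat.floor_le (by linarith)
  have h2 : L < ⌊L⌋₊ + 1 := Nat.lt_floor_add_one L
  have h3 : (1 : ℝ) ≤ ⌊L⌋₊ := by exact_mod_cast hk
  -- For `L ≥ 1` the quotient `L / ⌊L⌋₊` lies between 1 and 2, so `L` is an integer multiple of an
  -- already treated side.
  have h4 : L = ⌊L⌋₊ * ((2 : ℕ) * (L / (2 * ⌊L⌋₊))) := by
    push_cast
    field_simp
  rw [h4]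
  refine (sigmaZero_mul_le (by positivity) hk).trans (key _ ?_ ?_)
  · rw [le_div_iff₀ (by positivity)]; linarith
  · rw [div_le_iff₀ (by positivity)]; linarith

/-! ### Averages along segments. -/

section Segments

variable {m : ℕ} {g : Euc m → ℝ}

/-- The average of `g` over the segment from `y - v` to `y`. -/
def segAverage (g : Euc m → ℝ) (v y : Euc m) : ℝ := ∫ t in (0 : ℝ)..1, g (y - t • v)

lemma hasFDerivAt_segAverage (hg : ContDiff ℝ 1 g) (hgc : HasCompactSupport g) (v y : Euc m) :
    HasFDerivAt (segAverage g v) (∫ t in (0 : ℝ)..1, fderiv ℝ g (y - t • v)) y := by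
  have hcd := hg.continuous_fderiv one_ne_zero
  obtain ⟨M, hM⟩ := (hgc.fderiv ℝ).exists_bound_of_continuous hcd
  have hsub : ∀ y : Euc m, Continuous fun t : ℝ => y - t • v := fun y => by fun_prop
  refine (intervalIntegral.hasFDerivAt_integral_of_dominated_of_fderiv_le
    (F := fun y t => g (y - t • v)) (F' := fun y t => fderiv ℝ g (y - t • v))
    (bound := fun _ => M) univ_mem ?_ ?_ ?_ ?_ ?_ ?_)
  · exact Eventually.of_forall fun y => (hg.continuous.comp (hsub y)).aestronglyMeasurable
  · exact (hg.continuous.comp (hsub y)).intervalIntegrable _ _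
  · exact (hcd.comp (hsub y)).aestronglyMeasurable
  · exact ae_of_all _ fun t _ x _ => hM _
  · exact intervalIntegrable_const
  · refine ae_of_all _ fun t _ x _ => ?_
    exact ((hg.differentiable one_ne_zero _).hasFDerivAt.comp x
      ((hasFDerivAt_id x).sub_const (t • v)))

lemma contDiff_segAverage (hg : ContDiff ℝ 1 g) (hgc : HasCompactSupport g) (v : Euc m) :
    ContDiff ℝ 1 (segAverage g v) := by
  rw [contDiff_one_iff_hasFDerivAt]
  refine ⟨_, ?_, fun y => hasFDerivAt_segAverage hg hgc v y⟩
  refine intervalIntegral.continuous_parametric_intervalIntegral_of_continuous' ?_ 0 1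
  exact (hg.continuous_fderiv one_ne_zero).comp
    (show Continuous fun p : Euc m × ℝ => p.1 - p.2 • v by fun_prop)

/-- By the fundamental theorem of calculus `g - g(· - v)` is the divergence of the average of `g`
times `v`, a field of norm at most `‖v‖` when `|g| ≤ 1`. -/
lemma fderiv_segAverage_apply (hg : ContDiff ℝ 1 g) (hgc : HasCompactSupport g) (v y : Euc m) :
    fderiv ℝ (segAverage g v) y v = g y - g (y - v) := by
  have hcd := hg.continuous_fderiv one_ne_zero
  have hsub : Continuous fun t : ℝ => y - t • v := by fun_prop
  have hi : IntervalIntegrable (fun t : ℝ => fderiv ℝ g (y - t • v)) volume 0 1 :=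
    (hcd.comp hsub).intervalIntegrable _ _
  rw [(hasFDerivAt_segAverage hg hgc v y).fderiv, ContinuousLinearMap.intervalIntegral_apply hi]
  have hder : ∀ t : ℝ, HasDerivAt (fun t : ℝ => -g (y - t • v)) (fderiv ℝ g (y - t • v) v) t := by
    intro t
    have h1 : HasDerivAt (fun t : ℝ => y - t • v) (-v) t := by
      simpa using ((hasDerivAt_id t).smul_const v).const_sub y
    have h2 := ((hg.differentiable one_ne_zero _).hasFDerivAt.comp_hasDerivAt t h1).neg
    have h3 : fderiv ℝ g (y - t • v) v = -(fderiv ℝ g (y - t • v) (-v)) := by rw [map_neg, neg_neg]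
    rw [h3]
    exact h2
  rw [intervalIntegral.integral_eq_sub_of_hasDerivAt (fun t _ => hder t)
    (((hcd.comp hsub).clm_apply continuous_const).intervalIntegrable _ _)]
  simp only [one_smul, zero_smul, sub_zero]
  ring

lemma abs_segAverage_le (hg1 : ∀ y, |g y| ≤ 1) (v y : Euc m) : |segAverage g v y| ≤ 1 := by
  have := intervalIntegral.norm_integral_le_of_norm_le_const (a := (0 : ℝ)) (b := 1)
    (f := fun t : ℝ => g (y - t • v)) (C := 1) fun t _ => hg1 _
  simpa [segAverage] using this

lemma segAverage_eq_zero {R r : ℝ} (hgR : ∀ y, R < ‖y‖ → g y = 0) {v y : Euc m} (hv : ‖v‖ ≤ r)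
    (hy : R + r < ‖y‖) : segAverage g v y = 0 := by
  unfold segAverage
  rw [intervalIntegral.integral_congr (g := fun _ => 0), intervalIntegral.integral_zero]
  intro t ht
  rw [uIcc_of_le zero_le_one] at ht
  refine hgR _ ?_
  have h1 : ‖t • v‖ ≤ r := by
    rw [norm_smul, Real.norm_of_nonneg ht.1]
    exact (mul_le_of_le_one_left (norm_nonneg v) ht.2).trans hv
  have h2 := norm_sub_norm_le y (t • v)
  linarith

end Segments

/-! ### Translation and mollification estimates for BV charges. -/

section LowerBound

variable {n : ℕ} {l : ℝ} {u : Euc n → ℝ}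

lemma mem_bottom_of_norm_lt {y : Euc n} (hy : ‖y‖ < l / 2) : y ∈ bottom n l := fun i =>
  (abs_coord_le_norm y i).trans_lt hy

lemma hasCompactSupport_of_norm {m : ℕ} {F : Type*} [Zero F] {f : Euc m → F} {R : ℝ}
    (hf : ∀ y, R < ‖y‖ → f y = 0) : HasCompactSupport f :=
  HasCompactSupport.intro (isCompact_closedBall 0 R) fun y hy => hf y (by
    rw [mem_closedBall_zero_iff, not_le] at hy
    exact hy)

lemma tsupport_subset_of_norm {m : ℕ} {F : Type*} [Zero F] {f : Euc m → F} {R : ℝ}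
    (hf : ∀ y, R < ‖y‖ → f y = 0) : tsupport f ⊆ {y | ‖y‖ ≤ R} := by
  refine closure_minimal (fun y hy => ?_) (isClosed_le continuous_norm continuous_const)
  by_contra h
  exact hy (hf y (not_le.1 h))

/-- The BV translation estimate in dual form: the test function is moved instead of `u`, and the
room `R + r < l / 2` keeps the test field inside the cell. -/
lemma integral_sub_translate_le (hvar : variation (bottom n l) u < ⊤)
    {g : Euc n → ℝ} (hg : ContDiff ℝ 1 g) (hg1 : ∀ y, |g y| ≤ 1) {R r : ℝ} (hr : 0 < r)
    (hRr : R + r < l / 2) (hgR : ∀ y, R < ‖y‖ → g y = 0) {v : Euc n} (hv : ‖v‖ ≤ r) :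
    ∫ y in bottom n l, u y * (g y - g (y - v)) ≤ r * (variation (bottom n l) u).toReal := by
  have hgc := hasCompactSupport_of_norm hgR
  have hC := contDiff_segAverage hg hgc v
  have hφ0 : ∀ y, R + r < ‖y‖ → segAverage g v y • (r⁻¹ • v) = 0 := fun y hy => by
    rw [segAverage_eq_zero hgR hv hy, zero_smul]
  -- Scaling by `r⁻¹` rather than `‖v‖⁻¹` needs no separate treatment of `v = 0`.
  have h1 := le_variation (u := u) (Ω := bottom n l) (φ := fun y => segAverage g v y • (r⁻¹ • v))
    (hC.smul contDiff_const) (hasCompactSupport_of_norm hφ0)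
    ((tsupport_subset_of_norm hφ0).trans fun y hy => mem_bottom_of_norm_lt (lt_of_le_of_lt hy hRr))
    fun y => by
      rw [norm_smul, norm_smul, norm_inv, Real.norm_of_nonneg hr.le]
      refine mul_le_one₀ (abs_segAverage_le hg1 v y) (by positivity) ?_
      rwa [inv_mul_le_iff₀ hr, mul_one]
  have h2 := (ENNReal.ofReal_le_iff_le_toReal hvar.ne).1 h1
  have h3 : ∀ y, u y * (g y - g (y - v))
      = r * (u y * divergence (fun y => segAverage g v y • (r⁻¹ • v)) y) := fun y => by
    rw [divergence_smul_const (hC.differentiable one_ne_zero y), map_smul,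
      fderiv_segAverage_apply hg hgc, smul_eq_mul]
    field_simp
  simp_rw [h3]
  rw [integral_const_mul]
  gcongr

open scoped Convolution

/-- Mollification of `f` with the bump function `ρ`. -/
def mollify {m : ℕ} (ρ : ContDiffBump (0 : Euc m)) (f : Euc m → ℝ) : Euc m → ℝ :=
  ρ.normed volume ⋆[ContinuousLinearMap.lsmul ℝ ℝ, volume] f

section Mollify

variable {m : ℕ} (ρ : ContDiffBump (0 : Euc m)) {f : Euc m → ℝ}

lemma mollify_apply (x : Euc m) : mollify ρ f x = ∫ t, ρ.normed volume t * f (x - t) := rfl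

lemma locallyIntegrable_of_bound (hf : AEStronglyMeasurable f volume) (hf1 : ∀ y, |f y| ≤ 1) :
    LocallyIntegrable f volume := by
  refine (locallyIntegrable_const (1 : ℝ)).mono hf (ae_of_all _ fun y => ?_)
  rw [norm_one]
  exact hf1 y

lemma contDiff_mollify (hf : LocallyIntegrable f volume) : ContDiff ℝ ∞ (mollify ρ f) :=
  ρ.hasCompactSupport_normed.contDiff_convolution_left _ (n := ⊤) ρ.contDiff_normed hf

lemma abs_mollify_le (hf1 : ∀ y, |f y| ≤ 1) (x : Euc m) : |mollify ρ f x| ≤ 1 := by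
  rw [mollify_apply, ← ρ.integral_normed (μ := volume), ← Real.norm_eq_abs]
  refine norm_integral_le_of_norm_le ρ.integrable_normed (ae_of_all _ fun t => ?_)
  rw [norm_mul, Real.norm_of_nonneg (ρ.nonneg_normed t)]
  exact mul_le_of_le_one_right (ρ.nonneg_normed t) (hf1 _)

lemma normed_eq_zero {t : Euc m} (ht : ρ.rOut ≤ ‖t‖) : ρ.normed volume t = 0 := by
  by_contra h
  have := (ρ.support_normed_eq (μ := volume)).subset (Function.mem_support.2 h)
  rw [mem_ball_zero_iff] at this
  linarith

lemma mollify_eq_zero {R : ℝ} (hfR : ∀ y, R < ‖y‖ → f y = 0) {x : Euc m}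
    (hx : R + ρ.rOut < ‖x‖) : mollify ρ f x = 0 := by
  rw [mollify_apply]
  refine integral_eq_zero_of_ae (ae_of_all _ fun t => ?_)
  change ρ.normed volume t * f (x - t) = 0
  by_cases ht : ρ.rOut ≤ ‖t‖
  · rw [normed_eq_zero ρ ht, zero_mul]
  · rw [hfR, mul_zero]
    have := norm_sub_norm_le x t
    linarith

/-- The derivative falls on the kernel, so the bound depends on `ρ` alone; this is what makes the
constants of the lower bound independent of `u`. -/
lemma norm_fderiv_mollify_le (hf : LocallyIntegrable f volume) (hf1 : ∀ y, |f y| ≤ 1)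
    (x : Euc m) : ‖fderiv ℝ (mollify ρ f) x‖ ≤ ∫ t, ‖fderiv ℝ (ρ.normed volume) t‖ := by
  have hC : ContDiff ℝ 1 (ρ.normed (volume : Measure (Euc m))) := ρ.contDiff_normed
  have h := ρ.hasCompactSupport_normed.hasFDerivAt_convolution_left
    (ContinuousLinearMap.lsmul ℝ ℝ) hC hf x
  rw [mollify, h.fderiv]
  refine norm_integral_le_of_norm_le ?_ (ae_of_all _ fun t => ?_)
  · exact ((hC.continuous_fderiv one_ne_zero).integrable_of_hasCompactSupport
      (ρ.hasCompactSupport_normed.fderiv ℝ)).norm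
  · refine ContinuousLinearMap.opNorm_le_bound _ (norm_nonneg _) fun v => ?_
    have h1 : (((ContinuousLinearMap.lsmul ℝ ℝ).precompL (Euc m)
        (fderiv ℝ (ρ.normed volume) t)) (f (x - t))) v
        = (fderiv ℝ (ρ.normed volume) t v) * f (x - t) := rfl
    rw [h1, norm_mul]
    exact (mul_le_of_le_one_right (norm_nonneg _) (hf1 _)).trans
      ((fderiv ℝ (ρ.normed volume) t).le_opNorm v)

end Mollify

/-- The difference is a weighted average of `g - g(· - v)` over `‖v‖ < ρ.rOut`; by Fubini the
translation estimate may be averaged. -/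
lemma integral_sub_mollify_le (hu : IsCharge n l u) (hvar : variation (bottom n l) u < ⊤)
    {g : Euc n → ℝ} (hg : ContDiff ℝ 1 g) (hg1 : ∀ y, |g y| ≤ 1) {R : ℝ}
    (ρ : ContDiffBump (0 : Euc n)) (hRr : R + ρ.rOut < l / 2) (hgR : ∀ y, R < ‖y‖ → g y = 0) :
    ∫ y in bottom n l, u y * (g y - mollify ρ g y)
      ≤ ρ.rOut * (variation (bottom n l) u).toReal := by
  set V := (variation (bottom n l) u).toReal
  have : IsFiniteMeasure (volume.restrict (bottom n l)) :=
    isFiniteMeasure_restrict.2 (volume_lt_top_of_isBounded (isBounded_bottom n l)).ne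
  have hρi : Integrable (ρ.normed (volume : Measure (Euc n))) := ρ.integrable_normed
  have hρc : Continuous (ρ.normed (volume : Measure (Euc n))) :=
    (ρ.contDiff_normed (n := 0)).continuous
  have h1 : ∀ y, u y * (g y - mollify ρ g y)
      = ∫ v, u y * (ρ.normed volume v * (g y - g (y - v))) := by
    intro y
    rw [integral_const_mul, mollify_apply]
    congr 1
    have i1 : Integrable fun v => ρ.normed volume v * g y := hρi.mul_const _
    have i2 : Integrable fun v => ρ.normed volume v * g (y - v) :=
      hρi.mul_bdd (c := 1)
        (hg.continuous.comp (continuous_const.sub continuous_id)).aestronglyMeasurable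
        (ae_of_all _ fun v => hg1 _)
    simp_rw [mul_sub]
    rw [integral_sub i1 i2, integral_mul_const, ρ.integral_normed, one_mul]
  simp_rw [h1]
  rw [integral_integral_swap]
  · have h2 : ∀ v, ∫ y in bottom n l, u y * (ρ.normed volume v * (g y - g (y - v)))
        ≤ ρ.normed volume v * (ρ.rOut * V) := by
      intro v
      have h3 : ∀ y, u y * (ρ.normed volume v * (g y - g (y - v)))
          = ρ.normed volume v * (u y * (g y - g (y - v))) := fun y => by ring
      simp_rw [h3]
      rw [integral_const_mul]
      by_cases hv : ρ.rOut ≤ ‖v‖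
      · rw [normed_eq_zero ρ hv, zero_mul, zero_mul]
      · exact mul_le_mul_of_nonneg_left
          (integral_sub_translate_le hvar hg hg1 ρ.rOut_pos hRr hgR (not_le.1 hv).le)
          (ρ.nonneg_normed v)
    have h4 : ∫ v, ρ.normed volume v * (ρ.rOut * V) = ρ.rOut * V := by
      rw [integral_mul_const, ρ.integral_normed, one_mul]
    rw [← h4]
    -- Integrability in `v` is not needed: otherwise the integral is zero by convention, and the
    -- bound is nonnegative.
    by_cases hint : Integrable fun v =>
        ∫ y in bottom n l, u y * (ρ.normed volume v * (g y - g (y - v)))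
    · exact integral_mono hint (hρi.mul_const _) h2
    · rw [integral_undef hint]
      exact integral_nonneg fun v => mul_nonneg (ρ.nonneg_normed v)
        (mul_nonneg ρ.rOut_pos.le ENNReal.toReal_nonneg)
  · have hb : Integrable (fun z : Euc n × Euc n => (2 : ℝ) * ρ.normed volume z.2)
        ((volume.restrict (bottom n l)).prod volume) :=
      Integrable.mul_prod (integrable_const (2 : ℝ)) hρi
    refine hb.mono' ?_ ?_
    · refine hu.1.comp_fst.mul (Continuous.aestronglyMeasurable ?_)
      have := hg.continuous
      fun_prop
    · have hae : ∀ᵐ z ∂((volume.restrict (bottom n l)).prod (volume : Measure (Euc n))),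
          |u z.1| = 1 := Measure.quasiMeasurePreserving_fst.ae hu.ae_abs_eq
      filter_upwards [hae] with z hz
      simp only [Function.uncurry]
      rw [norm_mul, norm_mul, Real.norm_eq_abs, hz, one_mul,
        Real.norm_of_nonneg (ρ.nonneg_normed _), mul_comm]
      refine mul_le_mul_of_nonneg_right ?_ (ρ.nonneg_normed _)
      calc ‖g z.1 - g (z.1 - z.2)‖ ≤ ‖g z.1‖ + ‖g (z.1 - z.2)‖ := norm_sub_le _ _
        _ ≤ 1 + 1 := add_le_add (hg1 _) (hg1 _)
        _ = 2 := by norm_num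

end LowerBound

/-! ### Field energy against charge, and the lower bound. -/

section LowerBound

variable {n : ℕ} {l : ℝ} {u : Euc n → ℝ} {b : Euc (n + 1) → Euc (n + 1)}

/-- The horizontal projection as a continuous linear map. -/
def horL (n : ℕ) : Euc (n + 1) →L[ℝ] Euc n :=
  LinearMap.toContinuousLinearMap
    { toFun := hor
      map_add' := fun _ _ => rfl
      map_smul' := fun _ _ => rfl }

lemma horL_apply (x : Euc (n + 1)) : horL n x = hor x := rfl

lemma norm_hor_le (x : Euc (n + 1)) : ‖hor x‖ ≤ ‖x‖ := by
  rw [EuclideanSpace.norm_eq, EuclideanSpace.norm_eq, Fin.sum_univ_castSucc]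
  refine Real.sqrt_le_sqrt ?_
  have : ∀ i, hor x i = x i.castSucc := fun _ => rfl
  simp_rw [this]
  exact le_add_of_nonneg_right (by positivity)

lemma hor_incl (y : Euc n) : hor (incl y) = y := by
  ext i
  rw [hor_apply, incl_castSucc]

lemma integrable_sq_norm (hb : MemLp b 2 (volume.restrict (cube n l))) :
    IntegrableOn (fun x => ‖b x‖ ^ 2 / 2) (cube n l) :=
  ((memLp_two_iff_integrable_sq_norm hb.1).1 hb).div_const 2

lemma exists_bound_deriv_bump (κ : ContDiffBump (0 : ℝ)) :
    ∃ M : ℝ, 0 ≤ M ∧ ∀ t, ‖fderiv ℝ κ t‖ ≤ M := by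
  have hC : ContDiff ℝ 1 κ := κ.contDiff
  obtain ⟨M, hM⟩ := (κ.hasCompactSupport.fderiv ℝ).exists_bound_of_continuous
    (hC.continuous_fderiv one_ne_zero)
  exact ⟨M, (norm_nonneg _).trans (hM 0), hM⟩

/-- The charge tested with a smooth function is controlled by the field energy. -/
lemma exists_integral_mul_le (n : ℕ) (D : ℝ) (hD : 0 ≤ D) :
    ∃ A : ℝ, 0 < A ∧ ∀ (l : ℝ) (u : Euc n → ℝ) (b : Euc (n + 1) → Euc (n + 1)) (w : Euc n → ℝ)
      (R K : ℝ), 1 ≤ l → l ≤ 2 → (u, b) ∈ admissible n l → ContDiff ℝ ∞ w → (∀ y, |w y| ≤ 1) →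
      (∀ y, ‖fderiv ℝ w y‖ ≤ D) → R < l / 2 → (∀ y, R < ‖y‖ → w y = 0) → 0 < K →
      ∫ y in bottom n l, u y * w y ≤ K * (∫ x in cube n l, ‖b x‖ ^ 2 / 2) + A / K := by
  set κ : ContDiffBump (0 : ℝ) := ⟨1 / 8, 1 / 4, by norm_num, by norm_num⟩ with hκ
  obtain ⟨M, hM0, hM⟩ := exists_bound_deriv_bump κ
  -- Young's inequality leaves `(D + M) ^ 2 / (2 * K)` per unit volume, and the volume is at most `2
  -- ^ n * 2`; the summand 1 gives positivity.
  refine ⟨(D + M) ^ 2 * 2 ^ n + 1, by positivity, ?_⟩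
  intro l u b w R K hl1 hl2 hp hw hw1 hwD hR hwR hK
  obtain ⟨hu, hvar, hb, htest⟩ := hp
  simp only at hu hvar hb
  have hl : 0 < l := by linarith
  -- The function `w` is extended into the cube by a vertical cutoff equal to one at height 0 and
  -- zero above height `1 / 4`, well below the top since `l ≥ 1`.
  set ζ : Euc (n + 1) → ℝ := fun x => w (horL n x) * κ (x (Fin.last n)) with hζ
  have hκC : ContDiff ℝ ∞ κ := κ.contDiff
  have hlastC : ContDiff ℝ ∞ fun x : Euc (n + 1) => x (Fin.last n) := by fun_prop
  have hζC : ContDiff ℝ ∞ ζ := (hw.comp (horL n).contDiff).mul (hκC.comp hlastC)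
  have hsupp : tsupport ζ ⊆ {x | ‖hor x‖ ≤ R ∧ |x (Fin.last n)| ≤ 1 / 4} := by
    refine closure_minimal (fun x hx => ?_) ?_
    · have h1 : w (hor x) ≠ 0 := left_ne_zero_of_mul hx
      have h2 : κ (x (Fin.last n)) ≠ 0 := right_ne_zero_of_mul hx
      constructor
      · by_contra h
        exact h1 (hwR _ (not_le.1 h))
      · have h3 : x (Fin.last n) ∈ Function.support κ := h2
        rw [κ.support_eq, mem_ball_zero_iff] at h3
        exact h3.le
    · exact (isClosed_le ((horL n).continuous.norm) continuous_const).inter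
        (isClosed_le (show Continuous fun x : Euc (n + 1) => |x (Fin.last n)| by fun_prop)
          continuous_const)
  have hcompact : HasCompactSupport ζ := by
    refine isCompact_tsupport_of_isBounded (isBounded_of_coord_le (max R (1 / 4)) fun x hx i => ?_)
    refine Fin.lastCases ?_ (fun i => ?_) i
    · exact (hsupp hx).2.trans (le_max_right _ _)
    · exact ((abs_coord_le_norm (hor x) i).trans (hsupp hx).1).trans (le_max_left _ _)
  have key := htest ζ hζC hcompact fun x hx =>
    ⟨fun i => ((abs_coord_le_norm (hor x) i).trans (hsupp hx).1).trans_lt hR,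
      lt_of_le_of_lt (le_abs_self _) ((hsupp hx).2.trans_lt (by linarith))⟩
  unfold TestedBy at key
  have hincl : ∀ y : Euc n, ζ (incl y) = w y := by
    intro y
    have : κ (0 : ℝ) = 1 := κ.one_of_mem_closedBall (by simp [κ.rIn_pos.le])
    simp only [hζ, horL_apply, hor_incl, incl_last, this, mul_one]
  simp_rw [hincl] at key
  have hder : ∀ x v, |fderiv ℝ ζ x v| ≤ (D + M) * ‖v‖ := by
    intro x v
    have h1 : HasFDerivAt (fun x => w (horL n x)) ((fderiv ℝ w (horL n x)).comp (horL n)) x :=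
      ((hw.differentiable (by simp) _).hasFDerivAt).comp x (horL n).hasFDerivAt
    have h2 : HasFDerivAt (fun x : Euc (n + 1) => κ (x (Fin.last n)))
        ((fderiv ℝ κ (x (Fin.last n))).comp
          (EuclideanSpace.proj (Fin.last n) : Euc (n + 1) →L[ℝ] ℝ)) x :=
      ((hκC.differentiable (by simp) _).hasFDerivAt).comp x
        (EuclideanSpace.proj (Fin.last n) : Euc (n + 1) →L[ℝ] ℝ).hasFDerivAt
    have hζ' : ζ = (fun x => w (horL n x)) * fun x => κ (x (Fin.last n)) := rfl
    rw [hζ', (h1.mul h2).fderiv]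
    have h3 : |fderiv ℝ w (horL n x) (hor v)| ≤ D * ‖v‖ :=
      ((fderiv ℝ w (horL n x)).le_of_opNorm_le (hwD _) _).trans
        (mul_le_mul_of_nonneg_left (norm_hor_le v) hD)
    have h4 : |fderiv ℝ κ (x (Fin.last n)) (v (Fin.last n))| ≤ M * ‖v‖ :=
      ((fderiv ℝ κ (x (Fin.last n))).le_of_opNorm_le (hM _) _).trans
        (mul_le_mul_of_nonneg_left (abs_coord_le_norm v _) hM0)
    have h5 : |κ (x (Fin.last n))| ≤ 1 := by
      rw [abs_of_nonneg κ.nonneg]; exact κ.le_one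
    calc _ = |w (horL n x) * fderiv ℝ κ (x (Fin.last n)) (v (Fin.last n))
          + κ (x (Fin.last n)) * fderiv ℝ w (horL n x) (hor v)| := rfl
      _ ≤ |w (horL n x)| * |fderiv ℝ κ (x (Fin.last n)) (v (Fin.last n))|
          + |κ (x (Fin.last n))| * |fderiv ℝ w (horL n x) (hor v)| := by
        rw [← abs_mul, ← abs_mul]; exact abs_add_le _ _
      _ ≤ 1 * (M * ‖v‖) + 1 * (D * ‖v‖) := by
        gcongr
        exact hw1 _
      _ = _ := by ring
  have hyoung : ∀ x, -(fderiv ℝ ζ x (b x)) ≤ K * (‖b x‖ ^ 2 / 2) + (D + M) ^ 2 / (2 * K) := by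
    intro x
    have h1 := (neg_le_abs _).trans (hder x (b x))
    have h2 : 0 ≤ (K * ‖b x‖ - (D + M)) ^ 2 / (2 * K) := by positivity
    have h3 : (K * ‖b x‖ - (D + M)) ^ 2 / (2 * K)
        = K * (‖b x‖ ^ 2 / 2) + (D + M) ^ 2 / (2 * K) - (D + M) * ‖b x‖ := by
      field_simp; ring
    linarith
  have hvol : volume.real (cube n l) ≤ 2 ^ n * 2 := by
    have h1 : volume (cube n l) = ENNReal.ofReal (l ^ n * l) := by
      change volume (col n l l) = _
      rw [volume_col hl.le, ← ENNReal.ofReal_mul (by positivity)]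
    rw [measureReal_def, h1, ENNReal.toReal_ofReal (by positivity)]
    gcongr
  have hcol := volume_lt_top_of_isBounded (isBounded_col n l l)
  have hi1 : IntegrableOn (fun x => fderiv ℝ ζ x (b x)) (cube n l) :=
    integrableOn_apply (isBounded_col n l l) (isOpen_col n l l).measurableSet
      (integrableOn_of_memLp_two (isBounded_col n l l) hb)
      (hζC.continuous_fderiv (by simp))
  have hi2 := integrable_sq_norm hb
  have hi3 : IntegrableOn (fun _ : Euc (n + 1) => (D + M) ^ 2 / (2 * K)) (cube n l) :=
    integrableOn_const hcol.ne
  calc ∫ y in bottom n l, u y * w y = ∫ x in cube n l, -(fderiv ℝ ζ x (b x)) := by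
        rw [integral_neg, key, neg_neg]
    _ ≤ ∫ x in cube n l, (K * (‖b x‖ ^ 2 / 2) + (D + M) ^ 2 / (2 * K)) :=
        integral_mono hi1.neg ((hi2.const_mul K).add hi3) hyoung
    _ = K * (∫ x in cube n l, ‖b x‖ ^ 2 / 2)
          + volume.real (cube n l) * ((D + M) ^ 2 / (2 * K)) := by
        rw [integral_add (hi2.const_mul K) hi3, integral_const_mul, setIntegral_const, smul_eq_mul]
    _ ≤ K * (∫ x in cube n l, ‖b x‖ ^ 2 / 2) + (2 ^ n * 2) * ((D + M) ^ 2 / (2 * K)) := by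
        gcongr
    _ ≤ K * (∫ x in cube n l, ‖b x‖ ^ 2 / 2) + ((D + M) ^ 2 * 2 ^ n + 1) / K := by
        gcongr
        have h1 : (2 ^ n * 2) * ((D + M) ^ 2 / (2 * K)) = ((D + M) ^ 2 * 2 ^ n) / K := by
          field_simp
        rw [h1]
        gcongr
        linarith

lemma toReal_fieldEnergy (hb : MemLp b 2 (volume.restrict (cube n l))) :
    fieldEnergy n l b = ENNReal.ofReal (∫ x in cube n l, ‖b x‖ ^ 2 / 2) := by
  unfold fieldEnergy
  rw [ofReal_integral_eq_lintegral_ofReal (integrable_sq_norm hb)]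
  exact ae_of_all _ fun x => by positivity

/-- On cubes of size of order one the energy is bounded from below. -/
lemma exists_le_energy (n : ℕ) : ∃ c : ℝ, 0 < c ∧ ∀ (l : ℝ), 1 ≤ l → l ≤ 2 →
    ∀ p ∈ admissible n l, ENNReal.ofReal c ≤ energy n l p := by
  set η : ContDiffBump (0 : Euc n) := ⟨1 / 16, 1 / 8, by norm_num, by norm_num⟩ with hη
  set ρ : ContDiffBump (0 : Euc n) := ⟨1 / 16, 1 / 8, by norm_num, by norm_num⟩ with hρ
  set D : ℝ := ∫ t, ‖fderiv ℝ (ρ.normed (volume : Measure (Euc n))) t‖ with hD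
  obtain ⟨A, hA, htest⟩ := exists_integral_mul_le n D (integral_nonneg fun _ => norm_nonneg _)
  set m : ℝ := ∫ y, η y with hm
  have hm0 : 0 < m := η.integral_pos
  -- This choice makes `A / K = m / 2`, so that half of `m` survives and must be paid by variation
  -- and field energy.
  set K : ℝ := 2 * A / m with hK
  have hK0 : 0 < K := by positivity
  have hAK : A / K = m / 2 := by
    rw [hK]; field_simp
  refine ⟨m / 2 / (1 / 8 + K), by positivity, ?_⟩
  rintro l hl1 hl2 ⟨u, b⟩ hp
  have hp' := hp
  obtain ⟨hu, hvar, hb, -⟩ := hp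
  simp only at hu hvar hb
  have hbm := (isOpen_bottom n l).measurableSet
  set V : ℝ := (variation (bottom n l) u).toReal with hV
  set F : ℝ := ∫ x in cube n l, ‖b x‖ ^ 2 / 2 with hF
  have hF0 : 0 ≤ F := integral_nonneg fun x => by positivity
  have hηout : ∀ y : Euc n, 1 / 8 < ‖y‖ → η y = 0 := by
    intro y hy
    by_contra h
    have h1 : y ∈ Function.support η := h
    rw [η.support_eq, mem_ball_zero_iff] at h1
    exact absurd h1 (not_lt.2 hy.le)
  have hηin : ∀ y, y ∉ bottom n l → η y = 0 := fun y hy => by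
    refine hηout y ?_
    by_contra h
    exact hy (mem_bottom_of_norm_lt (by linarith))
  -- The truncation changes `u` on a null set only, but provides the pointwise bound that the
  -- mollification lemmas ask for.
  set f : Euc n → ℝ := (bottom n l).indicator fun y => max (-1) (min 1 (u y)) * η y with hf
  have hfm : AEStronglyMeasurable f volume := by
    rw [hf, aestronglyMeasurable_indicator_iff hbm]
    refine AEStronglyMeasurable.mul ?_ η.continuous.aestronglyMeasurable
    exact (show Continuous fun t : ℝ => max (-1) (min 1 t) by fun_prop).comp_aestronglyMeasurable
      hu.1
  have hf1 : ∀ y, |f y| ≤ 1 := by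
    intro y
    by_cases hy : y ∈ bottom n l
    · rw [hf, indicator_of_mem hy, abs_mul, abs_of_nonneg η.nonneg]
      refine mul_le_one₀ (abs_le.2 ⟨le_max_left _ _, max_le (by norm_num) (min_le_left _ _)⟩)
        η.nonneg η.le_one
    · rw [hf, indicator_of_notMem hy, abs_zero]
      exact zero_le_one
  have hfR : ∀ y, 1 / 8 < ‖y‖ → f y = 0 := by
    intro y hy
    by_cases hyb : y ∈ bottom n l
    · rw [hf, indicator_of_mem hyb, hηout y hy, mul_zero]
    · rw [hf, indicator_of_notMem hyb]
  have hfl := locallyIntegrable_of_bound hfm hf1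
  set φ : ℕ → ContDiffBump (0 : Euc n) := fun j =>
    ⟨1 / (16 * (j + 1)), 1 / (8 * (j + 1)), by positivity, by
      rw [div_lt_div_iff₀ (by positivity) (by positivity)]
      have : (0 : ℝ) ≤ j := Nat.cast_nonneg j
      linarith⟩ with hφ
  have hφ8 : ∀ j, (φ j).rOut ≤ 1 / 8 := fun j => by
    simp only [hφ]
    rw [div_le_div_iff₀ (by positivity) (by positivity)]
    have : (0 : ℝ) ≤ j := Nat.cast_nonneg j
    linarith
  -- Two scales: `φ j` shrinks and only serves to replace `f` by smooth functions, while `ρ` stays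
  -- fixed and gives the gradient bound `D`. The supports have radii `1/8`, then `1/4`, then `3/8`,
  -- still below `l / 2`.
  set g : ℕ → Euc n → ℝ := fun j => mollify (φ j) f with hg
  have hgC : ∀ j, ContDiff ℝ ∞ (g j) := fun j => contDiff_mollify _ hfl
  have hg1 : ∀ j y, |g j y| ≤ 1 := fun j y => abs_mollify_le _ hf1 y
  have hgR : ∀ j y, 1 / 4 < ‖y‖ → g j y = 0 := fun j y hy =>
    mollify_eq_zero _ hfR (by linarith [hφ8 j])
  have hgl : ∀ j, LocallyIntegrable (g j) volume := fun j =>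
    locallyIntegrable_of_bound (hgC j).continuous.aestronglyMeasurable (hg1 j)
  have hbound : ∀ j, ∫ y in bottom n l, u y * g j y ≤ 1 / 8 * V + (K * F + A / K) := by
    intro j
    have hwC : ContDiff ℝ ∞ (mollify ρ (g j)) := contDiff_mollify ρ (hgl j)
    have h1 : ∫ y in bottom n l, u y * (g j y - mollify ρ (g j) y) ≤ 1 / 8 * V :=
      integral_sub_mollify_le hu hvar ((hgC j).of_le (by exact_mod_cast le_top)) (hg1 j) ρ
        (R := 1 / 4) (by change (1 : ℝ) / 4 + 1 / 8 < l / 2; linarith) (hgR j)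
    have h2 : ∫ y in bottom n l, u y * mollify ρ (g j) y ≤ K * F + A / K :=
      htest l u b (mollify ρ (g j)) (1 / 4 + 1 / 8) K hl1 hl2 hp' hwC
        (abs_mollify_le ρ (hg1 j)) (norm_fderiv_mollify_le ρ (hgl j) (hg1 j)) (by linarith)
        (fun y hy => mollify_eq_zero ρ (hgR j) hy) hK0
    simp_rw [mul_sub] at h1
    rw [integral_sub (hu.integrableOn_mul (hgC j).continuous)
      (hu.integrableOn_mul hwC.continuous)] at h1
    linarith
  -- Since `u ^ 2 = 1`, `u * f` is `η` almost everywhere on the cell; the mollifications converge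
  -- almost everywhere, which needs the radii of `φ j` to have a bounded ratio.
  have hlim : Tendsto (fun j => ∫ y in bottom n l, u y * g j y) atTop (𝓝 m) := by
    have hm' : m = ∫ y in bottom n l, u y * f y := by
      rw [hm, ← setIntegral_eq_integral_of_forall_compl_eq_zero hηin]
      refine integral_congr_ae ?_
      filter_upwards [ae_restrict_mem hbm, hu.2] with y hy hy1
      rw [hf, indicator_of_mem hy]
      rcases hy1 with h | h <;> rw [h] <;> norm_num
    rw [hm']
    have : IsFiniteMeasure (volume.restrict (bottom n l)) :=
      isFiniteMeasure_restrict.2 (volume_lt_top_of_isBounded (isBounded_bottom n l)).ne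
    refine tendsto_integral_of_dominated_convergence (fun _ => 1)
      (fun j => hu.1.mul (hgC j).continuous.aestronglyMeasurable) (integrable_const 1)
      (fun j => ?_) ?_
    · filter_upwards [hu.ae_abs_eq] with y hy
      rw [norm_mul, Real.norm_eq_abs, hy, one_mul]
      exact hg1 j y
    · have hconv := ContDiffBump.ae_convolution_tendsto_right_of_locallyIntegrable (φ := φ)
        (l := atTop) (K := 2) (μ := volume) ?_ (Eventually.of_forall fun j => ?_) hfl
      · filter_upwards [ae_restrict_of_ae hconv] with y hy
        exact hy.const_mul _
      · simp only [hφ]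
        have h1 := (tendsto_one_div_add_atTop_nhds_zero_nat (𝕜 := ℝ)).const_mul (1 / 8)
        rw [mul_zero] at h1
        refine h1.congr fun j => ?_
        field_simp
      · simp only [hφ]
        refine le_of_eq ?_
        field_simp
        norm_num
  have hmle : m ≤ 1 / 8 * V + (K * F + A / K) := le_of_tendsto' hlim hbound
  have hV0 : 0 ≤ V := ENNReal.toReal_nonneg
  have hle : m / 2 / (1 / 8 + K) ≤ V + F := by
    rw [div_le_iff₀ (by positivity)]
    rw [hAK] at hmle
    have := mul_nonneg hK0.le hV0
    linarith
  unfold energy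
  simp only
  rw [toReal_fieldEnergy hb, ← ENNReal.ofReal_toReal hvar.ne, ← ENNReal.ofReal_add hV0 hF0]
  exact ENNReal.ofReal_le_ofReal hle

/-- Monotonicity along multiples reduces `L` to the side `L / ⌊L⌋₊` in `[1, 2]`, where the
normalising area is at most `2 ^ n`. -/
lemma exists_le_sigma (n : ℕ) :
    ∃ c : ℝ, 0 < c ∧ ∀ L : ℝ, 1 ≤ L → ENNReal.ofReal c ≤ sigma n L := by
  obtain ⟨c, hc, h⟩ := exists_le_energy n
  refine ⟨c / 2 ^ n, by positivity, fun L hL => ?_⟩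
  have hk : 0 < ⌊L⌋₊ := Nat.floor_pos.2 hL
  have hk' : (0 : ℝ) < ⌊L⌋₊ := by exact_mod_cast hk
  have h1 : (⌊L⌋₊ : ℝ) ≤ L := Nat.floor_le (by linarith)
  have h2 : L < ⌊L⌋₊ + 1 := Nat.lt_floor_add_one L
  have h3 : (1 : ℝ) ≤ ⌊L⌋₊ := by exact_mod_cast hk
  have h4 : L = ⌊L⌋₊ * (L / ⌊L⌋₊) := by field_simp
  have hl1 : 1 ≤ L / ⌊L⌋₊ := by rw [le_div_iff₀ hk']; linarith
  have hl2 : L / ⌊L⌋₊ ≤ 2 := by rw [div_le_iff₀ hk']; linarith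
  rw [h4]
  refine le_trans ?_ (sigma_le_sigma_mul (by positivity) hk)
  refine le_iInf₂ fun p hp => ?_
  rw [ENNReal.ofReal_div_of_pos (by positivity)]
  exact ENNReal.div_le_div (h _ hl1 hl2 p hp) (ENNReal.ofReal_le_ofReal (by gcongr))

end LowerBound

end ThinCharge

end

/-! ### Choice of the constants. -/

theorem mainTheorem10 (n : ℕ) (hn : 1 ≤ n) :
    ∃ C : ℝ, 0 < C ∧ ∃ L₀ : ℝ, 0 < L₀ ∧ ∀ L : ℝ, L₀ ≤ L →
      (ThinCharge.sigma n L ≤ ThinCharge.sigmaPer n L ∧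
        ThinCharge.sigma n L ≤ ThinCharge.sigmaZero n L) ∧
      (∀ k : ℕ, 0 < k → ThinCharge.sigma n L ≤ ThinCharge.sigma n (k * L)) ∧
      (∀ k : ℕ, 0 < k → ThinCharge.sigmaZero n (k * L) ≤ ThinCharge.sigmaZero n L) ∧
      ThinCharge.sigmaZero n L ≤ ENNReal.ofReal C ∧
      ENNReal.ofReal (1 / C) ≤ ThinCharge.sigma n L ∧
      ThinCharge.sigmaPer n L ≤ ThinCharge.sigma n L + ENNReal.ofReal (C / L) := by
  obtain ⟨C₁, hC₁, h₁⟩ := ThinCharge.exists_sigmaZero_le n hn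
  obtain ⟨c, hc, h₂⟩ := ThinCharge.exists_le_sigma n
  obtain ⟨C₃, hC₃, h₃⟩ := ThinCharge.exists_sigmaPer_le n hn
  -- The sum dominates both upper constants, and its inverse is at most `c`.
  refine ⟨C₁ + 1 / c + C₃, by positivity, 1, one_pos, fun L hL => ?_⟩
  have hL0 : 0 < L := by linarith
  have hc' : 0 < 1 / c := by positivity
  refine ⟨⟨ThinCharge.sigma_le_sigmaPer hL0, ThinCharge.sigma_le_sigmaZero⟩,
    fun k hk => ThinCharge.sigma_le_sigma_mul hL0 hk,
    fun k hk => ThinCharge.sigmaZero_mul_le hL0 hk,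
    (h₁ L hL).trans (ENNReal.ofReal_le_ofReal (by linarith)),
    (ENNReal.ofReal_le_ofReal ?_).trans (h₂ L hL),
    (h₃ L hL0).trans (add_le_add le_rfl (ENNReal.ofReal_le_ofReal ?_))⟩
  · rw [div_le_iff₀ (by positivity)]
    have h4 : c * (1 / c) = 1 := by field_simp
    nlinarith [mul_pos hc hC₁, mul_pos hc hC₃]
  · gcongr
    linarith
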